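/- Let $(W_i)_{i\ge1}$ be i.i.d. copies of a random variable $W>0$ with $\sup\{x\in\mathbb R:\mathbb P(W\le x)<1\}=1$ and $\mathbb P(W=1)=q_0$ for some $q_0\in(0,1]$ (the Atom case). The weighted recursive tree (WRT) starts from the single vertex $1$; conditionally on the weights, for each $n\ge1$, independently, vertex $n+1$ is connected by one edge, directed towards the older vertex, to vertex $i\in\{1,\dots,n\}$ with probability $W_i/(W_1+\dots+W_n)$. Let $\mathcal Z_n(i)$ be the in-degree of $i$ in the tree on the vertices $1,\dots,n$. Put $$\theta:=1+\mathbb E[W],\quad \mu:=1-\frac{\theta-1}{\theta\log\theta},\quad \sigma^2:=1-\frac{(\theta-1)^2}{\theta^2\log\theta},\quad \varepsilon_n:=\log_\theta n-\lfloor\log_\theta n\rfloor,$$ let $\Phi(B)$ be the standard Gaussian measure of $B\subseteq\mathbb R$, and write $(x)_0:=1$, $(x)_k:=x(x-1)\cdots(x-k+1)$. For $j\in\mathbb Z$ and $d:=\lfloor\log_\theta n\rfloor+j$ define $$X^{(n)}_j(B):=\Big|\Big\{1\le i\le n:\ \mathcal Z_n(i)=d,\ \frac{\log i-(\log n-(1-\theta^{-1})d)}{\sqrt{(1-\theta^{-1})^2d}}\in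 B\Big\}\Big|,\qquad \widetilde X^{(n)}_j(B):=\Big|\Big\{1\le i\le n:\ \mathcal Z_n(i)=d,\ \frac{\log i-\mu\log n}{\sqrt{(1-\sigma^2)\log n}}\in B\Big\}\Big|,$$ and let $X^{(n)}_{\ge j}(B)$, $\widetilde X^{(n)}_{\ge j}(B)$ be defined in the same way with $\mathcal Z_n(i)\ge d$ in place of $\mathcal Z_n(i)=d$. Fix $c\in(0,\theta/(\theta-1))$, $K\in\mathbb N$ and $c_1,\dots,c_K\in\{0,1,2,\dots\}$. Let $j_k=j_k(n)$, $1\le k\le K$, be integers, possibly depending on $n$, such that, for all large $n$, $j_1\le\dots\le j_K$ and $j_K+\log_\theta n<c\log n$, and such that $j_1+\log_\theta n\to\infty$ as $n\to\infty$. Let $K'=K'(n):=\min\{k\ge0:j_{k+1}=j_K\}$. Let $B_1,\dots,B_K\subseteq\mathbb R$ be Borel sets, not depending on $n$, with Lebesgue-null boundaries, each of them either empty or of positive Lebesgue measure (for example half-open intervals $(a_k,b_k]$), such that, for all large $n$, $B_k\cap B_\ell=\emptyset$ whenever $k\ne\ell$ and $j_k=j_\ell$. Then, as $n\to\infty$,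 $$\mathbb E\Big[\prod_{k=1}^{K'}\big(X^{(n)}_{j_k}(B_k)\big)_{c_k}\prod_{k=K'+1}^{K}\big(X^{(n)}_{\ge j_k}(B_k)\big)_{c_k}\Big]=(1+o(1))\prod_{k=1}^{K'}\big(q_0(1-\theta^{-1})\theta^{-j_k+\varepsilon_n}\Phi(B_k)\big)^{c_k}\prod_{k=K'+1}^{K}\big(q_0\theta^{-j_K+\varepsilon_n}\Phi(B_k)\big)^{c_k}.$$ If moreover $j_k=o(\sqrt{\log n})$ for every $k$, the same asymptotic equality holds with $\widetilde X^{(n)}_{j_k}(B_k)$ and $\widetilde X^{(n)}_{\ge j_k}(B_k)$ in place of $X^{(n)}_{j_k}(B_k)$ and $X^{(n)}_{\ge j_k}(B_k)$. -/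

import Mathlib

open MeasureTheory ProbabilityTheory Filter
open scoped Topology Asymptotics

namespace WRT

/-- The total weight `S_n = W_1 + ⋯ + W_n` of the vertices `1, …, n`. -/
noncomputable def totalWeight {Ω : Type*} (W : ℕ → Ω → ℝ) (n : ℕ) (ω : Ω) : ℝ :=
  ∑ i ∈ Finset.Icc 1 n, W i ω

/-- The σ-algebra generated by all vertex-weights `W_1, W_2, …`. -/
abbrev weightSigma {Ω : Type*} (W : ℕ → Ω → ℝ) : MeasurableSpace Ω :=
  ⨆ k : ℕ, MeasurableSpace.comap (W (k + 1)) inferInstance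

/-- The weighted recursive tree. Vertices are `1, 2, 3, …`; `W i` is the weight of vertex `i ≥ 1`
and, for `n ≥ 1`, `A n` is the vertex of `{1, …, n}` to which the new vertex `n + 1` is connected
(`W 0` and `A 0` play no role). The weights are i.i.d. and positive; conditionally on the weights,
the attachments are independent and vertex `n + 1` is connected to `i ∈ {1, …, n}` with
probability `W_i / S_n`. -/
structure IsWRT {Ω : Type*} [MeasurableSpace Ω] (P : Measure Ω)
    (W : ℕ → Ω → ℝ) (A : ℕ → Ω → ℕ) : Prop where
  measurable_weight : ∀ i, 1 ≤ i → Measurable (W i)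
  indep_weight : iIndepFun (fun k : ℕ => W (k + 1)) P
  identDistrib_weight : ∀ i, 1 ≤ i → IdentDistrib (W i) (W 1) P P
  pos_weight : ∀ i, 1 ≤ i → ∀ᵐ ω ∂P, 0 < W i ω
  measurable_attach : ∀ n, 1 ≤ n → Measurable (A n)
  attach_law : ∀ (N : ℕ) (a : ℕ → ℕ), (∀ n ∈ Finset.Ico 1 N, a n ∈ Finset.Icc 1 n) →
    P⟦{ω | ∀ n ∈ Finset.Ico 1 N, A n ω = a n} | weightSigma W⟧
      =ᵐ[P] fun ω => ∏ n ∈ Finset.Ico 1 N, W (a n) ω / totalWeight W n ω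

/-- The (Atom) case: the essential supremum `sup {x : P(W ≤ x) < 1}` of the weight distribution
is one, and the distribution has an atom of mass `q₀ ∈ (0, 1]` at one. -/
structure AtomCase {Ω : Type*} [MeasurableSpace Ω] (P : Measure Ω)
    (W : ℕ → Ω → ℝ) (q₀ : ℝ) : Prop where
  essSup_eq_one : IsLUB {x : ℝ | P {ω | W 1 ω ≤ x} < 1} 1
  q₀_mem : q₀ ∈ Set.Ioc (0 : ℝ) 1
  atom : P.real {ω | W 1 ω = 1} = q₀

/-- `θ = 1 + E[W]`. -/
noncomputable def theta {Ω : Type*} [MeasurableSpace Ω] (P : Measure Ω) (W : ℕ → Ω → ℝ) : ℝ :=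
  1 + ∫ ω, W 1 ω ∂P

/-- `μ = 1 - (θ - 1) / (θ log θ)`. -/
noncomputable def mu (θ : ℝ) : ℝ := 1 - (θ - 1) / (θ * Real.log θ)

/-- `σ² = 1 - (θ - 1)² / (θ² log θ)`. -/
noncomputable def sigmaSq (θ : ℝ) : ℝ := 1 - (θ - 1) ^ 2 / (θ ^ 2 * Real.log θ)

/-- `Φ(B)`, the standard Gaussian measure of `B`. -/
noncomputable def Phi (B : Set ℝ) : ℝ := (gaussianReal 0 1).real B

/-- The in-degree of vertex `i` in the tree on the vertices `1, …, n`: the number of vertices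
`m + 1 ∈ {2, …, n}` that were connected to `i`. -/
def inDegree {Ω : Type*} (A : ℕ → Ω → ℕ) (n i : ℕ) (ω : Ω) : ℕ :=
  ((Finset.Ico 1 n).filter fun m => A m ω = i).card

/-- The degree level `⌊log_θ n⌋ + j`. -/
noncomputable def level (θ : ℝ) (n : ℕ) (j : ℤ) : ℤ := ⌊Real.logb θ n⌋ + j

/-- The label `i`, rescaled with the degree-dependent normalisation
`(log i - (log n - (1 - θ⁻¹) d)) / √((1 - θ⁻¹)² d)`, where `d = ⌊log_θ n⌋ + j`. -/
noncomputable def labelDeg (θ : ℝ) (n : ℕ) (j : ℤ) (i : ℕ) : ℝ :=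
  (Real.log i - (Real.log n - (1 - θ⁻¹) * (level θ n j : ℝ))) /
    √((1 - θ⁻¹) ^ 2 * (level θ n j : ℝ))

/-- The label `i`, rescaled as `(log i - μ log n) / √((1 - σ²) log n)`. -/
noncomputable def labelMu (θ : ℝ) (n : ℕ) (i : ℕ) : ℝ :=
  (Real.log i - mu θ * Real.log n) / √((1 - sigmaSq θ) * Real.log n)

open Classical in
/-- `X^{(n)}_j(B)`. -/
noncomputable def X {Ω : Type*} (A : ℕ → Ω → ℕ) (θ : ℝ) (n : ℕ) (j : ℤ) (B : Set ℝ) (ω : Ω) : ℕ :=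
  ((Finset.Icc 1 n).filter fun i =>
    (inDegree A n i ω : ℤ) = level θ n j ∧ labelDeg θ n j i ∈ B).card

open Classical in
/-- `X^{(n)}_{≥ j}(B)`. -/
noncomputable def XGe {Ω : Type*} (A : ℕ → Ω → ℕ) (θ : ℝ) (n : ℕ) (j : ℤ) (B : Set ℝ)
    (ω : Ω) : ℕ :=
  ((Finset.Icc 1 n).filter fun i =>
    level θ n j ≤ (inDegree A n i ω : ℤ) ∧ labelDeg θ n j i ∈ B).card

open Classical in
/-- `X̃^{(n)}_j(B)`. -/
noncomputable def XTilde {Ω : Type*} (A : ℕ → Ω → ℕ) (θ : ℝ) (n : ℕ) (j : ℤ) (B : Set ℝ)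
    (ω : Ω) : ℕ :=
  ((Finset.Icc 1 n).filter fun i =>
    (inDegree A n i ω : ℤ) = level θ n j ∧ labelMu θ n i ∈ B).card

open Classical in
/-- `X̃^{(n)}_{≥ j}(B)`. -/
noncomputable def XTildeGe {Ω : Type*} (A : ℕ → Ω → ℕ) (θ : ℝ) (n : ℕ) (j : ℤ) (B : Set ℝ)
    (ω : Ω) : ℕ :=
  ((Finset.Icc 1 n).filter fun i =>
    level θ n j ≤ (inDegree A n i ω : ℤ) ∧ labelMu θ n i ∈ B).card

/-- `K' = min {k ≥ 0 : j_{k+1} = j_K}`, for a tuple `j_1, …, j_K` with `K ≥ 1`. -/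
noncomputable def cutoff (K : ℕ) (j : ℕ → ℤ) : ℕ := sInf {k : ℕ | j (k + 1) = j K}

/-- `ε_n = log_θ n - ⌊log_θ n⌋`. -/
noncomputable def eps (θ : ℝ) (n : ℕ) : ℝ := Real.logb θ n - ⌊Real.logb θ n⌋

/-- The asymptotic value of the joint factorial moments,
`∏_{k ≤ K'} (q₀ (1 - θ⁻¹) θ^(-j_k + ε_n) Φ(B_k))^{c_k}`
times `∏_{K' < k ≤ K} (q₀ θ^(-j_K + ε_n) Φ(B_k))^{c_k}`. -/
noncomputable def momentValue (q₀ θ : ℝ) (K : ℕ) (n : ℕ) (j : ℕ → ℤ) (B : ℕ → Set ℝ)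
    (c : ℕ → ℕ) : ℝ :=
  (∏ k ∈ Finset.Icc 1 (cutoff K j),
      (q₀ * (1 - θ⁻¹) * θ ^ (-(j k : ℝ) + eps θ n) * Phi (B k)) ^ c k) *
    ∏ k ∈ Finset.Icc (cutoff K j + 1) K,
      (q₀ * θ ^ (-(j K : ℝ) + eps θ n) * Phi (B k)) ^ c k

end WRT

set_option linter.unusedSectionVars false

namespace WRT

/-! A product of falling factorials counts ordered tuples of distinct vertices, so its expectation
is a sum over tuples of the probability that every vertex has its degree in the prescribed window
and its label in the prescribed set. Given the weights, the degree of `v` is a sum of independent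
indicators with success probabilities `W_v / S_m`, `v ≤ m < n`. Since `S_m ≈ (θ - 1) m`, this degree
is nearly Poisson with mean `t log (n / v)`, `t = W_v / (θ - 1)`, and the degrees of finitely many
vertices with large labels are nearly independent.

With `v = n e^{-y}` the expected number of vertices of degree `d` becomes `n ∫ e^{-y} pois (t y) d
dy = n t^d / (1 + t)^(d + 1)`, a geometric law. For weight one this is `n (1 - θ⁻¹) θ^{-d}`; for a
weight below one the ratio `t / (1 + t)` is smaller than `θ⁻¹` and the contribution is exponentially
smaller in `d`. Hence only the atom matters, which produces `q₀`. The integrand is a multiple of a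
Gamma density of shape `d + 1`, with mean about `(1 - θ⁻¹) d` and standard deviation about `(1 -
θ⁻¹) √d`; its Gaussian limit is the law of the rescaled label. These deterministic asymptotics are
`Admissible.tendsto_sum` and, averaged over the weight, `Admissible.tendsto_integral_windowSum` and
`Admissible.tendsto_sum_integral_windowSum`.

Upper bound. Weight sequences with irregular partial sums have probability below any prescribed
power of `n` (`exists_prob_not_good_le`), which beats the trivial count of tuples. Tuples with a
label below `n^η` are removed by an exponential Markov inequality with a tilt slightly smaller than
`θ` (`exists_tilt`); this is where degrees below `(θ / (θ - 1)) log n` are needed. For the remaining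
tuples `Regular.degProb_le_pois` compares the joint law with a product of Poisson laws, and
independence of the weights factorises the sum.

Lower bound. Only tuples of vertices of weight one are kept, with degree windows cut to finitely
many levels; `Regular.pois_le_degProb` gives the Poisson lower bound, and tuples with coinciding
entries are negligible because a single vertex contributes little.

Together the bounds give `tendsto_integral_tupleCount`. The normalisation there is exactly the
reciprocal of the claimed value up to the constant limit (`modeFactor_mul_momentValue`). Both label
normalisations are the case of a centring sequence `D` with `d - D = o(√D)`: `D = d` for the first
and `D = log_θ n` for the second. -/

/-! ### Poisson probabilities: Stirling's formula and the local limit theorem -/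

/-- The Poisson probability of `d`, as a function of the mean `t`. -/
noncomputable def pois (t : ℝ) (d : ℕ) : ℝ := Real.exp (-t) * t ^ d / d.factorial

lemma pois_nonneg {t : ℝ} (ht : 0 ≤ t) (d : ℕ) : 0 ≤ pois t d := by
  unfold pois; positivity

lemma pois_le_one {t : ℝ} (ht : 0 ≤ t) (d : ℕ) : pois t d ≤ 1 := by
  unfold pois
  have h1 := Real.pow_div_factorial_le_exp t ht d
  calc Real.exp (-t) * t ^ d / d.factorial = Real.exp (-t) * (t ^ d / d.factorial) := by ring
    _ ≤ Real.exp (-t) * Real.exp t := by gcongr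
    _ = 1 := by rw [← Real.exp_add]; simp

lemma continuous_pois (d : ℕ) : Continuous fun t => pois t d := by
  unfold pois; fun_prop

/-- Stirling's formula in the form `√d · pois d d → 1 / √(2π)`. -/
lemma tendsto_sqrt_mul_pois_self :
    Tendsto (fun d : ℕ => √(d : ℝ) * pois d d) atTop (𝓝 (√(2 * Real.pi))⁻¹) := by
  have h := Stirling.tendsto_stirlingSeq_sqrt_pi
  have h2 : Tendsto (fun d : ℕ => (√2 * Stirling.stirlingSeq d)⁻¹) atTop
      (𝓝 (√(2 * Real.pi))⁻¹) := by
    rw [Real.sqrt_mul (by norm_num)]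
    refine (h.const_mul _).inv₀ ?_
    have := Real.pi_pos
    positivity
  refine h2.congr' ?_
  filter_upwards [eventually_gt_atTop 0] with d hd
  have hd' : (0 : ℝ) < d := by exact_mod_cast hd
  have hs : √(d : ℝ) * √d = d := Real.mul_self_sqrt hd'.le
  unfold Stirling.stirlingSeq pois
  rw [Real.sqrt_mul (by norm_num), Real.exp_neg]
  have he : (Real.exp 1) ^ d = Real.exp d := by rw [← Real.exp_nat_mul]; simp
  have h0 : √(d : ℝ) ≠ 0 := by positivity
  rw [div_pow, he]
  field_simp

/-- Second-order expansion of `log (1 - ξ)`: the quadratic term gives `-(r ξ)² / 2`, and the cubic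
remainder is `(r ξ)²` times a quantity of order `|ξ|`, which vanishes because `r ξ` converges while
`r → ∞`. -/
lemma tendsto_sq_mul_add_log {ξ : ℕ → ℝ} {r : ℕ → ℝ} {z : ℝ}
    (hr : Tendsto r atTop atTop) (hξ : Tendsto (fun n => r n * ξ n) atTop (𝓝 z)) :
    Tendsto (fun n => r n ^ 2 * (ξ n + Real.log (1 - ξ n))) atTop (𝓝 (-z ^ 2 / 2)) := by
  have h0 : Tendsto ξ atTop (𝓝 0) := by
    have := hξ.mul (tendsto_inv_atTop_zero.comp hr)
    rw [mul_zero] at this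
    refine this.congr' ?_
    filter_upwards [hr.eventually_gt_atTop 0] with n hn
    simp only [Function.comp]
    field_simp
  have h1 : Tendsto (fun n => -(r n * ξ n) ^ 2 / 2) atTop (𝓝 (-z ^ 2 / 2)) :=
    ((hξ.pow 2).neg).div_const 2
  have h2 : Tendsto (fun n => r n ^ 2 * (ξ n + Real.log (1 - ξ n)) - (-(r n * ξ n) ^ 2 / 2))
      atTop (𝓝 0) := by
    have h3 : Tendsto (fun n => (r n * ξ n) ^ 2 * (|ξ n| * (1 - |ξ n|)⁻¹)) atTop (𝓝 0) := by
      have : Tendsto (fun n => |ξ n|) atTop (𝓝 0) := by simpa using h0.abs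
      have h4 : Tendsto (fun n => (1 - |ξ n|)⁻¹) atTop (𝓝 1) := by
        have := (this.const_sub 1).inv₀ (by norm_num)
        simpa using this
      have := (hξ.pow 2).mul (this.mul h4)
      simpa using this
    refine squeeze_zero_norm' ?_ h3
    have : ∀ᶠ n in atTop, |ξ n| < 1 := by
      have : Tendsto (fun n => |ξ n|) atTop (𝓝 0) := by simpa using h0.abs
      exact this.eventually_lt_const (by norm_num)
    filter_upwards [this] with n hn
    have h5 := Real.abs_log_sub_add_sum_range_le hn 2
    simp only [Finset.sum_range_succ, Finset.sum_range_zero] at h5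
    norm_num at h5
    have h6 : r n ^ 2 * (ξ n + Real.log (1 - ξ n)) - (-(r n * ξ n) ^ 2 / 2) =
      r n ^ 2 * (ξ n + ξ n ^ 2 / 2 + Real.log (1 - ξ n)) := by ring
    rw [Real.norm_eq_abs, h6, abs_mul, abs_of_nonneg (sq_nonneg _)]
    calc r n ^ 2 * |ξ n + ξ n ^ 2 / 2 + Real.log (1 - ξ n)|
        ≤ r n ^ 2 * (|ξ n| ^ 3 / (1 - |ξ n|)) := by gcongr
      _ = (r n * ξ n) ^ 2 * (|ξ n| * (1 - |ξ n|)⁻¹) := by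
        rw [mul_pow, ← sq_abs (ξ n)]; ring
  have := h2.add h1
  simpa using this

/-- Local central limit theorem for the Poisson weights. -/
lemma tendsto_sqrt_mul_pois {d : ℕ → ℕ} (hd : Tendsto d atTop atTop) {u : ℕ → ℝ} {z : ℝ}
    (hu : Tendsto (fun n => (d n - u n) / √(d n)) atTop (𝓝 z)) :
    Tendsto (fun n => √(d n) * pois (u n) (d n)) atTop (𝓝 (gaussianPDFReal 0 1 z)) := by
  have hd' : Tendsto (fun n => (d n : ℝ)) atTop atTop := tendsto_natCast_atTop_atTop.comp hd
  have hr : Tendsto (fun n => √(d n : ℝ)) atTop atTop := Real.tendsto_sqrt_atTop.comp hd'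
  have hξ : Tendsto (fun n => √(d n : ℝ) * ((d n - u n) / d n)) atTop (𝓝 z) := by
    refine hu.congr fun n => ?_
    rw [mul_div_assoc', mul_comm, mul_div_assoc, Real.sqrt_div_self', mul_one_div]
  -- With `ξ = (d - u) / d` one has `pois u d = pois d d * exp (d (ξ + log (1 - ξ)))`. Stirling's
  -- formula gives the constant and this expansion, with `r = √d`, gives the Gaussian exponent.
  have h1 := tendsto_sq_mul_add_log hr hξ
  have h0 : Tendsto (fun n => (d n - u n) / d n) atTop (𝓝 0) := by
    have := hξ.mul (tendsto_inv_atTop_zero.comp hr)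
    rw [mul_zero] at this
    refine this.congr' ?_
    filter_upwards [hr.eventually_gt_atTop 0] with n hn
    simp only [Function.comp]
    field_simp
  have h2 := (tendsto_sqrt_mul_pois_self.comp hd).mul (Real.continuous_exp.tendsto _ |>.comp h1)
  have e : gaussianPDFReal 0 1 z = (√(2 * Real.pi))⁻¹ * Real.exp (-z ^ 2 / 2) := by
    simp [gaussianPDFReal]
  rw [e]
  refine h2.congr' ?_
  filter_upwards [hd'.eventually_gt_atTop 0, h0.eventually_lt_const one_pos] with n hn hlt
  simp only [Function.comp]
  have hs : √(d n : ℝ) ^ 2 = d n := Real.sq_sqrt hn.le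
  have hu1 : 1 - (d n - u n) / d n = u n / d n := by field_simp; ring
  have hpos : 0 < u n / d n := by rw [← hu1]; linarith
  have hupos : 0 < u n := by
    have := mul_pos hpos hn
    rwa [div_mul_cancel₀ _ hn.ne'] at this
  rw [hs, hu1]
  have e2 : Real.exp (d n * ((d n - u n) / d n + Real.log (u n / d n))) =
      Real.exp (d n) * Real.exp (-u n) * (u n / d n) ^ d n := by
    rw [mul_add, Real.exp_add, Real.exp_nat_mul (Real.log _), Real.exp_log hpos,
      mul_div_cancel₀ _ hn.ne', sub_eq_add_neg, Real.exp_add]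
  rw [e2]
  unfold pois
  rw [Real.exp_neg (d n : ℝ), div_pow]
  have := Real.exp_pos (d n)
  field_simp

/-! ### A dominated convergence theorem -/

/-- Dominated convergence with converging dominating functions. -/
lemma tendsto_integral_of_dominated_of_tendsto {α : Type*} [MeasurableSpace α] {μ : Measure α}
    {f G : ℕ → α → ℝ} {f₀ G₀ : α → ℝ}
    (hfm : ∀ᶠ n in atTop, AEStronglyMeasurable (f n) μ)
    (hG : ∀ᶠ n in atTop, Integrable (G n) μ) (hG₀ : Integrable G₀ μ)
    (hf0 : ∀ᶠ n in atTop, ∀ x, 0 ≤ f n x) (hfG : ∀ᶠ n in atTop, ∀ x, f n x ≤ G n x)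
    (hGlim : ∀ᵐ x ∂μ, Tendsto (fun n => G n x) atTop (𝓝 (G₀ x)))
    (hflim : ∀ᵐ x ∂μ, Tendsto (fun n => f n x) atTop (𝓝 (f₀ x)))
    (hint : Tendsto (fun n => ∫ x, G n x ∂μ) atTop (𝓝 (∫ x, G₀ x ∂μ))) :
    Tendsto (fun n => ∫ x, f n x ∂μ) atTop (𝓝 (∫ x, f₀ x ∂μ)) := by
  have hG₀0 : 0 ≤ᵐ[μ] G₀ := by
    filter_upwards [hGlim] with x hx
    refine ge_of_tendsto hx ?_
    filter_upwards [hf0, hfG] with n h1 h2 using (h1 x).trans (h2 x)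
  have hle : ∀ᵐ x ∂μ, f₀ x ≤ G₀ x := by
    filter_upwards [hGlim, hflim] with x hx hy
    refine le_of_tendsto_of_tendsto hy hx ?_
    filter_upwards [hfG] with n h1 using h1 x
  -- the negative part of `G n - G₀`
  have hneg : Tendsto (fun n => ∫ x, max (G₀ x - G n x) 0 ∂μ) atTop (𝓝 0) := by
    have : Tendsto (fun n => ∫ x, max (G₀ x - G n x) 0 ∂μ) atTop (𝓝 (∫ x, (0 : ℝ) ∂μ)) := by
      refine tendsto_integral_filter_of_dominated_convergence G₀ ?_ ?_ hG₀ ?_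
      · filter_upwards [hG] with n hn
        exact ((hG₀.sub hn).pos_part).aestronglyMeasurable
      · filter_upwards [hf0, hfG] with n h1 h2
        filter_upwards [hG₀0] with x hx
        have := (h1 x).trans (h2 x)
        rw [Real.norm_eq_abs, abs_of_nonneg (le_max_right _ _)]
        exact max_le (by linarith) hx
      · filter_upwards [hGlim] with x hx
        have := (hx.const_sub (G₀ x)).max (tendsto_const_nhds (x := (0 : ℝ)))
        simpa using this
    simpa using this
  -- As `max u 0 = u + max (-u) 0`, convergence of the integrals of `G n` carries the vanishing of
  -- the negative part over to the positive part.
  have hpos : Tendsto (fun n => ∫ x, max (G n x - G₀ x) 0 ∂μ) atTop (𝓝 0) := by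
    have h1 := (hint.sub_const (∫ x, G₀ x ∂μ)).add hneg
    simp only [sub_self, add_zero] at h1
    refine h1.congr' ?_
    filter_upwards [hG] with n hn
    have e := integral_add (hn.sub hG₀) ((hG₀.sub hn).pos_part)
    simp only [Pi.sub_apply] at e
    rw [← integral_sub hn hG₀, ← e]
    refine integral_congr_ae (ae_of_all _ fun x => ?_)
    simp only
    rcases le_total (G n x) (G₀ x) with h | h
    · rw [max_eq_left (by linarith), max_eq_right (by linarith)]; ring
    · rw [max_eq_right (by linarith), max_eq_left (by linarith)]; ring
  -- The truncation at `G₀` has a fixed majorant, and what it cuts off is at most the positive part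
  -- of `G n - G₀`.
  have hmin : Tendsto (fun n => ∫ x, min (f n x) (G₀ x) ∂μ) atTop (𝓝 (∫ x, f₀ x ∂μ)) := by
    refine tendsto_integral_filter_of_dominated_convergence G₀ ?_ ?_ hG₀ ?_
    · filter_upwards [hfm] with n hn
      exact hn.inf hG₀.aestronglyMeasurable
    · filter_upwards [hf0] with n h1
      filter_upwards [hG₀0] with x hx
      rw [Real.norm_eq_abs, abs_of_nonneg (le_min (h1 x) hx)]
      exact min_le_right _ _
    · filter_upwards [hflim, hle] with x hx hy
      have := hx.min (tendsto_const_nhds (x := G₀ x))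
      rwa [min_eq_left hy] at this
  have hdiff : Tendsto (fun n => ∫ x, f n x ∂μ - ∫ x, min (f n x) (G₀ x) ∂μ) atTop (𝓝 0) := by
    refine squeeze_zero_norm' ?_ hpos
    filter_upwards [hfm, hG, hf0, hfG] with n h1 h2 h3 h4
    have hfi : Integrable (f n) μ := by
      refine h2.mono h1 (ae_of_all _ fun x => ?_)
      rw [Real.norm_eq_abs, Real.norm_eq_abs, abs_of_nonneg (h3 x),
        abs_of_nonneg ((h3 x).trans (h4 x))]
      exact h4 x
    have hmi : Integrable (fun x => min (f n x) (G₀ x)) μ := hfi.inf hG₀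
    rw [← integral_sub hfi hmi, Real.norm_eq_abs]
    have hnn : ∀ x, 0 ≤ f n x - min (f n x) (G₀ x) := fun x => sub_nonneg.2 (min_le_left _ _)
    rw [abs_of_nonneg (integral_nonneg hnn)]
    refine integral_mono (hfi.sub hmi) ((h2.sub hG₀).pos_part) fun x => ?_
    simp only
    have := h4 x
    rcases le_total (f n x) (G₀ x) with h | h
    · rw [min_eq_left h]; simp
    · rw [min_eq_right h]; exact le_max_of_le_left (by linarith)
  have := hdiff.add hmin
  simpa using this

/-! ### Harmonic sums, and sums over labels as integrals -/

/-- The harmonic sum `∑_{m = v}^{n - 1} 1 / m`. -/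
noncomputable def harm (n v : ℕ) : ℝ := ∑ m ∈ Finset.Ico v n, (m : ℝ)⁻¹

lemma harm_nonneg (n v : ℕ) : 0 ≤ harm n v := Finset.sum_nonneg fun _ _ => by positivity

lemma log_div_le_harm {n v : ℕ} (hv : 1 ≤ v) (hvn : v ≤ n) : Real.log (n / v) ≤ harm n v := by
  have hv0 : (0 : ℝ) < v := by exact_mod_cast hv
  induction n, hvn using Nat.le_induction with
  | base => simp [harm, hv0.ne']
  | succ n hn ih =>
    have hn0 : (0 : ℝ) < n := hv0.trans_le (by exact_mod_cast hn)
    unfold harm at *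
    rw [Finset.sum_Ico_succ_top hn]
    have e : ((n + 1 : ℕ) : ℝ) / v = (n / v) * (1 + (n : ℝ)⁻¹) := by
      push_cast; field_simp
    rw [e, Real.log_mul (by positivity) (by positivity)]
    have := Real.log_le_sub_one_of_pos (x := 1 + (n : ℝ)⁻¹) (by positivity)
    linarith

lemma harm_le_log_div {n v : ℕ} (hv : 2 ≤ v) (hvn : v ≤ n) :
    harm n v ≤ Real.log (n / (v - 1)) := by
  have hv0 : (0 : ℝ) < (v : ℝ) - 1 := by
    have : (2 : ℝ) ≤ v := by exact_mod_cast hv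
    linarith
  have key : harm n v ≤ Real.log (((n : ℝ) - 1) / (v - 1)) := by
    induction n, hvn using Nat.le_induction with
    | base => simp [harm, hv0.ne']
    | succ n hn ih =>
      have hn1 : (0 : ℝ) < (n : ℝ) - 1 := by
        have : (v : ℝ) ≤ n := by exact_mod_cast hn
        linarith
      have hn0 : (0 : ℝ) < n := by linarith
      unfold harm at *
      rw [Finset.sum_Ico_succ_top hn]
      have e : (((n + 1 : ℕ) : ℝ) - 1) / (v - 1) = ((n - 1) / (v - 1)) / (1 - (n : ℝ)⁻¹) := by
        push_cast; field_simp; ring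
      have h1 : 0 < 1 - (n : ℝ)⁻¹ := by
        have : 1 - (n : ℝ)⁻¹ = (n - 1) / n := by field_simp
        rw [this]; positivity
      rw [e, Real.log_div (by positivity) h1.ne']
      have := Real.log_le_sub_one_of_pos h1
      linarith
  refine key.trans (Real.log_le_log ?_ ?_)
  · have : (v : ℝ) ≤ n := by exact_mod_cast hvn
    have : 0 < (n : ℝ) - 1 := by linarith
    positivity
  · gcongr; linarith

/-- The hypotheses on `x` say that `⌊x⌋ + 2 = v`. The shift by two makes `n / x` larger than `n / (v
- 1)`, so this direction holds without error term; the error sits in the reverse bound only. -/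
lemma harm_le_log_sub {n v : ℕ} (hv : 3 ≤ v) (hvn : v ≤ n) {x : ℝ} (hx1 : (v : ℝ) - 2 ≤ x)
    (hx2 : x < v - 1) : harm n v ≤ Real.log (n / x) := by
  have hv0 : (3 : ℝ) ≤ v := by exact_mod_cast hv
  have hn0 : (v : ℝ) ≤ n := by exact_mod_cast hvn
  refine (harm_le_log_div (by omega) hvn).trans (Real.log_le_log ?_ ?_)
  · have : 0 < (v : ℝ) - 1 := by linarith
    have : (0 : ℝ) < n := by linarith
    positivity
  · gcongr; linarith

lemma log_sub_le_harm {N n v : ℕ} (hN : 3 ≤ N) (hNv : N ≤ v) (hvn : v ≤ n) {x : ℝ}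
    (hx1 : (v : ℝ) - 2 ≤ x) : Real.log (n / x) - 2 / (N - 2) ≤ harm n v := by
  have hN0 : (3 : ℝ) ≤ N := by exact_mod_cast hN
  have hv0 : (N : ℝ) ≤ v := by exact_mod_cast hNv
  have hn0 : (v : ℝ) ≤ n := by exact_mod_cast hvn
  refine le_trans ?_ (log_div_le_harm (by omega) hvn)
  have hx : 0 < x := by linarith
  rw [Real.log_div (by linarith) hx.ne', Real.log_div (by linarith) (by linarith)]
  have h1 : Real.log v - Real.log x ≤ 2 / (N - 2) := by
    rw [← Real.log_div (by linarith) hx.ne']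
    refine (Real.log_le_sub_one_of_pos (div_pos (by linarith) hx)).trans ?_
    have : (v : ℝ) / x - 1 = (v - x) / x := by field_simp
    rw [this]
    have hN2 : 0 < (N : ℝ) - 2 := by linarith
    gcongr <;> linarith
  linarith

/-- The power in `pois` takes the upper bound on the harmonic sum, the decreasing exponential takes
the lower bound; the error of the latter is the prefactor. -/
lemma pois_harm_le {N n v : ℕ} (hN : 3 ≤ N) (hNv : N ≤ v) (hvn : v ≤ n) {x t : ℝ} (ht : 0 ≤ t)
    (hx1 : (v : ℝ) - 2 ≤ x) (hx2 : x < v - 1) (d : ℕ) :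
    pois (t * harm n v) d ≤ Real.exp (t * (2 / (N - 2))) * pois (t * Real.log (n / x)) d := by
  have h1 := harm_le_log_sub (hN.trans hNv) hvn hx1 hx2
  have h2 := log_sub_le_harm hN hNv hvn hx1
  have h0 := harm_nonneg n v
  unfold pois
  rw [← mul_div_assoc, ← mul_assoc, ← Real.exp_add]
  gcongr
  nlinarith

/-- `e^{-y} · pois (t y) d` on the positive half-line. -/
noncomputable def expPois (t : ℝ) (d : ℕ) (y : ℝ) : ℝ :=
  (Set.Ioi (0 : ℝ)).indicator (fun y => Real.exp (-y) * pois (t * y) d) y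

lemma expPois_nonneg {t : ℝ} (ht : 0 ≤ t) (d : ℕ) (y : ℝ) : 0 ≤ expPois t d y := by
  refine Set.indicator_nonneg (fun y hy => ?_) y
  have := pois_nonneg (mul_nonneg ht (le_of_lt hy)) d
  positivity

lemma expPois_eq_rpow {t : ℝ} (d : ℕ) :
    (fun y => Real.exp (-y) * pois (t * y) d) =
      fun y => t ^ d / d.factorial * (y ^ (((d : ℝ) + 1) - 1) * Real.exp (-((1 + t) * y))) := by
  ext y
  simp only [add_sub_cancel_right, Real.rpow_natCast, pois]
  rw [show -((1 + t) * y) = -y + -(t * y) by ring, Real.exp_add, mul_pow]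
  ring

/-- A Poisson variable whose mean is `t` times a standard exponential variable is geometric with
ratio `t / (1 + t)`; analytically this is a Gamma integral of shape `d + 1` and rate `1 + t`. -/
lemma integral_expPois {t : ℝ} (ht : 0 ≤ t) (d : ℕ) :
    ∫ y, expPois t d y = t ^ d / (1 + t) ^ (d + 1) := by
  unfold expPois
  rw [integral_indicator measurableSet_Ioi, expPois_eq_rpow, integral_const_mul,
    Real.integral_rpow_mul_exp_neg_mul_Ioi (by positivity) (by positivity),
    Real.Gamma_nat_eq_factorial]
  have : (1 / (1 + t)) ^ ((d : ℝ) + 1) = (1 / (1 + t)) ^ (d + 1) := by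
    rw [← Real.rpow_natCast]; push_cast; rfl
  rw [this, div_pow, one_pow]
  have : (d.factorial : ℝ) ≠ 0 := by positivity
  field_simp

lemma integrable_expPois {t : ℝ} (ht : 0 ≤ t) (d : ℕ) : Integrable (expPois t d) := by
  -- In this case the integral is zero and gives no information on integrability, but the function
  -- itself vanishes.
  by_cases h : t = 0 ∧ d ≠ 0
  · obtain ⟨rfl, h⟩ := h
    have : expPois 0 d = 0 := by
      ext y; simp [expPois, pois, h]
    rw [this]; exact integrable_zero _ _ _
  · refine Integrable.of_integral_ne_zero ?_
    rw [integral_expPois ht]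
    rcases eq_or_lt_of_le ht with h0 | h0
    · have : d = 0 := by_contra fun hd => h ⟨h0.symm, hd⟩
      subst this; positivity
    · positivity

/-- The vertex `v` owns the unit interval `[v - 2, v - 1)`, on which `⌊x⌋ + 2 = v`; the bound `3 ≤
N` keeps all these intervals in the positive half-line. -/
lemma sum_eq_integral_floor (g : ℕ → ℝ) {N n : ℕ} (hN : 3 ≤ N) :
    ∑ v ∈ Finset.Icc N n, g v =
      ∫ x in Set.Ioi (0 : ℝ), if ⌊x⌋₊ + 2 ∈ Finset.Icc N n then g (⌊x⌋₊ + 2) else 0 := by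
  have e : ∀ x ∈ Set.Ioi (0 : ℝ),
      (if ⌊x⌋₊ + 2 ∈ Finset.Icc N n then g (⌊x⌋₊ + 2) else 0) =
        ∑ v ∈ Finset.Icc N n, (Set.Ico ((v : ℝ) - 2) (v - 1)).indicator (fun _ => g v) x := by
    intro x hx
    have hx0 : (0 : ℝ) ≤ x := le_of_lt hx
    have key : ∀ v ∈ Finset.Icc N n,
        (Set.Ico ((v : ℝ) - 2) (v - 1)).indicator (fun _ => g v) x =
          if v = ⌊x⌋₊ + 2 then g v else 0 := by
      intro v hv
      rw [Finset.mem_Icc] at hv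
      have hv3 : 3 ≤ v := hN.trans hv.1
      rw [Set.indicator_apply]
      refine if_congr ?_ rfl rfl
      rw [Set.mem_Ico]
      obtain ⟨w, rfl⟩ := Nat.exists_eq_add_of_le' (show 2 ≤ v by omega)
      rw [add_left_inj, eq_comm, Nat.floor_eq_iff hx0]
      push_cast
      constructor <;> rintro ⟨h1, h2⟩ <;> constructor <;> linarith
    rw [Finset.sum_congr rfl key, Finset.sum_ite_eq']
  rw [setIntegral_congr_fun measurableSet_Ioi e, integral_finsetSum]
  · refine Finset.sum_congr rfl fun v hv => ?_
    have hv3 : (3 : ℝ) ≤ v := by exact_mod_cast hN.trans (Finset.mem_Icc.1 hv).1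
    rw [integral_indicator measurableSet_Ico, Measure.restrict_restrict measurableSet_Ico,
      Set.inter_eq_left.2 (fun x hx => by
        have : (v : ℝ) - 2 ≤ x := hx.1
        simp only [Set.mem_Ioi]; linarith)]
    simp only [integral_const, MeasurableSet.univ, measureReal_restrict_apply, Set.univ_inter,
      Real.volume_real_Ico, smul_eq_mul]
    rw [show (v : ℝ) - 1 - (v - 2) = 1 by ring]
    simp
  · intro v hv
    refine (integrable_indicator_iff measurableSet_Ico).2 ?_
    refine integrableOn_const ?_
    rw [Measure.restrict_apply measurableSet_Ico]
    exact ne_top_of_le_ne_top (by simp) (measure_mono Set.inter_subset_left)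

/-- The substitution `x = exp (L + c z)`. With `L = log n`, `c = -1` the new variable is
exponential; with `L = log n - a D`, `c = a √D` it is the rescaled label. -/
lemma integral_Ioi_eq_integral_exp (F : ℝ → ℝ) (L : ℝ) {c : ℝ} (hc : c ≠ 0) :
    ∫ x in Set.Ioi (0 : ℝ), F x = ∫ z, |c| * Real.exp (L + c * z) * F (Real.exp (L + c * z)) := by
  have him : (fun z => Real.exp (L + c * z)) '' Set.univ = Set.Ioi 0 := by
    ext x
    simp only [Set.image_univ, Set.mem_range, Set.mem_Ioi]
    constructor
    · rintro ⟨z, rfl⟩; exact Real.exp_pos _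
    · intro hx
      exact ⟨(Real.log x - L) / c, by rw [mul_div_cancel₀ _ hc]; simp [Real.exp_log hx]⟩
  have hder : ∀ z ∈ (Set.univ : Set ℝ), HasDerivWithinAt (fun z => Real.exp (L + c * z))
      (Real.exp (L + c * z) * c) Set.univ z := by
    intro z _
    have h : HasDerivAt (fun z : ℝ => L + c * z) c z := by
      simpa using ((hasDerivAt_id z).const_mul c).const_add L
    exact h.exp.hasDerivWithinAt
  have hinj : Set.InjOn (fun z => Real.exp (L + c * z)) Set.univ := by
    intro x _ y _ h
    have := Real.exp_injective h
    exact mul_left_cancel₀ hc (add_left_cancel this)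
  have := integral_image_eq_integral_abs_deriv_smul MeasurableSet.univ hder hinj F
  rw [him, Measure.restrict_univ] at this
  rw [this]
  refine integral_congr_ae (ae_of_all _ fun z => ?_)
  simp only [smul_eq_mul, abs_mul, abs_of_pos (Real.exp_pos _)]
  ring

/-- Bound for the number of vertices of given degree, in terms of a geometric law. -/
lemma sum_pois_harm_le {N n : ℕ} (hN : 3 ≤ N) {t : ℝ} (ht : 0 ≤ t) (d : ℕ) :
    ∑ v ∈ Finset.Icc N n, pois (t * harm n v) d ≤
      n * (Real.exp (t * (2 / (N - 2))) * (t ^ d / (1 + t) ^ (d + 1))) := by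
  rcases Nat.eq_zero_or_pos n with rfl | hn
  · simp [Finset.Icc_eq_empty_of_lt (show 0 < N by omega)]
  have hn0 : (0 : ℝ) < n := by exact_mod_cast hn
  rw [sum_eq_integral_floor _ hN, integral_Ioi_eq_integral_exp _ (Real.log n) (c := -1) (by norm_num),
    ← integral_expPois ht, ← integral_const_mul, ← integral_const_mul]
  refine integral_mono_of_nonneg (ae_of_all _ fun y => ?_)
    (((integrable_expPois ht d).const_mul _).const_mul _) (ae_of_all _ fun y => ?_)
  · simp only [Pi.zero_apply]
    refine mul_nonneg (by positivity) ?_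
    split_ifs
    · exact pois_nonneg (mul_nonneg ht (harm_nonneg _ _)) _
    · exact le_rfl
  · simp only
    set x := Real.exp (Real.log n + -1 * y) with hx
    have hx' : x = n * Real.exp (-y) := by
      rw [hx, Real.exp_add, Real.exp_log hn0]; simp
    have hy : Real.log (n / x) = y := by
      rw [hx', div_mul_eq_div_div, div_self hn0.ne', one_div, ← Real.exp_neg, Real.log_exp, neg_neg]
    split_ifs with h
    · rw [Finset.mem_Icc] at h
      have hf1 : (⌊x⌋₊ : ℝ) ≤ x := Nat.floor_le (Real.exp_pos _).le
      have hf2 := Nat.lt_floor_add_one x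
      have hb := pois_harm_le hN h.1 h.2 ht (x := x) (by push_cast; linarith)
        (by push_cast; linarith) d
      have hxn : x < n := by
        have : ((⌊x⌋₊ + 2 : ℕ) : ℝ) ≤ n := by exact_mod_cast h.2
        push_cast at this
        linarith
      have hy0 : 0 < y := by
        rw [← hy]; exact Real.log_pos ((one_lt_div (Real.exp_pos _)).2 hxn)
      rw [hy] at hb
      rw [expPois, Set.indicator_of_mem (show y ∈ Set.Ioi 0 from hy0)]
      calc |(-1 : ℝ)| * x * pois (t * harm n (⌊x⌋₊ + 2)) d
          = n * Real.exp (-y) * pois (t * harm n (⌊x⌋₊ + 2)) d := by rw [hx']; simp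
        _ ≤ n * Real.exp (-y) * (Real.exp (t * (2 / (N - 2))) * pois (t * y) d) := by gcongr
        _ = _ := by ring
    · rw [mul_zero]
      have := expPois_nonneg ht d y
      positivity

/-! ### Asymptotic number of vertices with given degree and rescaled label -/

/-- The label `v`, centred and scaled by means of a real parameter `D`. -/
noncomputable def lab (a : ℝ) (n : ℕ) (D : ℝ) (v : ℕ) : ℝ :=
  (Real.log v - (Real.log n - a * D)) / (a * √D)

/-- The growth conditions on a sequence of degrees `d`, of normalisations `D`, and of cutoffs `N`
for the labels. -/
structure Admissible (a : ℝ) (d : ℕ → ℕ) (D : ℕ → ℝ) (N : ℕ → ℕ) : Prop where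
  tendsto_degree : Tendsto d atTop atTop
  tendsto_norm : Tendsto D atTop atTop
  tendsto_diff : Tendsto (fun n => ((d n : ℝ) - D n) / √(D n)) atTop (𝓝 0)
  le_log : ∃ b : ℝ, ∀ᶠ n in atTop, D n ≤ b * Real.log n
  tendsto_cutoff : Tendsto N atTop atTop
  cutoff_le : ∀ z : ℝ, ∀ᶠ n : ℕ in atTop,
    (N n : ℝ) ≤ Real.exp (Real.log n - a * D n + a * √(D n) * z)

namespace Admissible

variable {a : ℝ} {d : ℕ → ℕ} {D : ℕ → ℝ} {N : ℕ → ℕ}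

lemma tendsto_sqrt (h : Admissible a d D N) : Tendsto (fun n => √(D n)) atTop atTop :=
  Real.tendsto_sqrt_atTop.comp h.tendsto_norm

lemma tendsto_ratio (h : Admissible a d D N) :
    Tendsto (fun n => (d n : ℝ) / D n) atTop (𝓝 1) := by
  have := (h.tendsto_diff.mul (tendsto_inv_atTop_zero.comp h.tendsto_sqrt)).add_const 1
  simp only [mul_zero, zero_add] at this
  refine this.congr' ?_
  filter_upwards [h.tendsto_norm.eventually_gt_atTop 0] with n hn
  simp only [Function.comp]
  have hs : √(D n) * √(D n) = D n := Real.mul_self_sqrt hn.le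
  have h0 : √(D n) ≠ 0 := by positivity
  rw [div_mul_eq_mul_div, ← div_eq_mul_inv, div_div, hs]
  field_simp
  ring

lemma tendsto_sqrt_ratio (h : Admissible a d D N) :
    Tendsto (fun n => √(D n) / √(d n)) atTop (𝓝 1) := by
  have h1 := (h.tendsto_ratio.inv₀ one_ne_zero).sqrt
  simp only [inv_one, Real.sqrt_one, inv_div] at h1
  refine h1.congr' ?_
  filter_upwards [h.tendsto_norm.eventually_gt_atTop 0] with n hn
  rw [Real.sqrt_div hn.le]

lemma tendsto_mul_norm (h : Admissible a d D N) {δ : ℕ → ℝ}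
    (hδ : Tendsto (fun n => δ n * Real.log n) atTop (𝓝 0)) :
    Tendsto (fun n => δ n * D n) atTop (𝓝 0) := by
  obtain ⟨b, hb⟩ := h.le_log
  refine squeeze_zero_norm' (a := fun n => b * |δ n * Real.log n|) ?_ ?_
  · filter_upwards [hb, h.tendsto_norm.eventually_gt_atTop 0, eventually_ge_atTop 1] with n h1 h2 h3
    have : 0 ≤ Real.log n := Real.log_nonneg (by exact_mod_cast h3)
    rw [Real.norm_eq_abs, abs_mul, abs_mul, abs_of_pos h2, abs_of_nonneg this]
    calc |δ n| * D n ≤ |δ n| * (b * Real.log n) := by gcongr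
      _ = _ := by ring
  · have := hδ.abs.const_mul b
    simpa using this

/-- Shifting the degree by a constant. -/
lemma add (h : Admissible a d D N) (s : ℕ) : Admissible a (fun n => d n + s) D N where
  tendsto_degree := tendsto_atTop_mono (fun n => Nat.le_add_right _ _) h.tendsto_degree
  tendsto_norm := h.tendsto_norm
  tendsto_diff := by
    have := h.tendsto_diff.add ((tendsto_inv_atTop_zero.comp h.tendsto_sqrt).const_mul (s : ℝ))
    simp only [mul_zero, add_zero] at this
    refine this.congr fun n => ?_
    simp only [Function.comp]
    push_cast
    ring
  le_log := h.le_log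
  tendsto_cutoff := h.tendsto_cutoff
  cutoff_le := h.cutoff_le

variable {θ : ℝ} {t : ℕ → ℝ}

/-- Exponential tilting of the Poisson law: `θ^d pois (t y) d = exp ((θ - 1) t y) pois (θ t y) d`.
Since `t (θ - 1) = 1 + o(1 / log n)` and `y = O(log n)`, the first factor cancels the factor `exp
(-(a D - a √D z))` up to `1 + o(1)`. The tilted mean `θ t y` is `D - √D z + o(√D)`, so the local
limit theorem applies at `z`. -/
lemma tendsto_local (h : Admissible (1 - θ⁻¹) d D N) (hθ : 1 < θ)
    (ht : Tendsto (fun n => (t n * (θ - 1) - 1) * Real.log n) atTop (𝓝 0)) {z : ℝ}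
    {y : ℕ → ℝ}
    (hy : Tendsto (fun n => y n - ((1 - θ⁻¹) * D n - (1 - θ⁻¹) * √(D n) * z)) atTop (𝓝 0)) :
    Tendsto (fun n => θ ^ d n * ((1 - θ⁻¹) * √(D n)) *
        (Real.exp (-((1 - θ⁻¹) * D n - (1 - θ⁻¹) * √(D n) * z)) * pois (t n * y n) (d n)))
      atTop (𝓝 ((1 - θ⁻¹) * gaussianPDFReal 0 1 z)) := by
  set a := 1 - θ⁻¹ with ha
  have hθ0 : 0 < θ := by linarith
  have ha0 : 0 < a := by
    rw [ha, sub_pos]; exact inv_lt_one_of_one_lt₀ hθ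
  have hθ1 : θ - 1 ≠ 0 := by linarith
  have haθ : a * θ = θ - 1 := by rw [ha]; field_simp
  have hinv := tendsto_inv_atTop_zero.comp h.tendsto_sqrt
  have hD0 := h.tendsto_norm.eventually_gt_atTop 0
  -- `y / D → a`
  have hyD : Tendsto (fun n => y n / D n) atTop (𝓝 a) := by
    have h1 := (hy.mul (tendsto_inv_atTop_zero.comp h.tendsto_norm)).add
      ((hinv.mul_const (a * z)).const_sub a)
    simp only [zero_mul, sub_zero, zero_add] at h1
    refine h1.congr' ?_
    filter_upwards [hD0] with n hn
    simp only [Function.comp]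
    have hs : √(D n) * √(D n) = D n := Real.mul_self_sqrt hn.le
    have h0 : √(D n) ≠ 0 := by positivity
    field_simp
    linear_combination a * z * hs
  have hδy : Tendsto (fun n => (t n * (θ - 1) - 1) * y n) atTop (𝓝 0) := by
    have h1 := (h.tendsto_mul_norm ht).mul hyD
    rw [zero_mul] at h1
    refine h1.congr' ?_
    filter_upwards [hD0] with n hn
    field_simp
  have hexp : Tendsto (fun n => Real.exp ((t n * (θ - 1) - 1) * y n +
      (y n - (a * D n - a * √(D n) * z)))) atTop (𝓝 1) := by
    have := (Real.continuous_exp.tendsto _).comp (hδy.add hy)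
    simpa [Function.comp_def] using this
  have hu : Tendsto (fun n => ((d n : ℝ) - θ * t n * y n) / √(d n)) atTop (𝓝 z) := by
    have h1 : Tendsto (fun n => (((d n : ℝ) - D n) / √(D n) + z -
        (a⁻¹ * ((t n * (θ - 1) - 1) * y n + (y n - (a * D n - a * √(D n) * z)))) * (√(D n))⁻¹)
        * (√(D n) / √(d n))) atTop (𝓝 z) := by
      have := ((h.tendsto_diff.add_const z).sub (((hδy.add hy).const_mul a⁻¹).mul hinv)).mul
        h.tendsto_sqrt_ratio
      simpa using this
    refine h1.congr' ?_
    filter_upwards [hD0] with n hn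
    have h0 : √(D n) ≠ 0 := by positivity
    have e : θ = a⁻¹ * (θ - 1) := by rw [← haθ]; field_simp
    have e1 : θ * t n * y n = a⁻¹ * (t n * (θ - 1)) * y n := by
      conv_lhs => rw [e]
      ring
    have hs : √(D n) * √(D n) = D n := Real.mul_self_sqrt hn.le
    rw [e1]
    field_simp
    ring
  have hmain := ((tendsto_sqrt_mul_pois h.tendsto_degree hu).mul
    (h.tendsto_sqrt_ratio.mul hexp)).const_mul a
  simp only [mul_one] at hmain
  refine hmain.congr' ?_
  filter_upwards [h.tendsto_degree.eventually_gt_atTop 0] with n hn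
  have hd0 : √(d n : ℝ) ≠ 0 := by
    have : (0 : ℝ) < d n := by exact_mod_cast hn
    positivity
  unfold pois
  have e : (t n * (θ - 1) - 1) * y n + (y n - (a * D n - a * √(D n) * z)) =
    θ * t n * y n + (-(t n * y n)) + (-(a * D n - a * √(D n) * z)) := by ring
  rw [e, Real.exp_add, Real.exp_add, Real.exp_neg (θ * t n * y n), mul_assoc θ, mul_pow θ]
  have := (Real.exp_pos (θ * (t n * y n))).ne'
  field_simp

/-- The normalised geometric mass is `(θ t / (1 + t))^d / (1 + t)`. With `δ = t (θ - 1) - 1` the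
base is `1 + δ / (1 + t)`; as `δ log n → 0` and `d = O(log n)`, Bernoulli's inequality and `1 + u ≤
e^u` squeeze the power to one. This is the total mass needed for dominated convergence. -/
lemma tendsto_mass (h : Admissible (1 - θ⁻¹) d D N) (hθ : 1 < θ)
    (ht : Tendsto (fun n => (t n * (θ - 1) - 1) * Real.log n) atTop (𝓝 0)) :
    Tendsto (fun n => θ ^ d n * (t n ^ d n / (1 + t n) ^ (d n + 1))) atTop (𝓝 (1 - θ⁻¹)) := by
  have hθ0 : 0 < θ := by linarith
  have hθ1 : 0 < θ - 1 := by linarith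
  -- `t → 1 / (θ - 1)`
  have hlog : Tendsto (fun n : ℕ => Real.log n) atTop atTop :=
    Real.tendsto_log_atTop.comp tendsto_natCast_atTop_atTop
  have hδ : Tendsto (fun n => t n * (θ - 1) - 1) atTop (𝓝 0) := by
    have := ht.mul (tendsto_inv_atTop_zero.comp hlog)
    rw [zero_mul] at this
    refine this.congr' ?_
    filter_upwards [hlog.eventually_gt_atTop 0] with n hn
    simp only [Function.comp]
    field_simp
  have htl : Tendsto t atTop (𝓝 (θ - 1)⁻¹) := by
    have := (hδ.add_const 1).mul_const (θ - 1)⁻¹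
    simp only [zero_add, one_mul] at this
    refine this.congr fun n => ?_
    field_simp
    ring
  have h1 : Tendsto (fun n => (1 + t n)⁻¹) atTop (𝓝 (1 - θ⁻¹)) := by
    have := (htl.const_add 1).inv₀ (by positivity)
    convert this using 2
    field_simp
    ring
  -- the base `θ t / (1 + t) = 1 + δ / (1 + t)`
  have hbase : ∀ᶠ n in atTop, θ * t n / (1 + t n) = 1 + (t n * (θ - 1) - 1) * (1 + t n)⁻¹ := by
    filter_upwards [htl.eventually_const_lt (u := 0) (by positivity)] with n hn
    field_simp
    ring
  have hpow : Tendsto (fun n => (θ * t n / (1 + t n)) ^ d n) atTop (𝓝 1) := by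
    have hx : Tendsto (fun n => (t n * (θ - 1) - 1) * (1 + t n)⁻¹ * d n) atTop (𝓝 0) := by
      have := ((h.tendsto_mul_norm ht).mul h1).mul h.tendsto_ratio
      simp only [zero_mul] at this
      refine this.congr' ?_
      filter_upwards [h.tendsto_norm.eventually_gt_atTop 0] with n hn
      field_simp
    have hx0 : Tendsto (fun n => (t n * (θ - 1) - 1) * (1 + t n)⁻¹) atTop (𝓝 0) := by
      have := hδ.mul h1
      simpa using this
    have habs : Tendsto (fun n => |(t n * (θ - 1) - 1) * (1 + t n)⁻¹|) atTop (𝓝 0) := by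
      simpa using hx0.abs
    have hlow : Tendsto (fun n => 1 + (t n * (θ - 1) - 1) * (1 + t n)⁻¹ * d n) atTop (𝓝 1) := by
      simpa using hx.const_add 1
    have hupp : Tendsto (fun n => Real.exp ((t n * (θ - 1) - 1) * (1 + t n)⁻¹ * d n)) atTop
        (𝓝 1) := by
      have := (Real.continuous_exp.tendsto _).comp hx
      simpa [Function.comp_def] using this
    refine tendsto_of_tendsto_of_tendsto_of_le_of_le' hlow hupp ?_ ?_
    · filter_upwards [hbase, habs.eventually_lt_const one_pos] with n hn hn2
      rw [hn]
      have h3 := one_add_mul_le_pow (a := (t n * (θ - 1) - 1) * (1 + t n)⁻¹)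
        (by have := (abs_lt.1 hn2).1; linarith) (d n)
      linarith
    · filter_upwards [hbase, habs.eventually_lt_const one_pos] with n hn hn2
      rw [hn, mul_comm _ (d n : ℝ), Real.exp_nat_mul]
      have h4 := (abs_lt.1 hn2).1
      refine pow_le_pow_left₀ (by linarith) ?_ _
      linarith [Real.add_one_le_exp ((t n * (θ - 1) - 1) * (1 + t n)⁻¹)]
  have := hpow.mul h1
  rw [one_mul] at this
  refine this.congr fun n => ?_
  rw [div_pow, mul_pow, pow_succ]
  rw [div_mul_eq_div_div, div_eq_mul_inv (t n ^ d n / (1 + t n) ^ d n)]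
  ring

end Admissible

lemma Phi_eq_integral (B : Set ℝ) (hB : MeasurableSet B) :
    Phi B = ∫ z, B.indicator (gaussianPDFReal 0 1) z := by
  rw [Phi, measureReal_def, gaussianReal_apply_eq_integral 0 one_ne_zero, integral_indicator hB,
    ENNReal.toReal_ofReal]
  exact setIntegral_nonneg hB fun x _ => gaussianPDFReal_nonneg 0 1 x

lemma ae_notMem_frontier {B : Set ℝ} (hB : Phi (frontier B) = 0) : ∀ᵐ z : ℝ, z ∉ frontier B := by
  have h1 : gaussianReal 0 1 (frontier B) = 0 := by
    rwa [Phi, measureReal_def, ENNReal.toReal_eq_zero_iff, or_iff_left (measure_ne_top _ _)] at hB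
  exact measure_eq_zero_iff_ae_notMem.1
    (gaussianReal_absolutelyContinuous' 0 one_ne_zero h1)

lemma tendsto_indicator_of_notMem_frontier {B : Set ℝ} {z : ℝ} (hz : z ∉ frontier B)
    {u : ℕ → ℝ} (hu : Tendsto u atTop (𝓝 z)) :
    Tendsto (fun n => B.indicator (1 : ℝ → ℝ) (u n)) atTop (𝓝 (B.indicator 1 z)) := by
  by_cases hzB : z ∈ interior B
  · refine tendsto_const_nhds.congr' ?_
    filter_upwards [hu.eventually (isOpen_interior.mem_nhds hzB)] with n hn
    rw [Set.indicator_of_mem (interior_subset hzB), Set.indicator_of_mem (interior_subset hn)]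
    rfl
  · have hz' : z ∈ interior Bᶜ := by
      rw [interior_compl, Set.mem_compl_iff]
      exact fun h => hz ⟨h, hzB⟩
    refine tendsto_const_nhds.congr' ?_
    filter_upwards [hu.eventually (isOpen_interior.mem_nhds hz')] with n hn
    rw [Set.indicator_of_notMem (interior_subset hz'), Set.indicator_of_notMem (interior_subset hn)]

lemma integral_comp_sub_mul (φ : ℝ → ℝ) (y₀ : ℝ) {c : ℝ} (hc : 0 < c) :
    ∫ z, c * φ (y₀ - c * z) = ∫ y, φ y := by
  rw [integral_const_mul, Measure.integral_comp_mul_left (fun w => φ (y₀ - w)) c,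
    integral_sub_left_eq_self, abs_of_pos (inv_pos.2 hc), smul_eq_mul]
  field_simp

namespace Admissible

variable {d : ℕ → ℕ} {D : ℕ → ℝ} {N : ℕ → ℕ} {θ : ℝ} {t : ℕ → ℝ}

/-- The asymptotic number of vertices with a given degree and with rescaled label in `B`. -/
lemma tendsto_sum (h : Admissible (1 - θ⁻¹) d D N) (hθ : 1 < θ)
    (ht : Tendsto (fun n => (t n * (θ - 1) - 1) * Real.log n) atTop (𝓝 0))
    (ht0 : ∀ᶠ n in atTop, 0 ≤ t n) (htb : ∃ T, ∀ᶠ n in atTop, t n ≤ T)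
    {B : Set ℝ} (hB : MeasurableSet B) (hBf : Phi (frontier B) = 0) :
    Tendsto (fun n : ℕ => θ ^ d n / n * ∑ v ∈ Finset.Icc (N n) n,
        B.indicator (1 : ℝ → ℝ) (lab (1 - θ⁻¹) n (D n) v) * pois (t n * harm n v) (d n))
      atTop (𝓝 ((1 - θ⁻¹) * Phi B)) := by
  set a := 1 - θ⁻¹ with ha
  have hθ0 : 0 < θ := by linarith
  have ha0 : 0 < a := by
    rw [ha, sub_pos]; exact inv_lt_one_of_one_lt₀ hθ
  obtain ⟨T, hT⟩ := htb
  -- In the variable `z` of the rescaled label the sum is `∫ f n`. The majorant `G n` forgets `B`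
  -- and replaces the harmonic sum by `log (n / x)`, at the cost of a factor `C n → 1`.
  set x : ℕ → ℝ → ℝ := fun n z => Real.exp (Real.log n - a * D n + a * √(D n) * z) with hx
  set g : ℕ → ℕ → ℝ := fun n v =>
    B.indicator (1 : ℝ → ℝ) (lab a n (D n) v) * pois (t n * harm n v) (d n) with hg
  set f : ℕ → ℝ → ℝ := fun n z => θ ^ d n / n * (|a * √(D n)| * x n z *
    if ⌊x n z⌋₊ + 2 ∈ Finset.Icc (N n) n then g n (⌊x n z⌋₊ + 2) else 0) with hf
  set C : ℕ → ℝ := fun n => Real.exp (t n * (2 / (N n - 2))) with hC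
  set G : ℕ → ℝ → ℝ := fun n z => θ ^ d n * C n * ((a * √(D n)) *
    expPois (t n) (d n) (a * D n - a * √(D n) * z)) with hG
  have hD0 := h.tendsto_norm.eventually_gt_atTop 0
  have hN3 := h.tendsto_cutoff.eventually_ge_atTop 3
  have hgn : ∀ᶠ n in atTop, ∀ v, 0 ≤ g n v := by
    filter_upwards [ht0] with n hn v
    exact mul_nonneg (Set.indicator_nonneg (fun _ _ => zero_le_one) _)
      (pois_nonneg (mul_nonneg hn (harm_nonneg _ _)) _)
  have hgp : ∀ᶠ n in atTop, ∀ v, g n v ≤ pois (t n * harm n v) (d n) := by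
    filter_upwards [ht0] with n hn v
    refine mul_le_of_le_one_left (pois_nonneg (mul_nonneg hn (harm_nonneg _ _)) _) ?_
    exact Set.indicator_le_self' (s := B) (f := (1 : ℝ → ℝ)) (fun _ _ => zero_le_one) _
  have hNlim : Tendsto (fun n => (2 : ℝ) / (N n - 2)) atTop (𝓝 0) :=
    tendsto_const_nhds.div_atTop
      ((tendsto_atTop_add_const_right _ (-2) (tendsto_natCast_atTop_atTop.comp h.tendsto_cutoff)))
  have hClim : Tendsto C atTop (𝓝 1) := by
    have h1 : Tendsto (fun n => t n * (2 / (N n - 2))) atTop (𝓝 0) := by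
      refine squeeze_zero' ?_ ?_ (by simpa using hNlim.const_mul T)
      · filter_upwards [ht0, hN3] with n h1 h2
        have : (3 : ℝ) ≤ N n := by exact_mod_cast h2
        have : 0 ≤ (2 : ℝ) / (N n - 2) := div_nonneg (by norm_num) (by linarith)
        positivity
      · filter_upwards [hT, hN3] with n h1 h2
        have : (3 : ℝ) ≤ N n := by exact_mod_cast h2
        have : 0 ≤ (2 : ℝ) / (N n - 2) := div_nonneg (by norm_num) (by linarith)
        gcongr
    have := (Real.continuous_exp.tendsto _).comp h1
    simpa [Function.comp_def] using this
  have hsum : ∀ᶠ n in atTop, θ ^ d n / n * ∑ v ∈ Finset.Icc (N n) n, g n v = ∫ z, f n z := by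
    filter_upwards [hN3, hD0] with n h1 h2
    rw [sum_eq_integral_floor _ h1, integral_Ioi_eq_integral_exp _ (Real.log n - a * D n)
      (c := a * √(D n)) (by positivity), ← integral_const_mul]
  -- facts about a point `z` with `⌊x⌋ + 2` in the range of the sum
  have hyx : ∀ n : ℕ, 0 < n → ∀ z, Real.log (n / x n z) = a * D n - a * √(D n) * z := by
    intro n hn z
    have : (0 : ℝ) < n := by exact_mod_cast hn
    rw [Real.log_div this.ne' (Real.exp_pos _).ne', Real.log_exp]
    ring
  have hxn : ∀ n : ℕ, 0 < n → ∀ z, x n z / n = Real.exp (-(a * D n - a * √(D n) * z)) := by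
    intro n hn z
    have hn0 : (0 : ℝ) < n := by exact_mod_cast hn
    rw [← hyx n hn z, ← Real.log_inv, inv_div, Real.exp_log (div_pos (Real.exp_pos _) hn0)]
  have hfloor : ∀ n z, (((⌊x n z⌋₊ + 2 : ℕ) : ℝ) - 2 ≤ x n z ∧
      x n z < ((⌊x n z⌋₊ + 2 : ℕ) : ℝ) - 1) := by
    intro n z
    have hf1 : (⌊x n z⌋₊ : ℝ) ≤ x n z := Nat.floor_le (Real.exp_pos _).le
    have hf2 := Nat.lt_floor_add_one (x n z)
    push_cast
    constructor <;> linarith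
  have hfG : ∀ᶠ n in atTop, ∀ z, f n z ≤ G n z := by
    filter_upwards [hgp, hN3, hD0, ht0, eventually_gt_atTop 0] with n hn h3 hD ht0 hn0 z
    have hn0' : (0 : ℝ) < n := by exact_mod_cast hn0
    simp only [hf, hG]
    have hc : 0 < a * √(D n) := by positivity
    rw [abs_of_pos hc]
    split_ifs with hm
    · rw [Finset.mem_Icc] at hm
      obtain ⟨hf1, hf2⟩ := hfloor n z
      have hb := pois_harm_le h3 hm.1 hm.2 ht0 hf1 hf2 (d n)
      have hxlt : x n z < n := by
        have : ((⌊x n z⌋₊ + 2 : ℕ) : ℝ) ≤ n := by exact_mod_cast hm.2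
        linarith
      have hy0 : 0 < a * D n - a * √(D n) * z := by
        rw [← hyx n hn0]; exact Real.log_pos ((one_lt_div (Real.exp_pos _)).2 hxlt)
      rw [hyx n hn0] at hb
      rw [expPois, Set.indicator_of_mem (show _ ∈ Set.Ioi (0 : ℝ) from hy0), ← hxn n hn0]
      calc θ ^ d n / n * (a * √(D n) * x n z * g n (⌊x n z⌋₊ + 2))
          ≤ θ ^ d n / n * (a * √(D n) * x n z *
              (C n * pois (t n * (a * D n - a * √(D n) * z)) (d n))) := by
            have : 0 < x n z := Real.exp_pos _
            gcongr
            exact (hn _).trans hb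
        _ = _ := by field_simp
    · have := expPois_nonneg ht0 (d n) (a * D n - a * √(D n) * z)
      have : 0 < C n := Real.exp_pos _
      simp only [mul_zero]
      positivity
  have hGlim : ∀ z, Tendsto (fun n => G n z) atTop (𝓝 (a * gaussianPDFReal 0 1 z)) := by
    intro z
    have h1 := (h.tendsto_local hθ ht (z := z)
      (y := fun n => a * D n - a * √(D n) * z) (by simp [ha])).mul hClim
    rw [mul_one] at h1
    refine h1.congr' ?_
    filter_upwards [h.tendsto_sqrt.eventually_gt_atTop z, hD0] with n h2 h3
    have hy0 : 0 < a * D n - a * √(D n) * z := by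
      have hs : √(D n) * √(D n) = D n := Real.mul_self_sqrt h3.le
      have : 0 < √(D n) := by positivity
      have e : a * D n - a * √(D n) * z = a * √(D n) * (√(D n) - z) := by
        linear_combination -a * hs
      rw [e]
      exact mul_pos (by positivity) (by linarith)
    simp only [hG]
    rw [expPois, Set.indicator_of_mem (show _ ∈ Set.Ioi (0 : ℝ) from hy0)]
    ring
  have hflim : ∀ z, z ∉ frontier B → Tendsto (fun n => f n z) atTop
      (𝓝 (a * B.indicator (gaussianPDFReal 0 1) z)) := by
    intro z hz
    have hNx := h.cutoff_le z
    have hxlim : Tendsto (fun n => x n z) atTop atTop :=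
      tendsto_atTop_mono' _ hNx (tendsto_natCast_atTop_atTop.comp h.tendsto_cutoff)
    have hlim0 : Tendsto (fun n => x n z / n) atTop (𝓝 0) := by
      have h1 : Tendsto (fun n => a * D n - a * √(D n) * z) atTop atTop := by
        have h2 : Tendsto (fun n => a * √(D n) * (√(D n) - z)) atTop atTop :=
          (h.tendsto_sqrt.const_mul_atTop ha0).atTop_mul_atTop₀
            (tendsto_atTop_add_const_right _ _ h.tendsto_sqrt)
        refine h2.congr' ?_
        filter_upwards [hD0] with n h3
        have hs : √(D n) * √(D n) = D n := Real.mul_self_sqrt h3.le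
        rw [mul_sub, mul_assoc a, hs]
      have h2 := Real.tendsto_exp_neg_atTop_nhds_zero.comp h1
      refine h2.congr' ?_
      filter_upwards [eventually_gt_atTop 0] with n hn
      rw [hxn n hn]; rfl
    have hmem : ∀ᶠ n in atTop, ⌊x n z⌋₊ + 2 ∈ Finset.Icc (N n) n := by
      filter_upwards [hNx, hlim0.eventually_lt_const (show (0 : ℝ) < 1 / 2 by norm_num),
        eventually_ge_atTop 4] with n h1 h2 h3
      have h3' : (4 : ℝ) ≤ n := by exact_mod_cast h3
      rw [div_lt_iff₀ (by linarith)] at h2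
      rw [Finset.mem_Icc]
      constructor
      · have h4 : (N n : ℝ) < ((⌊x n z⌋₊ + 2 : ℕ) : ℝ) := by
          have := (hfloor n z).2
          have h5 : (N n : ℝ) ≤ x n z := h1
          linarith
        exact_mod_cast h4.le
      · have h4 : ((⌊x n z⌋₊ + 2 : ℕ) : ℝ) ≤ n := by
          have := (hfloor n z).1
          linarith
        exact_mod_cast h4
    -- Rounding `x` to a vertex adds at most `2`, hence changes `log x` by at most `2` once `x ≥ 1`;
    -- after division by `a √D` this vanishes.
    have hlab : Tendsto (fun n => lab a n (D n) (⌊x n z⌋₊ + 2)) atTop (𝓝 z) := by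
      rw [tendsto_iff_norm_sub_tendsto_zero]
      refine squeeze_zero' (Eventually.of_forall fun _ => norm_nonneg _) ?_
        (g := fun n => 2 / (a * √(D n)))
        (tendsto_const_nhds.div_atTop (h.tendsto_sqrt.const_mul_atTop ha0))
      filter_upwards [hxlim.eventually_ge_atTop 1, hD0] with n h1 h2
      have hc : 0 < a * √(D n) := by positivity
      obtain ⟨hf1, hf2⟩ := hfloor n z
      have hx0 : 0 < x n z := Real.exp_pos _
      have hlx : Real.log (x n z) = Real.log n - a * D n + a * √(D n) * z := Real.log_exp _
      set w := ((⌊x n z⌋₊ + 2 : ℕ) : ℝ) with hw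
      have e : lab a n (D n) (⌊x n z⌋₊ + 2) - z = Real.log (w / x n z) / (a * √(D n)) := by
        rw [Real.log_div (by linarith) hx0.ne', hlx, lab]
        field_simp
        ring
      have h3 : 0 ≤ Real.log (w / x n z) :=
        Real.log_nonneg ((one_le_div hx0).2 (by linarith))
      rw [e, Real.norm_eq_abs, abs_of_nonneg (by positivity)]
      gcongr
      refine (Real.log_le_sub_one_of_pos (div_pos (by linarith) hx0)).trans ?_
      rw [sub_le_iff_le_add, div_le_iff₀ hx0]
      nlinarith
    have hharm : Tendsto (fun n => harm n (⌊x n z⌋₊ + 2) - (a * D n - a * √(D n) * z)) atTop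
        (𝓝 0) := by
      have hlow : Tendsto (fun n => -((2 : ℝ) / (N n - 2))) atTop (𝓝 0) := by
        simpa using hNlim.neg
      refine tendsto_of_tendsto_of_tendsto_of_le_of_le' hlow tendsto_const_nhds ?_ ?_
      · filter_upwards [hmem, hN3, eventually_gt_atTop 0] with n h1 h2 h3
        rw [Finset.mem_Icc] at h1
        have := log_sub_le_harm h2 h1.1 h1.2 (hfloor n z).1
        rw [hyx n h3] at this
        linarith
      · filter_upwards [hmem, hN3, eventually_gt_atTop 0] with n h1 h2 h3
        rw [Finset.mem_Icc] at h1
        have := harm_le_log_sub (h2.trans h1.1) h1.2 (hfloor n z).1 (hfloor n z).2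
        rw [hyx n h3] at this
        linarith
    have h1 := (h.tendsto_local hθ ht hharm).mul (tendsto_indicator_of_notMem_frontier hz hlab)
    have e : a * B.indicator (gaussianPDFReal 0 1) z =
        a * gaussianPDFReal 0 1 z * B.indicator (1 : ℝ → ℝ) z := by
      by_cases hzB : z ∈ B <;> simp [hzB]
    rw [e]
    refine h1.congr' ?_
    filter_upwards [hmem, hD0, eventually_gt_atTop 0] with n h2 h3 h4
    have hn0' : (0 : ℝ) < n := by exact_mod_cast h4
    have hc : 0 < a * √(D n) := by positivity
    simp only [hf, if_pos h2, abs_of_pos hc, hg]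
    rw [← ha, ← hxn n h4]
    field_simp
  -- No fixed majorant is required: the masses of the `G n` are explicit geometric masses and
  -- converge to the mass `a` of their pointwise limit.
  have hint : Tendsto (fun n => ∫ z, G n z) atTop (𝓝 (∫ z, a * gaussianPDFReal 0 1 z)) := by
    rw [integral_const_mul, integral_gaussianPDFReal_eq_one 0 one_ne_zero, mul_one]
    have h1 := (h.tendsto_mass hθ ht).mul hClim
    rw [mul_one] at h1
    refine h1.congr' ?_
    filter_upwards [hD0, ht0] with n h2 h3
    simp only [hG]
    rw [integral_const_mul, integral_comp_sub_mul _ _ (by positivity), integral_expPois h3]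
    ring
  have hmain := tendsto_integral_of_dominated_of_tendsto (μ := volume) (f := f) (G := G)
    (f₀ := fun z => a * B.indicator (gaussianPDFReal 0 1) z)
    (G₀ := fun z => a * gaussianPDFReal 0 1 z) ?_ ?_ ?_ ?_ hfG (ae_of_all _ hGlim) ?_ hint
  · rw [integral_const_mul, ← Phi_eq_integral B hB] at hmain
    refine hmain.congr' ?_
    filter_upwards [hsum] with n hn using hn.symm
  · refine Eventually.of_forall fun n => Measurable.aestronglyMeasurable ?_
    have hxm : Measurable (x n) := by simp only [hx]; fun_prop
    refine Measurable.const_mul (Measurable.mul (hxm.const_mul _) ?_) _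
    exact (measurable_from_nat (f := fun k : ℕ =>
      if k + 2 ∈ Finset.Icc (N n) n then g n (k + 2) else 0)).comp (Nat.measurable_floor.comp hxm)
  · filter_upwards [hD0, ht0] with n h1 h2
    have hc : a * √(D n) ≠ 0 := by positivity
    exact ((((integrable_expPois h2 (d n)).comp_sub_left (a * D n)).comp_mul_left' hc).const_mul
      _).const_mul _
  · exact (integrable_gaussianPDFReal 0 1).const_mul a
  · filter_upwards [hgn] with n hn z
    have : 0 < x n z := Real.exp_pos _
    simp only [hf]
    split_ifs
    · have := hn (⌊x n z⌋₊ + 2)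
      positivity
    · simp
  · filter_upwards [ae_notMem_frontier hBf] with z hz using hflim z hz

end Admissible

lemma tendsto_log_natCast_atTop : Tendsto (fun n : ℕ => Real.log n) atTop atTop :=
  Real.tendsto_log_atTop.comp tendsto_natCast_atTop_atTop

lemma tendsto_rate {θ : ℝ} {t : ℕ → ℝ} (hθ : 1 < θ)
    (ht : Tendsto (fun n => (t n * (θ - 1) - 1) * Real.log n) atTop (𝓝 0)) :
    Tendsto t atTop (𝓝 (θ - 1)⁻¹) := by
  have hθ1 : 0 < θ - 1 := by linarith
  have hδ : Tendsto (fun n => t n * (θ - 1) - 1) atTop (𝓝 0) := by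
    have := ht.mul (tendsto_inv_atTop_zero.comp tendsto_log_natCast_atTop)
    rw [zero_mul] at this
    refine this.congr' ?_
    filter_upwards [tendsto_log_natCast_atTop.eventually_gt_atTop 0] with n hn
    simp only [Function.comp]
    field_simp
  have := (hδ.add_const 1).mul_const (θ - 1)⁻¹
  simp only [zero_add, one_mul] at this
  refine this.congr fun n => ?_
  field_simp
  ring

lemma tendsto_rate_frac {θ : ℝ} {t : ℕ → ℝ} (hθ : 1 < θ)
    (ht : Tendsto (fun n => (t n * (θ - 1) - 1) * Real.log n) atTop (𝓝 0)) :
    Tendsto (fun n => t n / (1 + t n)) atTop (𝓝 θ⁻¹) := by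
  have hθ1 : 0 < θ - 1 := by linarith
  have htl := tendsto_rate hθ ht
  have e : θ⁻¹ = (θ - 1)⁻¹ / (1 + (θ - 1)⁻¹) := by
    field_simp
    ring
  rw [e]
  exact htl.div (htl.const_add 1) (by positivity)

/-! ### Dependence on the weight: only weight one contributes -/

namespace Admissible

variable {d : ℕ → ℕ} {D : ℕ → ℝ} {N : ℕ → ℕ} {θ : ℝ} {t : ℕ → ℝ}

lemma tendsto_base_pow (h : Admissible (1 - θ⁻¹) d D N) (hθ : 1 < θ)
    (ht : Tendsto (fun n => (t n * (θ - 1) - 1) * Real.log n) atTop (𝓝 0)) :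
    Tendsto (fun n => (θ * t n / (1 + t n)) ^ d n) atTop (𝓝 1) := by
  have hθ1 : 0 < θ - 1 := by linarith
  have htl := tendsto_rate hθ ht
  have h1 := (h.tendsto_mass hθ ht).mul (htl.const_add 1)
  have e : (1 - θ⁻¹) * (1 + (θ - 1)⁻¹) = 1 := by field_simp; ring
  rw [e] at h1
  refine h1.congr' ?_
  filter_upwards [htl.eventually_const_lt (u := 0) (by positivity)] with n hn
  rw [div_pow, mul_pow, pow_succ]
  field_simp

/-- The normalised expected number of vertices with weight parameter `w`, degree `d + s` and label
in the window given by `B`. -/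
noncomputable def windowSum (θ : ℝ) (d : ℕ → ℕ) (D : ℕ → ℝ) (N : ℕ → ℕ) (t : ℕ → ℝ) (B : Set ℝ)
    (s n : ℕ) (w : ℝ) : ℝ :=
  θ ^ d n / n * ∑ v ∈ Finset.Icc (N n) n,
    B.indicator (1 : ℝ → ℝ) (lab (1 - θ⁻¹) n (D n) v) * pois (w * t n * harm n v) (d n + s)

lemma windowSum_nonneg {B : Set ℝ} (hθ : 1 < θ) {n : ℕ} (ht : 0 ≤ t n) {w : ℝ} (hw : 0 ≤ w)
    (s : ℕ) : 0 ≤ windowSum θ d D N t B s n w := by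
  unfold windowSum
  refine mul_nonneg (by positivity) (Finset.sum_nonneg fun v _ => ?_)
  exact mul_nonneg (Set.indicator_nonneg (fun _ _ => zero_le_one) _)
    (pois_nonneg (mul_nonneg (mul_nonneg hw ht) (harm_nonneg _ _)) _)

/-- Dropping the label condition leaves a geometric law with parameter `w t`. The factor with
exponent `d` keeps `w`, because it decides whether the weight contributes; the factor with exponent
`s` is made uniform in `w` by monotonicity of `u / (1 + u)`. -/
lemma windowSum_le {B : Set ℝ} (hθ : 1 < θ) {n : ℕ} (hN : 3 ≤ N n) (ht : 0 ≤ t n) {w : ℝ}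
    (hw : 0 ≤ w) (hw1 : w ≤ 1) (s : ℕ) :
    windowSum θ d D N t B s n w ≤
      Real.exp (t n * (2 / (N n - 2))) * (θ * (w * t n) / (1 + w * t n)) ^ d n *
        (t n / (1 + t n)) ^ s := by
  unfold windowSum
  have hwt : 0 ≤ w * t n := mul_nonneg hw ht
  have hN' : (3 : ℝ) ≤ N n := by exact_mod_cast hN
  have hN2 : 0 < (N n : ℝ) - 2 := by linarith
  rcases Nat.eq_zero_or_pos n with rfl | hn
  · simp only [Nat.cast_zero, div_zero, zero_mul]; positivity
  have hn0 : (0 : ℝ) < n := by exact_mod_cast hn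
  have h1 : ∑ v ∈ Finset.Icc (N n) n, B.indicator (1 : ℝ → ℝ) (lab (1 - θ⁻¹) n (D n) v) *
      pois (w * t n * harm n v) (d n + s) ≤
      ∑ v ∈ Finset.Icc (N n) n, pois (w * t n * harm n v) (d n + s) := by
    refine Finset.sum_le_sum fun v _ => ?_
    refine mul_le_of_le_one_left (pois_nonneg (mul_nonneg hwt (harm_nonneg _ _)) _) ?_
    exact Set.indicator_le_self' (s := B) (f := (1 : ℝ → ℝ)) (fun _ _ => zero_le_one) _
  have hfrac : w * t n / (1 + w * t n) ≤ t n / (1 + t n) := by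
    rw [div_le_div_iff₀ (by positivity) (by positivity)]
    nlinarith
  calc _ ≤ θ ^ d n / n * (n * (Real.exp (w * t n * (2 / (N n - 2))) *
        ((w * t n) ^ (d n + s) / (1 + w * t n) ^ (d n + s + 1)))) := by
        gcongr
        exact h1.trans (sum_pois_harm_le hN hwt _)
    _ = Real.exp (w * t n * (2 / (N n - 2))) * ((θ * (w * t n) / (1 + w * t n)) ^ d n *
        ((w * t n / (1 + w * t n)) ^ s * (1 + w * t n)⁻¹)) := by
        rw [div_pow, div_pow, mul_pow θ]
        field_simp
        ring
    _ ≤ Real.exp (t n * (2 / (N n - 2))) * ((θ * (w * t n) / (1 + w * t n)) ^ d n *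
        ((t n / (1 + t n)) ^ s * 1)) := by
        have hinv : (1 + w * t n)⁻¹ ≤ 1 := inv_le_one_of_one_le₀ (by linarith)
        gcongr
        exact mul_le_of_le_one_left ht hw1
    _ = _ := by ring

lemma tendsto_exp_cutoff (h : Admissible (1 - θ⁻¹) d D N) (hθ : 1 < θ)
    (ht : Tendsto (fun n => (t n * (θ - 1) - 1) * Real.log n) atTop (𝓝 0)) :
    Tendsto (fun n => Real.exp (t n * (2 / (N n - 2)))) atTop (𝓝 1) := by
  have hNlim : Tendsto (fun n => (2 : ℝ) / (N n - 2)) atTop (𝓝 0) :=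
    tendsto_const_nhds.div_atTop
      ((tendsto_atTop_add_const_right _ (-2) (tendsto_natCast_atTop_atTop.comp h.tendsto_cutoff)))
  have := (Real.continuous_exp.tendsto _).comp ((tendsto_rate hθ ht).mul hNlim)
  simpa [Function.comp_def] using this

/-- The bound is uniform in the weight and summable in the level, so it serves as majorant for both
limits that follow. The ratio is the midpoint between `1` and the limiting ratio `θ⁻¹`. -/
lemma windowSum_bound (h : Admissible (1 - θ⁻¹) d D N) (hθ : 1 < θ)
    (ht : Tendsto (fun n => (t n * (θ - 1) - 1) * Real.log n) atTop (𝓝 0)) (B : Set ℝ) :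
    ∀ᶠ n in atTop, ∀ s : ℕ, ∀ w : ℝ, 0 ≤ w → w ≤ 1 →
      windowSum θ d D N t B s n w ≤ 4 * ((1 + θ⁻¹) / 2) ^ s := by
  have hθ1 : 0 < θ - 1 := by linarith
  have htl := tendsto_rate hθ ht
  have hfr := tendsto_rate_frac hθ ht
  have hθi : θ⁻¹ < 1 := inv_lt_one_of_one_lt₀ hθ
  filter_upwards [h.tendsto_cutoff.eventually_ge_atTop 3,
    htl.eventually_const_lt (u := 0) (by positivity),
    (h.tendsto_exp_cutoff hθ ht).eventually_lt_const one_lt_two,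
    (h.tendsto_base_pow hθ ht).eventually_lt_const one_lt_two,
    hfr.eventually_lt_const (show θ⁻¹ < (1 + θ⁻¹) / 2 by linarith)] with n h1 h2 h3 h4 h5 s w hw hw1
  refine (windowSum_le hθ h1 h2.le hw hw1 s).trans ?_
  have hwt : 0 ≤ w * t n := mul_nonneg hw h2.le
  have h6 : (θ * (w * t n) / (1 + w * t n)) ^ d n ≤ 2 := by
    refine le_trans ?_ h4.le
    gcongr ?_ ^ _
    rw [mul_div_assoc, mul_div_assoc θ (t n)]
    refine mul_le_mul_of_nonneg_left ?_ (by linarith)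
    rw [div_le_div_iff₀ (by positivity) (by positivity)]
    nlinarith
  have h7 : 0 ≤ t n / (1 + t n) := by positivity
  calc _ ≤ 2 * 2 * ((1 + θ⁻¹) / 2) ^ s := by gcongr
    _ = _ := by norm_num

/-- The base of the power `d` tends to `θ w / (θ - 1 + w)`, which is below one exactly when `w < 1`;
the decay is therefore geometric in `d`. -/
lemma windowSum_tendsto_of_lt_one (h : Admissible (1 - θ⁻¹) d D N) (hθ : 1 < θ)
    (ht : Tendsto (fun n => (t n * (θ - 1) - 1) * Real.log n) atTop (𝓝 0)) (B : Set ℝ) (s : ℕ)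
    {w : ℝ} (hw : 0 ≤ w) (hw1 : w < 1) :
    Tendsto (fun n => windowSum θ d D N t B s n w) atTop (𝓝 0) := by
  have hθ1 : 0 < θ - 1 := by linarith
  have htl := tendsto_rate hθ ht
  have hfr := tendsto_rate_frac hθ ht
  have hbase : Tendsto (fun n => θ * (w * t n) / (1 + w * t n)) atTop
      (𝓝 (θ * (w * (θ - 1)⁻¹) / (1 + w * (θ - 1)⁻¹))) :=
    ((htl.const_mul w).const_mul θ).div ((htl.const_mul w).const_add 1) (by positivity)
  have hlt : θ * (w * (θ - 1)⁻¹) / (1 + w * (θ - 1)⁻¹) < 1 := by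
    rw [div_lt_one (by positivity)]
    field_simp
    nlinarith
  obtain ⟨r, hr1, hr2⟩ := exists_between hlt
  have hr0 : 0 ≤ r := le_trans (by positivity) hr1.le
  have hpow : Tendsto (fun n => r ^ d n) atTop (𝓝 0) :=
    (tendsto_pow_atTop_nhds_zero_of_lt_one hr0 hr2).comp h.tendsto_degree
  have hlim : Tendsto (fun n => Real.exp (t n * (2 / (N n - 2))) * r ^ d n *
      (t n / (1 + t n)) ^ s) atTop (𝓝 0) := by
    have := ((h.tendsto_exp_cutoff hθ ht).mul hpow).mul (hfr.pow s)
    simpa using this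
  have htpos := htl.eventually_const_lt (u := 0) (by positivity)
  refine squeeze_zero' ?_ ?_ hlim
  · filter_upwards [htpos] with n hn using windowSum_nonneg hθ hn.le hw s
  · filter_upwards [htpos, h.tendsto_cutoff.eventually_ge_atTop 3,
      hbase.eventually_lt_const hr1] with n hn h3 h4
    refine (windowSum_le hθ h3 hn.le hw hw1.le s).trans ?_
    gcongr

/-- The normalisation is `θ^d` while the degree is `d + s`; this is the origin of `θ⁻¹ ^ s`. -/
lemma windowSum_tendsto_one (h : Admissible (1 - θ⁻¹) d D N) (hθ : 1 < θ)
    (ht : Tendsto (fun n => (t n * (θ - 1) - 1) * Real.log n) atTop (𝓝 0)) {B : Set ℝ}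
    (hB : MeasurableSet B) (hBf : Phi (frontier B) = 0) (s : ℕ) :
    Tendsto (fun n => windowSum θ d D N t B s n 1) atTop
      (𝓝 ((1 - θ⁻¹) * θ⁻¹ ^ s * Phi B)) := by
  have hθ1 : 0 < θ - 1 := by linarith
  have htl := tendsto_rate hθ ht
  have htpos := htl.eventually_const_lt (u := 0) (by positivity)
  have h1 := ((h.add s).tendsto_sum hθ ht (htpos.mono fun _ => le_of_lt)
    ⟨(θ - 1)⁻¹ + 1, (htl.eventually_lt_const (lt_add_one _)).mono fun _ => le_of_lt⟩ hB hBf).mul_const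
    (θ⁻¹ ^ s)
  have e : (1 - θ⁻¹) * Phi B * θ⁻¹ ^ s = (1 - θ⁻¹) * θ⁻¹ ^ s * Phi B := by ring
  rw [e] at h1
  refine h1.congr fun n => ?_
  simp only [windowSum, one_mul, pow_add, inv_pow]
  field_simp

lemma continuous_windowSum (B : Set ℝ) (s n : ℕ) :
    Continuous fun w => windowSum θ d D N t B s n w := by
  unfold windowSum
  refine continuous_const.mul (continuous_finsetSum _ fun v _ => continuous_const.mul ?_)
  exact (continuous_pois _).comp (by fun_prop)

variable {Ω : Type*} [MeasurableSpace Ω] {P : Measure Ω} [IsProbabilityMeasure P] {Y : Ω → ℝ}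

/-- Pointwise the integrand converges to a constant on `{Y = 1}` and to zero on `{Y < 1}`, so by
dominated convergence only the atom of the weight distribution survives. -/
lemma tendsto_integral_windowSum (h : Admissible (1 - θ⁻¹) d D N) (hθ : 1 < θ)
    (ht : Tendsto (fun n => (t n * (θ - 1) - 1) * Real.log n) atTop (𝓝 0)) {B : Set ℝ}
    (hB : MeasurableSet B) (hBf : Phi (frontier B) = 0) (hY : Measurable Y)
    (hY0 : ∀ᵐ ω ∂P, 0 < Y ω) (hY1 : ∀ᵐ ω ∂P, Y ω ≤ 1) (s : ℕ) :
    Tendsto (fun n => ∫ ω, windowSum θ d D N t B s n (Y ω) ∂P) atTop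
      (𝓝 (P.real {ω | Y ω = 1} * ((1 - θ⁻¹) * θ⁻¹ ^ s * Phi B))) := by
  have hθ1 : 0 < θ - 1 := by linarith
  have htpos := (tendsto_rate hθ ht).eventually_const_lt (u := 0) (by positivity)
  have hms : MeasurableSet {ω | Y ω = 1} := hY (measurableSet_singleton 1)
  have e : P.real {ω | Y ω = 1} * ((1 - θ⁻¹) * θ⁻¹ ^ s * Phi B) =
      ∫ ω, ({ω | Y ω = 1}.indicator (fun _ => (1 - θ⁻¹) * θ⁻¹ ^ s * Phi B)) ω ∂P := by
    rw [integral_indicator_const _ hms, smul_eq_mul]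
  rw [e]
  refine tendsto_integral_filter_of_dominated_convergence (fun _ => 4 * ((1 + θ⁻¹) / 2) ^ s)
    ?_ ?_ (integrable_const _) ?_
  · exact Eventually.of_forall fun n =>
      ((continuous_windowSum B s n).measurable.comp hY).aestronglyMeasurable
  · filter_upwards [h.windowSum_bound hθ ht B, htpos] with n hn hn2
    filter_upwards [hY0, hY1] with ω h0 h1
    rw [Real.norm_eq_abs, abs_of_nonneg (windowSum_nonneg hθ hn2.le h0.le s)]
    exact hn s _ h0.le h1
  · filter_upwards [hY0, hY1] with ω h0 h1
    rcases h1.lt_or_eq with h2 | h2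
    · rw [Set.indicator_of_notMem (by simp [h2.ne])]
      exact h.windowSum_tendsto_of_lt_one hθ ht B s h0.le h2
    · rw [Set.indicator_of_mem (by simpa using h2)]
      simp only [h2]
      exact h.windowSum_tendsto_one hθ ht hB hBf s

/-- The same for degrees at least `d`. -/
lemma tendsto_sum_integral_windowSum (h : Admissible (1 - θ⁻¹) d D N) (hθ : 1 < θ)
    (ht : Tendsto (fun n => (t n * (θ - 1) - 1) * Real.log n) atTop (𝓝 0)) {B : Set ℝ}
    (hB : MeasurableSet B) (hBf : Phi (frontier B) = 0) (hY : Measurable Y)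
    (hY0 : ∀ᵐ ω ∂P, 0 < Y ω) (hY1 : ∀ᵐ ω ∂P, Y ω ≤ 1) :
    Tendsto (fun n => ∑ s ∈ Finset.range n, ∫ ω, windowSum θ d D N t B s n (Y ω) ∂P) atTop
      (𝓝 (P.real {ω | Y ω = 1} * Phi B)) := by
  have hθ1 : 0 < θ - 1 := by linarith
  have hθi : θ⁻¹ < 1 := inv_lt_one_of_one_lt₀ hθ
  have hθi0 : 0 < θ⁻¹ := by positivity
  have htpos := (tendsto_rate hθ ht).eventually_const_lt (u := 0) (by positivity)
  have hlim : ∑' s : ℕ, P.real {ω | Y ω = 1} * ((1 - θ⁻¹) * θ⁻¹ ^ s * Phi B) =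
      P.real {ω | Y ω = 1} * Phi B := by
    have h1 : ∀ s : ℕ, P.real {ω | Y ω = 1} * ((1 - θ⁻¹) * θ⁻¹ ^ s * Phi B) =
        P.real {ω | Y ω = 1} * (1 - θ⁻¹) * Phi B * θ⁻¹ ^ s := fun s => by ring
    simp_rw [h1]
    rw [tsum_mul_left, tsum_geometric_of_lt_one hθi0.le hθi]
    have : 1 - θ⁻¹ ≠ 0 := by linarith
    field_simp
  rw [← hlim]
  have hsummable : Summable fun s : ℕ => 4 * ((1 + θ⁻¹) / 2) ^ s :=
    (summable_geometric_of_lt_one (by positivity) (by linarith)).mul_left 4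
  -- The finite sum is a series in `s` with vanishing terms from `n` on; the limiting series is
  -- geometric and its sum cancels `1 - θ⁻¹`.
  have key := tendsto_tsum_of_dominated_convergence (𝓕 := atTop)
    (f := fun n s => if s < n then ∫ ω, windowSum θ d D N t B s n (Y ω) ∂P else 0)
    (g := fun s => P.real {ω | Y ω = 1} * ((1 - θ⁻¹) * θ⁻¹ ^ s * Phi B)) hsummable ?_ ?_
  · refine key.congr fun n => ?_
    rw [tsum_eq_sum (s := Finset.range n) (fun s hs => by
      rw [if_neg (by simpa using hs)])]
    exact Finset.sum_congr rfl fun s hs => if_pos (Finset.mem_range.1 hs)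
  · intro s
    refine (h.tendsto_integral_windowSum hθ ht hB hBf hY hY0 hY1 s).congr' ?_
    filter_upwards [eventually_gt_atTop s] with n hn
    rw [if_pos hn]
  · filter_upwards [h.windowSum_bound hθ ht B, htpos] with n hn hn2 s
    split_ifs
    · refine (norm_integral_le_of_norm_le_const (C := 4 * ((1 + θ⁻¹) / 2) ^ s) ?_).trans ?_
      · filter_upwards [hY0, hY1] with ω h0 h1
        rw [Real.norm_eq_abs, abs_of_nonneg (windowSum_nonneg hθ hn2.le h0.le s)]
        exact hn s _ h0.le h1
      · simp
    · rw [norm_zero]; positivity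

end Admissible

/-! ### The joint law of the degrees for given weights -/

/-- The partial sums of a deterministic weight sequence. -/
noncomputable def wsum (w : ℕ → ℝ) (n : ℕ) : ℝ := ∑ i ∈ Finset.Icc 1 n, w i

lemma wsum_pos {w : ℕ → ℝ} (hw : ∀ i, 1 ≤ i → 0 < w i) {n : ℕ} (hn : 1 ≤ n) : 0 < wsum w n :=
  Finset.sum_pos (fun i hi => hw i (Finset.mem_Icc.1 hi).1) ⟨1, by simp [hn]⟩

/-- The in-degree of `v` in the tree on `1, …, n` in which `m + 1` is attached to `a m`. -/
def deg (a : ℕ → ℕ) (n v : ℕ) : ℕ := ((Finset.Ico 1 n).filter fun m => a m = v).card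

lemma deg_update (a : ℕ → ℕ) (M i v : ℕ) :
    deg (Function.update a (M + 1) i) (M + 2) v = deg a (M + 1) v + if i = v then 1 else 0 := by
  unfold deg
  rw [Finset.card_filter, Finset.card_filter, Finset.sum_Ico_succ_top (by omega)]
  congr 1
  · refine Finset.sum_congr rfl fun m hm => ?_
    rw [Function.update_of_ne (by have := (Finset.mem_Ico.1 hm).2; omega)]
  · rw [Function.update_self]

open Classical in
/-- The attachment sequences `a 1, …, a M`, continued by zero. -/
noncomputable def paths : ℕ → Finset (ℕ → ℕ)
  | 0 => {fun _ => 0}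
  | M + 1 => (paths M ×ˢ Finset.Icc 1 (M + 1)).image fun p => Function.update p.1 (M + 1) p.2

lemma paths_spec {M : ℕ} {a : ℕ → ℕ} (ha : a ∈ paths M) :
    (∀ m ∈ Finset.Icc 1 M, a m ∈ Finset.Icc 1 m) ∧ ∀ m ∉ Finset.Icc 1 M, a m = 0 := by
  induction M generalizing a with
  | zero => simp only [paths, Finset.mem_singleton] at ha; subst ha; simp
  | succ M ih =>
    simp only [paths, Finset.mem_image, Finset.mem_product, Prod.exists] at ha
    obtain ⟨b, i, ⟨hb, hi⟩, rfl⟩ := ha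
    obtain ⟨h1, h2⟩ := ih hb
    refine ⟨fun m hm => ?_, fun m hm => ?_⟩
    · rcases eq_or_ne m (M + 1) with rfl | hne
      · simpa using hi
      · rw [Function.update_of_ne hne]
        exact h1 m (by simp only [Finset.mem_Icc] at hm ⊢; omega)
    · rw [Function.update_of_ne (by rintro rfl; simp at hm)]
      exact h2 m (by simp only [Finset.mem_Icc] at hm ⊢; omega)

/-- The conditional expectation of `f` of the attachments of the vertices `2, …, M + 1`, given the
weights `w`. -/
noncomputable def pathSum (w : ℕ → ℝ) (M : ℕ) (f : (ℕ → ℕ) → ℝ) : ℝ :=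
  ∑ a ∈ paths M, (∏ m ∈ Finset.Ico 1 (M + 1), w (a m) / wsum w m) * f a

lemma pathSum_zero (w : ℕ → ℝ) (f : (ℕ → ℕ) → ℝ) : pathSum w 0 f = f fun _ => 0 := by
  simp [pathSum, paths]

/-- Tower property: the last attachment is averaged first. Extending a path by one attachment is
injective because paths vanish outside `Icc 1 M`. -/
lemma pathSum_succ (w : ℕ → ℝ) (M : ℕ) (f : (ℕ → ℕ) → ℝ) :
    pathSum w (M + 1) f = pathSum w M fun a =>
      ∑ i ∈ Finset.Icc 1 (M + 1), w i / wsum w (M + 1) * f (Function.update a (M + 1) i) := by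
  classical
  unfold pathSum
  rw [paths, Finset.sum_image, Finset.sum_product]
  · refine Finset.sum_congr rfl fun a _ => ?_
    rw [Finset.mul_sum]
    refine Finset.sum_congr rfl fun i _ => ?_
    simp only
    rw [Finset.prod_Ico_succ_top (by omega), Function.update_self, mul_assoc]
    congr 1
    refine Finset.prod_congr rfl fun m hm => ?_
    rw [Function.update_of_ne (by have := (Finset.mem_Ico.1 hm).2; omega)]
  · rintro ⟨a, i⟩ ha ⟨b, k⟩ hb h
    simp only [Finset.coe_product, Set.mem_prod, Finset.mem_coe] at ha hb
    simp only at h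
    have hi : i = k := by
      have := congrFun h (M + 1)
      simpa using this
    have hab : a = b := by
      ext m
      rcases eq_or_ne m (M + 1) with rfl | hne
      · rw [(paths_spec ha.1).2 _ (by simp), (paths_spec hb.1).2 _ (by simp)]
      · have := congrFun h m
        rwa [Function.update_of_ne hne, Function.update_of_ne hne] at this
    rw [hi, hab]

lemma pathSum_weight_nonneg {w : ℕ → ℝ} (hw : ∀ i, 1 ≤ i → 0 < w i) {M : ℕ} {a : ℕ → ℕ}
    (ha : a ∈ paths M) : 0 ≤ ∏ m ∈ Finset.Ico 1 (M + 1), w (a m) / wsum w m := by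
  refine Finset.prod_nonneg fun m hm => ?_
  rw [Finset.mem_Ico] at hm
  have h1 := Finset.mem_Icc.1 ((paths_spec ha).1 m (by simp only [Finset.mem_Icc]; omega))
  exact div_nonneg (hw _ h1.1).le (wsum_pos hw hm.1).le

lemma pathSum_mono {w : ℕ → ℝ} (hw : ∀ i, 1 ≤ i → 0 < w i) {M : ℕ} {f g : (ℕ → ℕ) → ℝ}
    (h : ∀ a, f a ≤ g a) : pathSum w M f ≤ pathSum w M g :=
  Finset.sum_le_sum fun a ha => mul_le_mul_of_nonneg_left (h a) (pathSum_weight_nonneg hw ha)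

lemma pathSum_nonneg {w : ℕ → ℝ} (hw : ∀ i, 1 ≤ i → 0 < w i) {M : ℕ} {f : (ℕ → ℕ) → ℝ}
    (h : ∀ a, 0 ≤ f a) : 0 ≤ pathSum w M f :=
  Finset.sum_nonneg fun a ha => mul_nonneg (pathSum_weight_nonneg hw ha) (h a)

lemma pathSum_const_mul (w : ℕ → ℝ) (M : ℕ) (c : ℝ) (f : (ℕ → ℕ) → ℝ) :
    pathSum w M (fun a => c * f a) = c * pathSum w M f := by
  unfold pathSum
  rw [Finset.mul_sum]
  exact Finset.sum_congr rfl fun a _ => by ring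

lemma pathSum_add (w : ℕ → ℝ) (M : ℕ) (f g : (ℕ → ℕ) → ℝ) :
    pathSum w M (fun a => f a + g a) = pathSum w M f + pathSum w M g := by
  unfold pathSum
  rw [← Finset.sum_add_distrib]
  exact Finset.sum_congr rfl fun a _ => by ring

lemma pathSum_sum {κ : Type*} (w : ℕ → ℝ) (M : ℕ) (s : Finset κ) (f : κ → (ℕ → ℕ) → ℝ) :
    pathSum w M (fun a => ∑ k ∈ s, f k a) = ∑ k ∈ s, pathSum w M (f k) := by
  unfold pathSum
  rw [Finset.sum_comm]
  exact Finset.sum_congr rfl fun a _ => by rw [Finset.mul_sum]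

lemma pathSum_one {w : ℕ → ℝ} (hw : ∀ i, 1 ≤ i → 0 < w i) (M : ℕ) :
    pathSum w M (fun _ => 1) = 1 := by
  induction M with
  | zero => rw [pathSum_zero]
  | succ M ih =>
    have h1 : ∑ i ∈ Finset.Icc 1 (M + 1), w i / wsum w (M + 1) = 1 := by
      rw [← Finset.sum_div]
      exact div_self (wsum_pos hw (by omega)).ne'
    rw [pathSum_succ]
    simp only [mul_one, h1, ih]

/-- The left side collects the terms with at most one factor `β` in the expansion of the right side.
This is the form in which upper bounds propagate, since in one step at most one of the tracked
vertices gains an edge. -/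
lemma prod_add_sum_le {ι : Type*} [DecidableEq ι] {s : Finset ι} {α β : ι → ℝ} (hα : ∀ l, 0 ≤ α l) (hβ : ∀ l, 0 ≤ β l) :
    ∏ l ∈ s, α l + ∑ l ∈ s, β l * ∏ k ∈ s.erase l, α k ≤ ∏ l ∈ s, (α l + β l) := by
  induction s using Finset.induction_on with
  | empty => simp
  | insert x s hx ih =>
    rw [Finset.prod_insert hx, Finset.prod_insert hx, Finset.sum_insert hx,
      Finset.erase_insert hx]
    have h1 : ∑ l ∈ s, β l * ∏ k ∈ (insert x s).erase l, α k =
        α x * ∑ l ∈ s, β l * ∏ k ∈ s.erase l, α k := by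
      rw [Finset.mul_sum]
      refine Finset.sum_congr rfl fun l hl => ?_
      rw [Finset.erase_insert_of_ne (by rintro rfl; exact hx hl),
        Finset.prod_insert (fun h => hx (Finset.mem_of_mem_erase h))]
      ring
    have h2 : ∏ l ∈ s, α l ≤ ∏ l ∈ s, (α l + β l) :=
      Finset.prod_le_prod (fun l _ => hα l) fun l _ => by linarith [hβ l]
    rw [h1]
    have h3 := mul_le_mul_of_nonneg_left ih (hα x)
    have h4 := mul_le_mul_of_nonneg_left h2 (hβ x)
    linarith

/-- The factors `α` are replaced by `β` one at a time; each replacement costs at most `γ l` times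
the other factors, which are bounded by `α`. It propagates the lower bound. -/
lemma prod_le_prod_add_sum {ι : Type*} [DecidableEq ι] {s : Finset ι} {α β γ : ι → ℝ} (hβ : ∀ l, 0 ≤ β l)
    (hβα : ∀ l, β l ≤ α l) (hγ : ∀ l, 0 ≤ γ l) (hα : ∀ l, α l ≤ β l + γ l) :
    ∏ l ∈ s, α l ≤ ∏ l ∈ s, β l + ∑ l ∈ s, γ l * ∏ k ∈ s.erase l, α k := by
  have hα0 : ∀ l, 0 ≤ α l := fun l => (hβ l).trans (hβα l)
  induction s using Finset.induction_on with
  | empty => simp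
  | insert x s hx ih =>
    rw [Finset.prod_insert hx, Finset.prod_insert hx, Finset.sum_insert hx,
      Finset.erase_insert hx]
    have h1 : ∑ l ∈ s, γ l * ∏ k ∈ (insert x s).erase l, α k =
        α x * ∑ l ∈ s, γ l * ∏ k ∈ s.erase l, α k := by
      rw [Finset.mul_sum]
      refine Finset.sum_congr rfl fun l hl => ?_
      rw [Finset.erase_insert_of_ne (by rintro rfl; exact hx hl),
        Finset.prod_insert (fun h => hx (Finset.mem_of_mem_erase h))]
      ring
    have h2 : 0 ≤ ∏ l ∈ s, α l := Finset.prod_nonneg fun l _ => hα0 l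
    have h5 : 0 ≤ ∑ l ∈ s, γ l * ∏ k ∈ s.erase l, α k :=
      Finset.sum_nonneg fun l _ => mul_nonneg (hγ l) (Finset.prod_nonneg fun k _ => hα0 k)
    rw [h1]
    have h3 := mul_le_mul_of_nonneg_left ih (hβ x)
    have h4 := mul_le_mul_of_nonneg_right (hα x) h2
    have h6 := mul_le_mul_of_nonneg_right (hβα x) h5
    linarith

lemma pow_add_mul_pow_le {R r : ℝ} (hR : 0 ≤ R) (hr : 0 ≤ r) (k : ℕ) :
    R ^ (k + 1) + (k + 1) * r * R ^ k ≤ (R + r) ^ (k + 1) := by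
  induction k with
  | zero => simp
  | succ k ih =>
    have h1 := mul_le_mul_of_nonneg_right ih (add_nonneg hR hr)
    have h2 : 0 ≤ (k + 1) * r * R ^ k * r := by positivity
    rw [pow_succ (R + r)]
    push_cast
    rw [pow_succ R (k + 1), pow_succ R k] at *
    nlinarith

lemma pow_sub_pow_le {A B : ℝ} (hB : 0 ≤ B) (hBA : B ≤ A) (k : ℕ) :
    A ^ (k + 1) ≤ B ^ (k + 1) + (k + 1) * (A - B) * A ^ k := by
  induction k with
  | zero => simp
  | succ k ih =>
    have hA : 0 ≤ A := hB.trans hBA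
    have h1 := mul_le_mul_of_nonneg_right ih hA
    have h2 : B ^ (k + 1) * (A - B) ≤ A ^ (k + 1) * (A - B) := by
      have := sub_nonneg.2 hBA
      gcongr
    rw [pow_succ A (k + 1), pow_succ B (k + 1)]
    push_cast
    rw [pow_succ A k] at *
    nlinarith

section Degrees

variable {ι : Type*} [Fintype ι] [DecidableEq ι]

/-- The probability, given the weights `w`, that the vertex `m + 1` is attached to `v`. -/
noncomputable def attachProb (w : ℕ → ℝ) (v m : ℕ) : ℝ := if v ≤ m then w v / wsum w m else 0

lemma attachProb_nonneg {w : ℕ → ℝ} (hw : ∀ i, 1 ≤ i → 0 < w i) {v : ℕ} (hv : 1 ≤ v) (m : ℕ) :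
    0 ≤ attachProb w v m := by
  unfold attachProb
  split_ifs with h
  · exact div_nonneg (hw _ hv).le (wsum_pos hw (hv.trans h)).le
  · exact le_rfl

/-- As the tracked vertices are distinct, a new vertex attaches to at most one of them, so the
change of `F` is a sum of mutually exclusive increments. -/
lemma step_sum {w : ℕ → ℝ} (hw : ∀ i, 1 ≤ i → 0 < w i) {v : ι → ℕ} (hv : Function.Injective v)
    (hv1 : ∀ l, 1 ≤ v l) {m : ℕ} (hm : 1 ≤ m) (F : (ι → ℕ) → ℝ) (c : ι → ℕ) :
    ∑ i ∈ Finset.Icc 1 m, w i / wsum w m * F (fun l => c l + if i = v l then 1 else 0) =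
      (1 - ∑ l, attachProb w (v l) m) * F c +
        ∑ l, attachProb w (v l) m * F (c + Pi.single l 1) := by
  have h1 : ∀ i, F (fun l => c l + if i = v l then 1 else 0) =
      F c + ∑ l, if i = v l then F (c + Pi.single l 1) - F c else 0 := by
    intro i
    by_cases h : ∃ l, i = v l
    · obtain ⟨l, rfl⟩ := h
      have e : (fun k => c k + if v l = v k then 1 else 0) = c + Pi.single l 1 := by
        ext k
        by_cases hk : l = k
        · subst hk; simp
        · rw [if_neg (fun h => hk (hv h))]
          simp [Ne.symm hk]
      rw [e, Finset.sum_eq_single l]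
      · simp
      · intro k _ hk
        rw [if_neg (fun h => hk (hv h).symm)]
      · simp
    · have h2 : ∀ l, ¬ i = v l := fun l hl => h ⟨l, hl⟩
      simp only [h2, if_false, add_zero, Finset.sum_const_zero]
  have hS := (wsum_pos hw hm).ne'
  have hone : ∑ i ∈ Finset.Icc 1 m, w i / wsum w m = 1 := by
    rw [← Finset.sum_div]; exact div_self hS
  have h2 : ∀ l, ∑ i ∈ Finset.Icc 1 m, w i / wsum w m *
      (if i = v l then F (c + Pi.single l 1) - F c else 0) =
      attachProb w (v l) m * (F (c + Pi.single l 1) - F c) := by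
    intro l
    simp only [mul_ite, mul_zero, Finset.sum_ite_eq', Finset.mem_Icc, hv1 l, true_and, attachProb,
      ite_mul, zero_mul]
  simp_rw [h1, mul_add, Finset.sum_add_distrib, Finset.mul_sum]
  rw [Finset.sum_comm, ← Finset.sum_mul, hone]
  simp_rw [h2, mul_sub, Finset.sum_sub_distrib]
  rw [← Finset.sum_mul]
  ring

/-- One step of the evolution of the degrees of the vertices `v l`. -/
lemma pathSum_degrees_succ {w : ℕ → ℝ} (hw : ∀ i, 1 ≤ i → 0 < w i) {v : ι → ℕ}
    (hv : Function.Injective v) (hv1 : ∀ l, 1 ≤ v l) (M : ℕ) (F : (ι → ℕ) → ℝ) :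
    pathSum w (M + 1) (fun a => F fun l => deg a (M + 2) (v l)) =
      (1 - ∑ l, attachProb w (v l) (M + 1)) * pathSum w M (fun a => F fun l => deg a (M + 1) (v l)) +
        ∑ l, attachProb w (v l) (M + 1) *
          pathSum w M (fun a => F ((fun l => deg a (M + 1) (v l)) + Pi.single l 1)) := by
  rw [pathSum_succ]
  simp_rw [deg_update]
  simp_rw [step_sum hw hv hv1 (show 1 ≤ M + 1 by omega)]
  rw [pathSum_add, pathSum_const_mul, pathSum_sum]
  simp_rw [pathSum_const_mul]

/-- The probability, given the weights `w`, that the vertices `v l` have degrees `D l` in the tree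
on `1, …, M + 1`. -/
noncomputable def degProb (w : ℕ → ℝ) (v : ι → ℕ) (M : ℕ) (D : ι → ℕ) : ℝ :=
  pathSum w M fun a => if (fun l => deg a (M + 1) (v l)) = D then 1 else 0

lemma degProb_zero (w : ℕ → ℝ) (v : ι → ℕ) (D : ι → ℕ) :
    degProb w v 0 D = if D = 0 then 1 else 0 := by
  rw [degProb, pathSum_zero]
  refine if_congr ?_ rfl rfl
  rw [eq_comm]
  simp [deg, funext_iff]

lemma degProb_succ {w : ℕ → ℝ} (hw : ∀ i, 1 ≤ i → 0 < w i) {v : ι → ℕ}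
    (hv : Function.Injective v) (hv1 : ∀ l, 1 ≤ v l) (M : ℕ) (D : ι → ℕ) :
    degProb w v (M + 1) D = (1 - ∑ l, attachProb w (v l) (M + 1)) * degProb w v M D +
      ∑ l, attachProb w (v l) (M + 1) *
        if D l = 0 then 0 else degProb w v M (Function.update D l (D l - 1)) := by
  unfold degProb
  rw [pathSum_degrees_succ hw hv hv1 M (fun c => if c = D then 1 else 0)]
  congr 1
  refine Finset.sum_congr rfl fun l _ => ?_
  congr 1
  split_ifs with h
  · have : ∀ a : ℕ → ℕ, ¬ (fun l => deg a (M + 1) (v l)) + Pi.single l 1 = D := by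
      intro a ha
      have := congrFun ha l
      simp only [Pi.add_apply, Pi.single_eq_same] at this
      omega
    simp_rw [if_neg (this _)]
    simp [pathSum]
  · congr 1
    ext a
    refine if_congr ?_ rfl rfl
    constructor
    · rintro rfl
      ext k
      by_cases hk : k = l
      · subst hk; simp
      · simp [hk]
    · intro ha
      ext k
      have := congrFun ha k
      by_cases hk : k = l
      · subst hk
        simp only [Function.update_self] at this
        simp only [Pi.add_apply, Pi.single_eq_same]
        omega
      · rw [Function.update_of_ne hk] at this
        simpa [hk] using this

lemma prod_update_pow_div (R : ι → ℝ) (D : ι → ℕ) (l : ι) :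
    ∏ k, R k ^ (Function.update D l (D l - 1) k) / (Function.update D l (D l - 1) k).factorial =
      R l ^ (D l - 1) / (D l - 1).factorial *
        ∏ k ∈ Finset.univ.erase l, R k ^ D k / (D k).factorial := by
  rw [← Finset.mul_prod_erase _ _ (Finset.mem_univ l), Function.update_self]
  congr 1
  refine Finset.prod_congr rfl fun k hk => ?_
  rw [Function.update_of_ne (Finset.ne_of_mem_erase hk)]

/-- Upper bound for the joint degree distribution. -/
lemma degProb_le {w : ℕ → ℝ} (hw : ∀ i, 1 ≤ i → 0 < w i) {v : ι → ℕ}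
    (hv : Function.Injective v) (hv1 : ∀ l, 1 ≤ v l)
    {M : ℕ} (hs : ∀ m ≤ M, ∑ l, attachProb w (v l) m < 1) (D : ι → ℕ) :
    degProb w v M D ≤ (∏ m ∈ Finset.Ico 1 (M + 1), (1 - ∑ l, attachProb w (v l) m)) *
      ∏ l, (∑ m ∈ Finset.Ico 1 (M + 1),
        attachProb w (v l) m / (1 - ∑ k, attachProb w (v k) m)) ^ D l / (D l).factorial := by
  -- The exact probability is the product of the probabilities of no tracked attachment, times a sum
  -- over disjoint sets of attachment times of products of `p / (1 - ∑ p)`. Dropping disjointness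
  -- yields the powers over factorials; the induction carries this out through the one-step
  -- recursion.
  induction M generalizing D with
  | zero =>
    rw [degProb_zero]
    split_ifs with h
    · subst h; simp
    · simp only [zero_add, Finset.Ico_self, Finset.prod_empty, Finset.sum_empty, one_mul]
      positivity
  | succ M ih =>
    replace ih := ih fun m hm => hs m (by omega)
    rw [degProb_succ hw hv hv1, Finset.prod_Ico_succ_top (by omega)]
    simp_rw [Finset.sum_Ico_succ_top (show 1 ≤ M + 1 by omega)]
    set q : ℝ := 1 - ∑ l, attachProb w (v l) (M + 1) with hq
    have hq0 : 0 < q := by have := hs (M + 1) le_rfl; linarith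
    set π : ℝ := ∏ m ∈ Finset.Ico 1 (M + 1), (1 - ∑ l, attachProb w (v l) m) with hπ
    have hπ0 : 0 ≤ π := Finset.prod_nonneg fun m hm => by
      have := hs m (by have := (Finset.mem_Ico.1 hm).2; omega)
      linarith
    set p : ι → ℝ := fun l => attachProb w (v l) (M + 1) with hp
    have hp0 : ∀ l, 0 ≤ p l := fun l => attachProb_nonneg hw (hv1 l) _
    set R : ι → ℝ := fun l => ∑ m ∈ Finset.Ico 1 (M + 1),
      attachProb w (v l) m / (1 - ∑ k, attachProb w (v k) m) with hR
    have hR0 : ∀ l, 0 ≤ R l := fun l => Finset.sum_nonneg fun m hm =>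
      div_nonneg (attachProb_nonneg hw (hv1 l) _) (by
        have := hs m (by have := (Finset.mem_Ico.1 hm).2; omega)
        linarith)
    set α : ι → ℝ := fun l => R l ^ D l / (D l).factorial with hα
    set β : ι → ℝ := fun l => p l / q *
      if D l = 0 then 0 else R l ^ (D l - 1) / (D l - 1).factorial with hβ
    have hα0 : ∀ l, 0 ≤ α l := fun l => by have := hR0 l; positivity
    have hβ0 : ∀ l, 0 ≤ β l := fun l => by
      have := hR0 l; have := hp0 l
      simp only [hβ]
      split_ifs <;> positivity
    have hαβ : ∀ l, α l + β l ≤ (R l + p l / q) ^ D l / (D l).factorial := by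
      intro l
      simp only [hα, hβ]
      rcases h : D l with _ | k
      · simp
      · rw [if_neg (by omega), Nat.add_sub_cancel, Nat.factorial_succ]
        push_cast
        have h1 := pow_add_mul_pow_le (hR0 l) (div_nonneg (hp0 l) hq0.le) k
        have hk : (0 : ℝ) < k.factorial := by positivity
        rw [div_add' _ _ _ (by positivity)]
        gcongr
        refine le_trans (le_of_eq ?_) h1
        field_simp
    have hterm : ∀ l, p l * (if D l = 0 then 0 else degProb w v M (Function.update D l (D l - 1))) ≤
        π * q * (β l * ∏ k ∈ Finset.univ.erase l, α k) := by
      intro l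
      simp only [hβ]
      split_ifs with h
      · simp
      · have h1 := ih (Function.update D l (D l - 1))
        rw [prod_update_pow_div] at h1
        calc _ ≤ p l * (π * (R l ^ (D l - 1) / (D l - 1).factorial *
              ∏ k ∈ Finset.univ.erase l, R k ^ D k / (D k).factorial)) :=
              mul_le_mul_of_nonneg_left h1 (hp0 l)
          _ = _ := by
              simp only [hα]
              field_simp
    calc _ ≤ q * (π * ∏ l, α l) + ∑ l, π * q * (β l * ∏ k ∈ Finset.univ.erase l, α k) :=
          add_le_add (mul_le_mul_of_nonneg_left (ih D) hq0.le) (Finset.sum_le_sum fun l _ => hterm l)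
      _ = π * q * (∏ l, α l + ∑ l, β l * ∏ k ∈ Finset.univ.erase l, α k) := by
          rw [← Finset.mul_sum]; ring
      _ ≤ π * q * ∏ l, (α l + β l) := by
          gcongr
          exact prod_add_sum_le hα0 hβ0
      _ ≤ π * q * ∏ l, (R l + p l / q) ^ D l / (D l).factorial := by
          gcongr with l
          · exact fun l _ => add_nonneg (hα0 l) (hβ0 l)
          · exact hαβ l

/-- Lower bound for the joint degree distribution. -/
lemma le_degProb {w : ℕ → ℝ} (hw : ∀ i, 1 ≤ i → 0 < w i) {v : ι → ℕ}
    (hv : Function.Injective v) (hv1 : ∀ l, 1 ≤ v l)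
    {M : ℕ} (hs : ∀ m ≤ M, ∑ l, attachProb w (v l) m < 1) {ρ : ℝ} (hρ0 : 0 ≤ ρ)
    (hρ : ∀ l, ∀ m ≤ M, attachProb w (v l) m ≤ ρ) (D : ι → ℕ) :
    (∏ m ∈ Finset.Ico 1 (M + 1), (1 - ∑ l, attachProb w (v l) m)) *
      ∏ l, (max (∑ m ∈ Finset.Ico 1 (M + 1), attachProb w (v l) m - (∑ k, D k : ℕ) * ρ) 0) ^ D l /
        (D l).factorial ≤ degProb w v M D := by
  -- When the attachment times are chosen one after another, each must avoid fewer than `∑ D` times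
  -- already used, each of weight at most `ρ`; hence the subtracted term. Truncation at zero keeps
  -- the powers monotone.
  induction M generalizing D with
  | zero =>
    rw [degProb_zero]
    split_ifs with h
    · subst h; simp
    · obtain ⟨l, hl⟩ : ∃ l, D l ≠ 0 := by
        by_contra! h2
        exact h (funext h2)
      refine le_of_eq ?_
      rw [Finset.prod_eq_zero (Finset.mem_univ l), mul_zero]
      have : (0 : ℝ) ≤ (∑ k, D k : ℕ) * ρ := by positivity
      simp only [zero_add, Finset.Ico_self, Finset.sum_empty, zero_sub]
      rw [max_eq_right (by linarith), zero_pow hl, zero_div]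
  | succ M ih =>
    replace ih := ih (fun m hm => hs m (by omega)) fun l m hm => hρ l m (by omega)
    rw [degProb_succ hw hv hv1, Finset.prod_Ico_succ_top (by omega)]
    simp_rw [Finset.sum_Ico_succ_top (show 1 ≤ M + 1 by omega)]
    set q : ℝ := 1 - ∑ l, attachProb w (v l) (M + 1) with hq
    have hq0 : 0 < q := by have := hs (M + 1) le_rfl; linarith
    have hq1 : q ≤ 1 := by
      have : 0 ≤ ∑ l, attachProb w (v l) (M + 1) :=
        Finset.sum_nonneg fun l _ => attachProb_nonneg hw (hv1 l) _
      linarith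
    set π : ℝ := ∏ m ∈ Finset.Ico 1 (M + 1), (1 - ∑ l, attachProb w (v l) m) with hπ
    have hπ0 : 0 ≤ π := Finset.prod_nonneg fun m hm => by
      have := hs m (by have := (Finset.mem_Ico.1 hm).2; omega)
      linarith
    set p : ι → ℝ := fun l => attachProb w (v l) (M + 1) with hp
    have hp0 : ∀ l, 0 ≤ p l := fun l => attachProb_nonneg hw (hv1 l) _
    set X : ι → ℝ := fun l => ∑ m ∈ Finset.Ico 1 (M + 1), attachProb w (v l) m -
      (∑ k, D k : ℕ) * ρ with hX
    set α : ι → ℝ := fun l => (max (X l + p l) 0) ^ D l / (D l).factorial with hα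
    set β : ι → ℝ := fun l => (max (X l) 0) ^ D l / (D l).factorial with hβ
    set γ : ι → ℝ := fun l => p l *
      if D l = 0 then 0 else (max (X l + p l) 0) ^ (D l - 1) / (D l - 1).factorial with hγ
    have hβ0 : ∀ l, 0 ≤ β l := fun l => by positivity
    have hβα : ∀ l, β l ≤ α l := fun l => by
      simp only [hα, hβ]
      have := hp0 l
      gcongr
      linarith
    have hγ0 : ∀ l, 0 ≤ γ l := fun l => by
      have := hp0 l
      simp only [hγ]
      split_ifs <;> positivity
    have hαβγ : ∀ l, α l ≤ β l + γ l := by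
      intro l
      simp only [hα, hβ, hγ]
      rcases h : D l with _ | k
      · simp
      · rw [if_neg (by omega), Nat.add_sub_cancel, Nat.factorial_succ]
        push_cast
        have hk : (0 : ℝ) < k.factorial := by positivity
        have hBA : max (X l) 0 ≤ max (X l + p l) 0 := max_le_max_right _ (by linarith [hp0 l])
        have h1 := pow_sub_pow_le (le_max_right (X l) 0) hBA k
        have h2 : max (X l + p l) 0 - max (X l) 0 ≤ p l := by
          have := hp0 l
          rcases le_total (X l) 0 with h3 | h3 <;> rcases le_total (X l + p l) 0 with h4 | h4 <;>
            simp only [max_eq_left, max_eq_right, h3, h4] <;> linarith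
        rw [div_add' _ _ _ (by positivity)]
        gcongr
        refine h1.trans ?_
        have h5 : 0 ≤ max (X l + p l) 0 := le_max_right _ _
        calc _ ≤ max (X l) 0 ^ (k + 1) + (k + 1) * p l * max (X l + p l) 0 ^ k := by gcongr
          _ = _ := by field_simp
    have hterm : ∀ l, π * q * (γ l * ∏ k ∈ Finset.univ.erase l, α k) ≤
        p l * (if D l = 0 then 0 else degProb w v M (Function.update D l (D l - 1))) := by
      intro l
      simp only [hγ]
      split_ifs with h
      · simp
      · have h1 := ih (Function.update D l (D l - 1))
        rw [prod_update_pow_div] at h1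
        have hD : ((∑ k, Function.update D l (D l - 1) k : ℕ) : ℝ) = (∑ k, D k : ℕ) - 1 := by
          rw [← Finset.add_sum_erase _ _ (Finset.mem_univ l),
            ← Finset.add_sum_erase Finset.univ D (Finset.mem_univ l), Function.update_self]
          have : ∑ k ∈ Finset.univ.erase l, Function.update D l (D l - 1) k =
              ∑ k ∈ Finset.univ.erase l, D k :=
            Finset.sum_congr rfl fun k hk => by
              rw [Function.update_of_ne (Finset.ne_of_mem_erase hk)]
          rw [this]
          push_cast [Nat.one_le_iff_ne_zero.2 h]
          ring
        -- Lowering the total degree by one raises the bracket by `ρ`, which pays for the summand `p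
        -- k ≤ ρ` of the new step.
        have hmono : ∀ k, max (X k + p k) 0 ≤ max (∑ m ∈ Finset.Ico 1 (M + 1),
            attachProb w (v k) m - (∑ k, Function.update D l (D l - 1) k : ℕ) * ρ) 0 := by
          intro k
          refine max_le_max_right _ ?_
          rw [hD]
          have := hρ k (M + 1) le_rfl
          simp only [hX, hp]
          linarith
        have hnn : ∀ k, 0 ≤ max (X k + p k) 0 := fun k => le_max_right _ _
        have hα0 : ∀ k, 0 ≤ α k := fun k => (hβ0 k).trans (hβα k)
        have hpr : 0 ≤ ∏ k ∈ Finset.univ.erase l, α k := Finset.prod_nonneg fun k _ => hα0 k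
        calc π * q * (p l * (max (X l + p l) 0 ^ (D l - 1) / (D l - 1).factorial) *
              ∏ k ∈ Finset.univ.erase l, α k)
            ≤ π * 1 * (p l * (max (X l + p l) 0 ^ (D l - 1) / (D l - 1).factorial) *
              ∏ k ∈ Finset.univ.erase l, α k) := by
              have := hp0 l
              have := hnn l
              gcongr
          _ = p l * (π * (max (X l + p l) 0 ^ (D l - 1) / (D l - 1).factorial *
              ∏ k ∈ Finset.univ.erase l, α k)) := by ring
          _ ≤ _ := by
              refine mul_le_mul_of_nonneg_left (le_trans ?_ h1) (hp0 l)
              refine mul_le_mul_of_nonneg_left ?_ hπ0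
              refine mul_le_mul ?_ ?_ hpr (by positivity)
              · have := hnn l
                have := hmono l
                gcongr
              · refine Finset.prod_le_prod (fun k _ => hα0 k) fun k _ => ?_
                have := hnn k
                have := hmono k
                simp only [hα]
                gcongr
    have hXp : ∀ l, ∑ m ∈ Finset.Ico 1 (M + 1), attachProb w (v l) m + attachProb w (v l) (M + 1) -
        (∑ k, D k : ℕ) * ρ = X l + p l := fun l => by simp only [hX, hp]; ring
    simp_rw [hXp]
    calc π * q * ∏ l, α l
        ≤ π * q * (∏ l, β l + ∑ l, γ l * ∏ k ∈ Finset.univ.erase l, α k) := by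
          gcongr
          exact prod_le_prod_add_sum hβ0 hβα hγ0 hαβγ
      _ = q * (π * ∏ l, β l) + ∑ l, π * q * (γ l * ∏ k ∈ Finset.univ.erase l, α k) := by
          rw [← Finset.mul_sum]; ring
      _ ≤ _ := add_le_add (mul_le_mul_of_nonneg_left (ih D) hq0.le)
          (Finset.sum_le_sum fun l _ => hterm l)

/-- Bound for the joint generating function of the degrees. -/
lemma pathSum_prod_pow_le {w : ℕ → ℝ} (hw : ∀ i, 1 ≤ i → 0 < w i) {v : ι → ℕ}
    (hv : Function.Injective v) (hv1 : ∀ l, 1 ≤ v l) {x : ι → ℝ} (hx : ∀ l, 1 ≤ x l) (M : ℕ) :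
    pathSum w M (fun a => ∏ l, x l ^ deg a (M + 1) (v l)) ≤
      ∏ l, ∏ m ∈ Finset.Ico 1 (M + 1), (1 + (x l - 1) * attachProb w (v l) m) := by
  have hx0 : ∀ l, 0 ≤ x l := fun l => zero_le_one.trans (hx l)
  have hb : ∀ l m, 0 ≤ (x l - 1) * attachProb w (v l) m := fun l m =>
    mul_nonneg (by linarith [hx l]) (attachProb_nonneg hw (hv1 l) m)
  induction M with
  | zero => simp [pathSum_zero, deg]
  | succ M ih =>
    rw [pathSum_degrees_succ hw hv hv1 M (fun c => ∏ l, x l ^ c l)]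
    have e : ∀ l, pathSum w M (fun a => ∏ k, x k ^ (((fun l => deg a (M + 1) (v l)) +
        Pi.single l 1 : ι → ℕ) k)) = x l * pathSum w M (fun a => ∏ k, x k ^ deg a (M + 1) (v k)) := by
      intro l
      rw [← pathSum_const_mul]
      congr 1
      ext a
      simp only [Pi.add_apply, pow_add, Finset.prod_mul_distrib]
      rw [mul_comm]
      congr 1
      rw [Finset.prod_eq_single l]
      · simp
      · intro k _ hk; simp [hk]
      · simp
    simp_rw [e, Finset.prod_Ico_succ_top (show 1 ≤ M + 1 by omega)]
    rw [Finset.prod_mul_distrib]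
    set G := pathSum w M (fun a => ∏ k, x k ^ deg a (M + 1) (v k)) with hG
    have hG0 : 0 ≤ G := pathSum_nonneg hw fun a => Finset.prod_nonneg fun k _ => pow_nonneg (hx0 k) _
    -- Negative dependence: the exact joint factor of one step is `1 + ∑ (x - 1) p`, which is at
    -- most the product `∏ (1 + (x - 1) p)` of the individual factors.
    have h1 := prod_add_sum_le (s := Finset.univ) (α := fun _ : ι => (1 : ℝ))
      (β := fun l => (x l - 1) * attachProb w (v l) (M + 1)) (fun _ => zero_le_one)
      (fun l => hb l (M + 1))
    simp only [Finset.prod_const_one, mul_one] at h1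
    calc _ = G * (1 + ∑ l, (x l - 1) * attachProb w (v l) (M + 1)) := by
          rw [sub_mul, Finset.sum_mul, mul_add, Finset.mul_sum, one_mul, mul_one, sub_add,
            ← Finset.sum_sub_distrib, sub_eq_add_neg, ← Finset.sum_neg_distrib]
          congr 1
          exact Finset.sum_congr rfl fun l _ => by ring
      _ ≤ _ := by
          refine mul_le_mul ih h1 ?_ ?_
          · exact add_nonneg zero_le_one (Finset.sum_nonneg fun l _ => hb l _)
          · exact Finset.prod_nonneg fun l _ => Finset.prod_nonneg fun m _ => by
              linarith [hb l m]

end Degrees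

/-! ### Integrating out the attachments -/

namespace IsWRT

variable {Ω : Type*} [mΩ : MeasurableSpace Ω] {P : Measure Ω} [IsProbabilityMeasure P]
  {W : ℕ → Ω → ℝ} {A : ℕ → Ω → ℕ}

lemma weightSigma_le (hT : IsWRT P W A) : weightSigma W ≤ mΩ :=
  iSup_le fun k => (hT.measurable_weight (k + 1) (by omega)).comap_le

lemma ae_pos (hT : IsWRT P W A) : ∀ᵐ ω ∂P, ∀ i, 1 ≤ i → 0 < W i ω :=
  ae_all_iff.2 fun i => by
    by_cases hi : 1 ≤ i
    · filter_upwards [hT.pos_weight i hi] with ω h _ using h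
    · exact ae_of_all _ fun ω h => absurd h hi

/-- The event that the first attachments are given by the path `a`. -/
def cyl (A : ℕ → Ω → ℕ) (M : ℕ) (a : ℕ → ℕ) : Set Ω :=
  {ω | ∀ m ∈ Finset.Ico 1 (M + 1), A m ω = a m}

lemma measurableSet_cyl (hT : IsWRT P W A) (M : ℕ) (a : ℕ → ℕ) : MeasurableSet (cyl A M a) := by
  have : cyl A M a = ⋂ m ∈ Finset.Ico 1 (M + 1), A m ⁻¹' {a m} := by
    ext ω; simp [cyl]
  rw [this]
  exact Finset.measurableSet_biInter _ fun m hm =>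
    hT.measurable_attach m (Finset.mem_Ico.1 hm).1 (measurableSet_singleton _)

lemma condExp_cyl (hT : IsWRT P W A) {M : ℕ} {a : ℕ → ℕ} (ha : a ∈ paths M) :
    P⟦cyl A M a | weightSigma W⟧ =ᵐ[P] fun ω =>
      ∏ m ∈ Finset.Ico 1 (M + 1), W (a m) ω / wsum (fun i => W i ω) m :=
  hT.attach_law (M + 1) a fun m hm => (paths_spec ha).1 m (by
    simp only [Finset.mem_Ico, Finset.mem_Icc] at hm ⊢; omega)

lemma integrable_pathWeight (hT : IsWRT P W A) {M : ℕ} {a : ℕ → ℕ} (ha : a ∈ paths M) :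
    Integrable (fun ω => ∏ m ∈ Finset.Ico 1 (M + 1), W (a m) ω / wsum (fun i => W i ω) m) P :=
  integrable_condExp.congr (hT.condExp_cyl ha)

lemma setIntegral_pathWeight (hT : IsWRT P W A) {M : ℕ} {a : ℕ → ℕ} (ha : a ∈ paths M)
    {E : Set Ω} (hE : MeasurableSet[weightSigma W] E) :
    ∫ ω in E, ∏ m ∈ Finset.Ico 1 (M + 1), W (a m) ω / wsum (fun i => W i ω) m ∂P =
      ∫ ω in E, (cyl A M a).indicator (fun _ => (1 : ℝ)) ω ∂P := by
  rw [← setIntegral_condExp hT.weightSigma_le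
    ((integrable_const (1 : ℝ)).indicator (hT.measurableSet_cyl M a)) hE]
  exact setIntegral_congr_ae (hT.weightSigma_le _ hE)
    ((hT.condExp_cyl ha).mono fun ω h _ => h.symm)

lemma sum_indicator_cyl {M : ℕ} (f : (ℕ → ℕ) → ℝ) {a : ℕ → ℕ} (ha : a ∈ paths M) {ω : Ω}
    (hω : ω ∈ cyl A M a) :
    ∑ b ∈ paths M, f b * (cyl A M b).indicator (fun _ => (1 : ℝ)) ω = f a := by
  rw [Finset.sum_eq_single a]
  · rw [Set.indicator_of_mem hω, mul_one]
  · intro b hb hba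
    rw [Set.indicator_of_notMem, mul_zero]
    intro hωb
    refine hba (funext fun m => ?_)
    by_cases hm : m ∈ Finset.Icc 1 M
    · have hm' : m ∈ Finset.Ico 1 (M + 1) := by
        simp only [Finset.mem_Ico, Finset.mem_Icc] at hm ⊢; omega
      rw [← hωb m hm', hω m hm']
    · rw [(paths_spec ha).2 m hm, (paths_spec hb).2 m hm]
  · exact fun h => absurd ha h

/-- The attachment law is prescribed only for sequences with `a m ∈ Icc 1 m`. Their conditional
probabilities sum to one, and the cylinders are disjoint, so the sum of their indicators is at most
one with integral one, hence almost surely one. -/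
lemma ae_exists_path (hT : IsWRT P W A) (M : ℕ) :
    ∀ᵐ ω ∂P, ∃ a ∈ paths M, ω ∈ cyl A M a := by
  set g : Ω → ℝ := fun ω => ∑ a ∈ paths M, (cyl A M a).indicator (fun _ => (1 : ℝ)) ω with hg
  have hgi : Integrable g P := integrable_finsetSum _ fun a _ =>
    (integrable_const (1 : ℝ)).indicator (hT.measurableSet_cyl M a)
  have hg1 : ∀ ω, g ω ≤ 1 := by
    intro ω
    by_cases h : ∃ a ∈ paths M, ω ∈ cyl A M a
    · obtain ⟨a, ha, hω⟩ := h
      have := sum_indicator_cyl (A := A) (fun _ => 1) ha hω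
      simp only [one_mul] at this
      exact this.le
    · push Not at h
      refine le_trans (le_of_eq (Finset.sum_eq_zero fun a ha => ?_)) zero_le_one
      rw [Set.indicator_of_notMem (h a ha)]
  have hint : ∫ ω, g ω ∂P = 1 := by
    rw [hg, integral_finsetSum _ fun a _ =>
      (integrable_const (1 : ℝ)).indicator (hT.measurableSet_cyl M a)]
    have h1 : ∀ a ∈ paths M, ∫ ω, (cyl A M a).indicator (fun _ => (1 : ℝ)) ω ∂P =
        ∫ ω, ∏ m ∈ Finset.Ico 1 (M + 1), W (a m) ω / wsum (fun i => W i ω) m ∂P := by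
      intro a ha
      have := hT.setIntegral_pathWeight ha (@MeasurableSet.univ _ (weightSigma W))
      simpa using this.symm
    rw [Finset.sum_congr rfl h1, ← integral_finsetSum _ fun a ha => hT.integrable_pathWeight ha]
    have h2 : (fun ω => ∑ a ∈ paths M, ∏ m ∈ Finset.Ico 1 (M + 1),
        W (a m) ω / wsum (fun i => W i ω) m) =ᵐ[P] fun _ => 1 := by
      filter_upwards [hT.ae_pos] with ω hω
      have := pathSum_one hω M
      simpa [pathSum] using this
    rw [integral_congr_ae h2]
    simp
  have h0 : (fun ω => 1 - g ω) =ᵐ[P] 0 := by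
    rw [← integral_eq_zero_iff_of_nonneg (fun ω => sub_nonneg.2 (hg1 ω))
      ((integrable_const _).sub hgi), integral_sub (integrable_const _) hgi, hint]
    simp
  filter_upwards [h0] with ω hω
  by_contra h
  push Not at h
  have : g ω = 0 := Finset.sum_eq_zero fun a ha => by rw [Set.indicator_of_notMem (h a ha)]
  simp [this] at hω

lemma integrable_pathSum (hT : IsWRT P W A) (M : ℕ) (f : (ℕ → ℕ) → ℝ) :
    Integrable (fun ω => pathSum (fun i => W i ω) M f) P :=
  integrable_finsetSum _ fun _ ha => (hT.integrable_pathWeight ha).mul_const _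

lemma ae_eq_sum_indicator (hT : IsWRT P W A) (M : ℕ) {f : (ℕ → ℕ) → ℝ}
    (hf : ∀ a b : ℕ → ℕ, (∀ m ∈ Finset.Ico 1 (M + 1), a m = b m) → f a = f b) :
    (fun ω => f fun m => A m ω) =ᵐ[P]
      fun ω => ∑ a ∈ paths M, f a * (cyl A M a).indicator (fun _ => (1 : ℝ)) ω := by
  filter_upwards [hT.ae_exists_path M] with ω ⟨a, ha, hω⟩
  rw [sum_indicator_cyl f ha hω]
  exact hf _ _ hω

lemma integrable_comp_attach (hT : IsWRT P W A) (M : ℕ) {f : (ℕ → ℕ) → ℝ}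
    (hf : ∀ a b : ℕ → ℕ, (∀ m ∈ Finset.Ico 1 (M + 1), a m = b m) → f a = f b) :
    Integrable (fun ω => f fun m => A m ω) P :=
  (integrable_finsetSum _ fun a _ => ((integrable_const (1 : ℝ)).indicator
    (hT.measurableSet_cyl M a)).const_mul _).congr (hT.ae_eq_sum_indicator M hf).symm

/-- Integration over the attachments, given the weights. -/
lemma setIntegral_comp_attach (hT : IsWRT P W A) (M : ℕ) {f : (ℕ → ℕ) → ℝ}
    (hf : ∀ a b : ℕ → ℕ, (∀ m ∈ Finset.Ico 1 (M + 1), a m = b m) → f a = f b)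
    {E : Set Ω} (hE : MeasurableSet[weightSigma W] E) :
    ∫ ω in E, f (fun m => A m ω) ∂P = ∫ ω in E, pathSum (fun i => W i ω) M f ∂P := by
  rw [setIntegral_congr_ae (hT.weightSigma_le _ hE)
    ((hT.ae_eq_sum_indicator M hf).mono fun ω h _ => h)]
  unfold pathSum
  rw [integral_finsetSum, integral_finsetSum]
  · refine Finset.sum_congr rfl fun a ha => ?_
    rw [integral_const_mul, integral_mul_const, hT.setIntegral_pathWeight ha hE, mul_comm]
  · exact fun a ha => ((hT.integrable_pathWeight ha).mul_const _).integrableOn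
  · exact fun a ha => (((integrable_const (1 : ℝ)).indicator
      (hT.measurableSet_cyl M a)).const_mul _).integrableOn

end IsWRT

/-! ### Concentration of the partial sums of the weights -/

/-- Weight sequences with good control of the partial sums. -/
structure Good (θ η ε ε' : ℝ) (n : ℕ) (w : ℕ → ℝ) : Prop where
  pos : ∀ i, 1 ≤ i → 0 < w i
  le_one : ∀ i, 1 ≤ i → w i ≤ 1
  lower : ∀ m : ℕ, m ≤ n → (n : ℝ) ^ η ≤ m →
    (θ - 1) * m * (1 - (n : ℝ) ^ (-(η / 4))) ≤ wsum w m
  upper : ∀ m : ℕ, m ≤ n → (n : ℝ) ^ η ≤ m →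
    wsum w m ≤ (θ - 1) * m * (1 + (n : ℝ) ^ (-(η / 4)))
  crude : ∀ m : ℕ, m ≤ n → ε' * Real.log n ≤ m → ε * m ≤ wsum w m

lemma wsum_eq_sum_range (w : ℕ → ℝ) (m : ℕ) : wsum w m = ∑ k ∈ Finset.range m, w (k + 1) := by
  rw [wsum, Finset.range_eq_Ico, Finset.sum_Ico_add' w 0 m 1, zero_add]
  rfl

namespace IsWRT

variable {Ω : Type*} [mΩ : MeasurableSpace Ω] {P : Measure Ω} [IsProbabilityMeasure P]
  {W : ℕ → Ω → ℝ} {A : ℕ → Ω → ℕ} {q₀ θ : ℝ}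

/-- The supremum condition gives `P (W ≤ x) = 1` only for `x > 1`; the bound follows along `x = 1 +
1 / (k + 1)`. -/
lemma ae_le_one (hT : IsWRT P W A) (hatom : AtomCase P W q₀) :
    ∀ᵐ ω ∂P, ∀ i, 1 ≤ i → W i ω ≤ 1 := by
  have h1 : ∀ k : ℕ, ∀ᵐ ω ∂P, W 1 ω ≤ 1 + 1 / ((k : ℝ) + 1) := by
    intro k
    have hm : MeasurableSet {ω | W 1 ω ≤ 1 + 1 / ((k : ℝ) + 1)} :=
      hT.measurable_weight 1 le_rfl measurableSet_Iic
    have h2 : ¬ P {ω | W 1 ω ≤ 1 + 1 / ((k : ℝ) + 1)} < 1 := fun h => by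
      have := hatom.essSup_eq_one.1 h
      have : (0 : ℝ) < 1 / ((k : ℝ) + 1) := by positivity
      linarith
    have h3 : P {ω | W 1 ω ≤ 1 + 1 / ((k : ℝ) + 1)} = 1 := le_antisymm prob_le_one (not_lt.1 h2)
    exact (prob_compl_eq_zero_iff hm).2 h3
  have h2 : ∀ᵐ ω ∂P, W 1 ω ≤ 1 := by
    filter_upwards [ae_all_iff.2 h1] with ω hω
    have hlim : Tendsto (fun k : ℕ => 1 + 1 / ((k : ℝ) + 1)) atTop (𝓝 (1 + 0)) :=
      tendsto_one_div_add_atTop_nhds_zero_nat.const_add 1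
    rw [add_zero] at hlim
    exact ge_of_tendsto' hlim hω
  refine ae_all_iff.2 fun i => ?_
  by_cases hi : 1 ≤ i
  · have := (hT.identDistrib_weight i hi).symm.ae_snd (p := fun x => x ≤ 1) measurableSet_Iic h2
    filter_upwards [this] with ω h _ using h
  · exact ae_of_all _ fun ω h => absurd h hi

lemma theta_gt_one (hT : IsWRT P W A) (hatom : AtomCase P W q₀) (hθ : θ = theta P W) : 1 < θ := by
  have hi : Integrable (W 1) P :=
    Integrable.of_mem_Icc 0 1 (hT.measurable_weight 1 le_rfl).aemeasurable (by
      filter_upwards [hT.ae_pos, hT.ae_le_one hatom] with ω h1 h2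
      exact ⟨(h1 1 le_rfl).le, h2 1 le_rfl⟩)
  have : 0 < ∫ ω, W 1 ω ∂P := by
    rw [integral_pos_iff_support_of_nonneg_ae]
    · have : ∀ᵐ ω ∂P, ω ∈ Function.support (W 1) := by
        filter_upwards [hT.ae_pos] with ω h1 using (h1 1 le_rfl).ne'
      refine pos_iff_ne_zero.2 fun h0 => ?_
      obtain ⟨ω, h1, h2⟩ := (this.and (measure_eq_zero_iff_ae_notMem.1 h0)).exists
      exact h2 h1
    · filter_upwards [hT.ae_pos] with ω h1 using (h1 1 le_rfl).le
    · exact hi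
  rw [hθ, theta]; linarith

/-- Every tilt `x ≤ θ` then satisfies `x ≤ 2`, as the estimate for the earliest attachment steps
requires. -/
lemma theta_le_two (hT : IsWRT P W A) (hatom : AtomCase P W q₀) (hθ : θ = theta P W) : θ ≤ 2 := by
  have : ∫ ω, W 1 ω ∂P ≤ ∫ _, (1 : ℝ) ∂P := by
    refine integral_mono_of_nonneg ?_ (integrable_const _) ?_
    · filter_upwards [hT.ae_pos] with ω h1 using (h1 1 le_rfl).le
    · filter_upwards [hT.ae_le_one hatom] with ω h1 using h1 1 le_rfl
  simp at this
  rw [hθ, theta]; linarith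

lemma integral_weight (hT : IsWRT P W A) (hθ : θ = theta P W) {i : ℕ} (hi : 1 ≤ i) :
    ∫ ω, W i ω ∂P = θ - 1 := by
  rw [(hT.identDistrib_weight i hi).integral_eq, hθ, theta]; ring

lemma measurable_weightSigma {i : ℕ} (hi : 1 ≤ i) : Measurable[weightSigma W] (W i) := by
  obtain ⟨k, rfl⟩ := Nat.exists_eq_add_of_le' hi
  exact (comap_measurable (W (k + 1))).mono
    (le_iSup (fun k : ℕ => MeasurableSpace.comap (W (k + 1)) inferInstance) k) le_rfl

lemma measurable_wsum (m : ℕ) :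
    Measurable[weightSigma W] (fun ω => wsum (fun i => W i ω) m) :=
  @Finset.measurable_sum _ _ _ _ _ _ (weightSigma W) _ _ fun _ hi =>
    measurable_weightSigma (Finset.mem_Icc.1 hi).1

lemma measurableSet_good (θ η ε ε' : ℝ) (n : ℕ) :
    MeasurableSet[weightSigma W] {ω | Good θ η ε ε' n fun i => W i ω} := by
  have e : {ω | Good θ η ε ε' n fun i => W i ω} =
      (⋂ (i : ℕ) (_ : 1 ≤ i), W i ⁻¹' Set.Ioi 0) ∩ (⋂ (i : ℕ) (_ : 1 ≤ i), W i ⁻¹' Set.Iic 1) ∩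
      (⋂ (m : ℕ) (_ : m ≤ n) (_ : (n : ℝ) ^ η ≤ m), (fun ω => wsum (fun i => W i ω) m) ⁻¹'
        Set.Ici ((θ - 1) * m * (1 - (n : ℝ) ^ (-(η / 4))))) ∩
      (⋂ (m : ℕ) (_ : m ≤ n) (_ : (n : ℝ) ^ η ≤ m), (fun ω => wsum (fun i => W i ω) m) ⁻¹'
        Set.Iic ((θ - 1) * m * (1 + (n : ℝ) ^ (-(η / 4))))) ∩
      (⋂ (m : ℕ) (_ : m ≤ n) (_ : ε' * Real.log n ≤ m), (fun ω => wsum (fun i => W i ω) m) ⁻¹'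
        Set.Ici (ε * m)) := by
    ext ω
    simp only [Set.mem_inter_iff, Set.mem_iInter, Set.mem_preimage, Set.mem_Ioi, Set.mem_Iic,
      Set.mem_Ici, Set.mem_ofPred_eq]
    constructor
    · rintro ⟨h1, h2, h3, h4, h5⟩; exact ⟨⟨⟨⟨h1, h2⟩, h3⟩, h4⟩, h5⟩
    · rintro ⟨⟨⟨⟨h1, h2⟩, h3⟩, h4⟩, h5⟩; exact ⟨h1, h2, h3, h4, h5⟩
  rw [e]
  refine MeasurableSet.inter (MeasurableSet.inter (MeasurableSet.inter (MeasurableSet.inter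
    ?_ ?_) ?_) ?_) ?_
  · exact .iInter fun i => .iInter fun hi => measurable_weightSigma hi measurableSet_Ioi
  · exact .iInter fun i => .iInter fun hi => measurable_weightSigma hi measurableSet_Iic
  · exact .iInter fun m => .iInter fun _ => .iInter fun _ => measurable_wsum m measurableSet_Ici
  · exact .iInter fun m => .iInter fun _ => .iInter fun _ => measurable_wsum m measurableSet_Iic
  · exact .iInter fun m => .iInter fun _ => .iInter fun _ => measurable_wsum m measurableSet_Ici

/-- Hoeffding's lemma on `[0, 1]`: the variance proxy is the squared half-length, whence the
exponents `2 r² / m` below. -/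
lemma hasSubgaussianMGF_weight (hT : IsWRT P W A) (hatom : AtomCase P W q₀) (hθ : θ = theta P W)
    (k : ℕ) : HasSubgaussianMGF (fun ω => W (k + 1) ω - (θ - 1)) (1 / 4) P := by
  have h := hasSubgaussianMGF_of_mem_Icc (μ := P) (X := W (k + 1)) (a := 0) (b := 1)
    (hT.measurable_weight (k + 1) (by omega)).aemeasurable (by
      filter_upwards [hT.ae_pos, hT.ae_le_one hatom] with ω h1 h2
      exact ⟨(h1 _ (by omega)).le, h2 _ (by omega)⟩)
  rw [hT.integral_weight hθ (by omega)] at h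
  convert h using 1
  norm_num

lemma prob_upper (hT : IsWRT P W A) (hatom : AtomCase P W q₀) (hθ : θ = theta P W) (m : ℕ) {r : ℝ}
    (hr : 0 ≤ r) :
    P.real {ω | (θ - 1) * m + r ≤ wsum (fun i => W i ω) m} ≤ Real.exp (-(2 * r ^ 2 / m)) := by
  have hind : iIndepFun (fun (k : ℕ) ω => W (k + 1) ω - (θ - 1)) P :=
    hT.indep_weight.comp (fun _ x => x - (θ - 1)) fun _ => measurable_id.sub_const _
  have h := HasSubgaussianMGF.measure_sum_range_ge_le_of_iIndepFun hind (n := m) (c := 1 / 4)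
    (fun i _ => hT.hasSubgaussianMGF_weight hatom hθ i) hr
  convert h using 2
  · ext ω
    simp only [Set.mem_ofPred_eq, Finset.sum_sub_distrib, Finset.sum_const, Finset.card_range,
      nsmul_eq_mul, wsum_eq_sum_range]
    constructor <;> intro h <;> linarith
  · rcases Nat.eq_zero_or_pos m with rfl | hm
    · simp
    · push_cast
      field_simp
      norm_num
      ring

lemma prob_lower (hT : IsWRT P W A) (hatom : AtomCase P W q₀) (hθ : θ = theta P W) (m : ℕ) {r : ℝ}
    (hr : 0 ≤ r) :
    P.real {ω | wsum (fun i => W i ω) m ≤ (θ - 1) * m - r} ≤ Real.exp (-(2 * r ^ 2 / m)) := by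
  have hind : iIndepFun (fun (k : ℕ) ω => -(W (k + 1) ω - (θ - 1))) P :=
    hT.indep_weight.comp (fun _ x => -(x - (θ - 1))) fun _ => (measurable_id.sub_const _).neg
  have h := HasSubgaussianMGF.measure_sum_range_ge_le_of_iIndepFun hind (n := m) (c := 1 / 4)
    (fun i _ => (hT.hasSubgaussianMGF_weight hatom hθ i).neg) hr
  convert h using 2
  · ext ω
    simp only [Set.mem_ofPred_eq, Finset.sum_sub_distrib, Finset.sum_const, Finset.card_range,
      nsmul_eq_mul, wsum_eq_sum_range, Finset.sum_neg_distrib]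
    constructor <;> intro h <;> linarith
  · rcases Nat.eq_zero_or_pos m with rfl | hm
    · simp
    · push_cast
      field_simp
      norm_num
      ring

/-- The partial sums of the weights are very unlikely to be smaller than a small multiple of the
number of summands. -/
lemma exists_crude (hT : IsWRT P W A) (Γ : ℝ) :
    ∃ ε > 0, ∀ m : ℕ, P.real {ω | wsum (fun i => W i ω) m ≤ ε * m} ≤ Real.exp (-(Γ * m)) := by
  have hlim : Tendsto (fun k : ℕ => mgf (W 1) P (-(k : ℝ))) atTop (𝓝 0) := by
    have : Tendsto (fun k : ℕ => ∫ ω, Real.exp (-(k : ℝ) * W 1 ω) ∂P) atTop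
        (𝓝 (∫ _, (0 : ℝ) ∂P)) := by
      refine tendsto_integral_of_dominated_convergence (fun _ => 1) ?_ (integrable_const _) ?_ ?_
      · intro k
        have := hT.measurable_weight 1 le_rfl
        exact (Real.measurable_exp.comp (this.const_mul _)).aestronglyMeasurable
      · intro k
        filter_upwards [hT.ae_pos] with ω h1
        rw [Real.norm_eq_abs, abs_of_pos (Real.exp_pos _), Real.exp_le_one_iff]
        have := (h1 1 le_rfl).le
        have : (0 : ℝ) ≤ k * W 1 ω := by positivity
        linarith
      · filter_upwards [hT.ae_pos] with ω h1
        have h2 : Tendsto (fun k : ℕ => (k : ℝ) * W 1 ω) atTop atTop :=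
          tendsto_natCast_atTop_atTop.atTop_mul_const (h1 1 le_rfl)
        refine (Real.tendsto_exp_neg_atTop_nhds_zero.comp h2).congr fun k => ?_
        simp
    simpa [mgf] using this
  -- Positivity of `W` makes the Laplace transform at `k` arbitrarily small. In the exponential
  -- Markov inequality with `ε = 1 / k` the prefactor is `e^m`, which the extra `1` in `Γ + 1`
  -- absorbs.
  obtain ⟨k, hk, hk0⟩ := ((hlim.eventually_lt_const (Real.exp_pos (-(Γ + 1)))).and
    (eventually_gt_atTop 0)).exists
  have hk' : (0 : ℝ) < k := by exact_mod_cast hk0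
  refine ⟨(k : ℝ)⁻¹, by positivity, fun m => ?_⟩
  have hmeas : ∀ i, Measurable fun ω => W (i + 1) ω := fun i => hT.measurable_weight _ (by omega)
  have hint : Integrable (fun ω => Real.exp (-(k : ℝ) *
      (∑ i ∈ Finset.range m, fun ω => W (i + 1) ω) ω)) P := by
    refine Integrable.of_mem_Icc 0 1 ?_ ?_
    · simp only [Finset.sum_apply]
      exact (Real.measurable_exp.comp
        ((Finset.measurable_sum _ fun i _ => hmeas i).const_mul _)).aemeasurable
    · filter_upwards [hT.ae_pos] with ω h1
      refine ⟨(Real.exp_pos _).le, Real.exp_le_one_iff.2 ?_⟩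
      rw [Finset.sum_apply]
      have : 0 ≤ ∑ i ∈ Finset.range m, W (i + 1) ω :=
        Finset.sum_nonneg fun i _ => (h1 _ (by omega)).le
      have : 0 ≤ (k : ℝ) * ∑ i ∈ Finset.range m, W (i + 1) ω := by positivity
      linarith
  have h := measure_le_le_exp_mul_mgf (μ := P) (t := -(k : ℝ)) ((k : ℝ)⁻¹ * m) (by linarith) hint
  rw [hT.indep_weight.mgf_sum hmeas] at h
  have hid : ∀ i ∈ Finset.range m, mgf (fun ω => W (i + 1) ω) P (-(k : ℝ)) =
      mgf (W 1) P (-(k : ℝ)) := fun i _ =>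
    congrFun (mgf_congr_identDistrib (hT.identDistrib_weight (i + 1) (by omega))) _
  rw [Finset.prod_congr rfl hid, Finset.prod_const, Finset.card_range] at h
  have e : {ω | wsum (fun i => W i ω) m ≤ (k : ℝ)⁻¹ * m} =
      {ω | (∑ i ∈ Finset.range m, fun ω => W (i + 1) ω) ω ≤ (k : ℝ)⁻¹ * m} := by
    ext ω
    simp [wsum_eq_sum_range]
  rw [e]
  refine h.trans ?_
  calc Real.exp (-(-(k : ℝ)) * ((k : ℝ)⁻¹ * m)) * mgf (W 1) P (-(k : ℝ)) ^ m
      ≤ Real.exp (-(-(k : ℝ)) * ((k : ℝ)⁻¹ * m)) * Real.exp (-(Γ + 1)) ^ m := by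
        have := mgf_nonneg (X := W 1) (μ := P) (t := -(k : ℝ))
        gcongr
    _ = Real.exp (-(Γ * m)) := by
        rw [← Real.exp_nat_mul, ← Real.exp_add]
        congr 1
        field_simp
        ring

/-- The weights are good with overwhelming probability. -/
lemma exists_prob_not_good_le (hT : IsWRT P W A) (hatom : AtomCase P W q₀) (hθ : θ = theta P W)
    {ε' : ℝ} (hε' : 0 < ε') (γ : ℝ) :
    ∃ ε > 0, ∀ η : ℝ, 0 < η → ∀ᶠ n : ℕ in atTop,
      P.real {ω | ¬ Good θ η ε ε' n fun i => W i ω} ≤ (n : ℝ) ^ (-γ) := by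
  have hθ1 : 0 < θ - 1 := by linarith [hT.theta_gt_one hatom hθ]
  -- This rate gives `exp (-Γ m) ≤ n^(-(γ + 2))` once `m ≥ ε' log n`; the additional `n²` pays for
  -- the union over `m ≤ n` and for constants.
  obtain ⟨ε, hε, hcr⟩ := hT.exists_crude (|γ + 2| / ε')
  refine ⟨ε, hε, fun η hη => ?_⟩
  have hbig : Tendsto (fun n : ℕ => ((n : ℝ) ^ (γ + 2)) *
      Real.exp (-(2 * (θ - 1) ^ 2 * (n : ℝ) ^ (η / 2)))) atTop (𝓝 0) := by
    have h1 : Tendsto (fun n : ℕ => (n : ℝ) ^ (η / 2)) atTop atTop :=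
      (tendsto_rpow_atTop (by positivity)).comp tendsto_natCast_atTop_atTop
    have h2 := (tendsto_rpow_mul_exp_neg_mul_atTop_nhds_zero ((γ + 2) / (η / 2))
      (2 * (θ - 1) ^ 2) (by positivity)).comp h1
    refine h2.congr fun n => ?_
    simp only [Function.comp]
    rw [← Real.rpow_mul (by positivity), mul_div_cancel₀ _ (by positivity)]
    ring_nf
  filter_upwards [hbig.eventually_lt_const (show (0 : ℝ) < 1 / 4 by norm_num),
    eventually_ge_atTop 4] with n hn hn2
  have hn0 : (4 : ℝ) ≤ n := by exact_mod_cast hn2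
  have hnpos : (0 : ℝ) < n := by linarith
  have hlog : 0 ≤ Real.log n := Real.log_nonneg (by linarith)
  set δ := (n : ℝ) ^ (-(η / 4)) with hδ
  set V : ℕ → Set Ω := fun m => {ω | (n : ℝ) ^ η ≤ m ∧
    (θ - 1) * m + (θ - 1) * m * δ ≤ wsum (fun i => W i ω) m} with hV
  set L : ℕ → Set Ω := fun m => {ω | (n : ℝ) ^ η ≤ m ∧
    wsum (fun i => W i ω) m ≤ (θ - 1) * m - (θ - 1) * m * δ} with hL
  set C : ℕ → Set Ω := fun m => {ω | ε' * Real.log n ≤ m ∧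
    wsum (fun i => W i ω) m ≤ ε * m} with hC
  -- The exponent `η / 4` in `δ` is chosen so that `δ² m ≥ n^(η / 2)` for `m ≥ n^η`, which makes the
  -- deviation probability smaller than any power of `n`.
  have hdev : ∀ m : ℕ, (n : ℝ) ^ η ≤ m →
      Real.exp (-(2 * ((θ - 1) * m * δ) ^ 2 / m)) ≤ (n : ℝ) ^ (-(γ + 2)) / 4 := by
    intro m hm
    have hm0 : (0 : ℝ) < m := lt_of_lt_of_le (by positivity) hm
    have h1 : (n : ℝ) ^ (η / 2) ≤ δ ^ 2 * m := by
      calc (n : ℝ) ^ (η / 2) = δ ^ 2 * (n : ℝ) ^ η := by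
            rw [hδ, ← Real.rpow_natCast, ← Real.rpow_mul hnpos.le, ← Real.rpow_add hnpos]
            congr 1
            push_cast
            ring
        _ ≤ _ := by gcongr
    have h2 : Real.exp (-(2 * ((θ - 1) * m * δ) ^ 2 / m)) ≤
        Real.exp (-(2 * (θ - 1) ^ 2 * (n : ℝ) ^ (η / 2))) := by
      refine Real.exp_le_exp.2 (neg_le_neg ?_)
      have e : 2 * ((θ - 1) * m * δ) ^ 2 / m = 2 * (θ - 1) ^ 2 * (δ ^ 2 * m) := by
        field_simp
      rw [e]
      gcongr
    refine h2.trans ?_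
    rw [Real.rpow_neg hnpos.le, le_div_iff₀ (by norm_num), ← one_div, le_div_iff₀ (by positivity)]
    nlinarith
  have hPV : ∀ m, P.real (V m) ≤ (n : ℝ) ^ (-(γ + 2)) / 4 := by
    intro m
    by_cases hm : (n : ℝ) ^ η ≤ m
    · refine le_trans ?_ (hdev m hm)
      refine le_trans (measureReal_mono fun ω hω => hω.2) (hT.prob_upper hatom hθ m ?_)
      positivity
    · have : V m = ∅ := by ext ω; simp [hV, hm]
      rw [this, measureReal_empty]; positivity
  have hPL : ∀ m, P.real (L m) ≤ (n : ℝ) ^ (-(γ + 2)) / 4 := by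
    intro m
    by_cases hm : (n : ℝ) ^ η ≤ m
    · refine le_trans ?_ (hdev m hm)
      refine le_trans (measureReal_mono fun ω hω => hω.2) (hT.prob_lower hatom hθ m ?_)
      positivity
    · have : L m = ∅ := by ext ω; simp [hL, hm]
      rw [this, measureReal_empty]; positivity
  have hPC : ∀ m, P.real (C m) ≤ (n : ℝ) ^ (-(γ + 2)) := by
    intro m
    by_cases hm : ε' * Real.log n ≤ m
    · refine (measureReal_mono fun ω hω => hω.2).trans ((hcr m).trans ?_)
      rw [Real.rpow_def_of_pos hnpos]
      refine Real.exp_le_exp.2 ?_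
      have h1 : |γ + 2| / ε' * (ε' * Real.log n) ≤ |γ + 2| / ε' * m := by gcongr
      have h2 : |γ + 2| / ε' * (ε' * Real.log n) = |γ + 2| * Real.log n := by field_simp
      have h3 := le_abs_self (γ + 2)
      nlinarith
    · have : C m = ∅ := by ext ω; simp [hC, hm]
      rw [this, measureReal_empty]; positivity
  set Z : Set Ω := {ω | ¬ ((∀ i, 1 ≤ i → 0 < W i ω) ∧ ∀ i, 1 ≤ i → W i ω ≤ 1)} with hZ
  have hPZ : P.real Z = 0 := by
    rw [measureReal_def, ENNReal.toReal_eq_zero_iff]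
    left
    have : ∀ᵐ ω ∂P, (∀ i, 1 ≤ i → 0 < W i ω) ∧ ∀ i, 1 ≤ i → W i ω ≤ 1 :=
      hT.ae_pos.and (hT.ae_le_one hatom)
    exact this
  have hsub : {ω | ¬ Good θ η ε ε' n fun i => W i ω} ⊆
      Z ∪ ⋃ m ∈ Finset.range (n + 1), (V m ∪ (L m ∪ C m)) := by
    intro ω hω
    by_contra hcon
    simp only [Set.mem_union, Set.mem_iUnion, not_or, not_exists, Finset.mem_range, hZ,
      Set.mem_ofPred_eq, not_not] at hcon
    obtain ⟨⟨h1, h2⟩, h3⟩ := hcon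
    refine hω ⟨h1, h2, fun m hm hm2 => ?_, fun m hm hm2 => ?_, fun m hm hm2 => ?_⟩
    · have := (h3 m (by omega)).2.1
      by_contra h4
      exact this ⟨hm2, by rw [not_le] at h4; nlinarith⟩
    · have := (h3 m (by omega)).1
      by_contra h4
      exact this ⟨hm2, by rw [not_le] at h4; nlinarith⟩
    · have := (h3 m (by omega)).2.2
      by_contra h4
      exact this ⟨hm2, (not_le.1 h4).le⟩
  calc P.real {ω | ¬ Good θ η ε ε' n fun i => W i ω}
      ≤ P.real Z + ∑ m ∈ Finset.range (n + 1), P.real (V m ∪ (L m ∪ C m)) :=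
        (measureReal_mono hsub).trans ((measureReal_union_le _ _).trans
          (add_le_add le_rfl (measureReal_biUnion_finset_le _ _)))
    _ ≤ 0 + ∑ m ∈ Finset.range (n + 1), ((n : ℝ) ^ (-(γ + 2)) / 4 +
          ((n : ℝ) ^ (-(γ + 2)) / 4 + (n : ℝ) ^ (-(γ + 2)))) := by
        refine add_le_add hPZ.le (Finset.sum_le_sum fun m _ => ?_)
        refine (measureReal_union_le _ _).trans (add_le_add (hPV m) ?_)
        exact (measureReal_union_le _ _).trans (add_le_add (hPL m) (hPC m))
    _ = (n + 1) * (3 / 2) * (n : ℝ) ^ (-(γ + 2)) := by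
        rw [Finset.sum_const, Finset.card_range, nsmul_eq_mul]
        push_cast
        ring
    _ ≤ n ^ (2 : ℝ) * (n : ℝ) ^ (-(γ + 2)) := by
        gcongr
        rw [Real.rpow_two]
        nlinarith
    _ = (n : ℝ) ^ (-γ) := by
        rw [← Real.rpow_add hnpos]
        congr 1
        ring

end IsWRT

/-! ### Poisson comparison for regular weights -/

/-- Regularity of the partial sums of the weights between `N` and `n`. -/
structure Regular (θ δ : ℝ) (N n : ℕ) (w : ℕ → ℝ) : Prop where
  pos : ∀ i, 1 ≤ i → 0 < w i
  le_one : ∀ i, 1 ≤ i → w i ≤ 1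
  lower : ∀ m : ℕ, N ≤ m → m ≤ n → (θ - 1) * m * (1 - δ) ≤ wsum w m
  upper : ∀ m : ℕ, N ≤ m → m ≤ n → wsum w m ≤ (θ - 1) * m * (1 + δ)

lemma sum_attachProb (w : ℕ → ℝ) {n v : ℕ} (hv : 1 ≤ v) (f : ℕ → ℝ) :
    ∑ m ∈ Finset.Ico 1 n, attachProb w v m * f m = ∑ m ∈ Finset.Ico v n, w v / wsum w m * f m := by
  have h1 : ∑ m ∈ Finset.Ico v n, w v / wsum w m * f m =
      ∑ m ∈ Finset.Ico v n, attachProb w v m * f m :=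
    Finset.sum_congr rfl fun m hm => by rw [attachProb, if_pos (Finset.mem_Ico.1 hm).1]
  rw [h1]
  refine (Finset.sum_subset (Finset.Ico_subset_Ico_left hv) fun m hm hm2 => ?_).symm
  rw [attachProb, if_neg, zero_mul]
  intro hvm
  exact hm2 (Finset.mem_Ico.2 ⟨hvm, (Finset.mem_Ico.1 hm).2⟩)

lemma harm_le_log {n v : ℕ} (hv : 2 ≤ v) (hvn : v ≤ n) : harm n v ≤ Real.log n := by
  have hv' : (2 : ℝ) ≤ v := by exact_mod_cast hv
  have hn' : (v : ℝ) ≤ n := by exact_mod_cast hvn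
  refine (harm_le_log_div hv hvn).trans (Real.log_le_log ?_ ?_)
  · exact div_pos (by linarith) (by linarith)
  · exact div_le_self (by linarith) (by linarith)

namespace Regular

variable {θ δ : ℝ} {N n : ℕ} {w : ℕ → ℝ}

lemma attachProb_le (h : Regular θ δ N n w) (hθ : 1 < θ) (hδ : δ ≤ 1 / 2)
    {v : ℕ} (hv : N ≤ v) (hN : 1 ≤ N) {m : ℕ} (hm : m ≤ n) :
    attachProb w v m ≤ 2 * (θ - 1)⁻¹ / N := by
  have hθ1 : 0 < θ - 1 := by linarith
  have hN' : (0 : ℝ) < N := by exact_mod_cast hN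
  unfold attachProb
  split_ifs with hvm
  · have hm' : (N : ℝ) ≤ m := by exact_mod_cast hv.trans hvm
    have h1 := h.lower m (hv.trans hvm) hm
    have h2 : (θ - 1) * N * (1 / 2) ≤ wsum w m := by
      refine le_trans ?_ h1
      gcongr
      linarith
    have h3 := h.le_one v (by omega)
    calc w v / wsum w m ≤ 1 / ((θ - 1) * N * (1 / 2)) := by gcongr
      _ = _ := by field_simp
  · positivity

lemma sum_le (h : Regular θ δ N n w) (hθ : 1 < θ) (hδ : δ ≤ 1 / 2) {v : ℕ} (hv : N ≤ v)
    (hN : 1 ≤ N) :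
    ∑ m ∈ Finset.Ico 1 n, attachProb w v m ≤ w v * ((θ - 1)⁻¹ / (1 - δ)) * harm n v := by
  have hθ1 : 0 < θ - 1 := by linarith
  have := sum_attachProb w (n := n) (hN.trans hv) (fun _ => 1)
  simp only [mul_one] at this
  rw [this, harm, Finset.mul_sum]
  refine Finset.sum_le_sum fun m hm => ?_
  rw [Finset.mem_Ico] at hm
  have hm0 : (0 : ℝ) < m := by exact_mod_cast (by omega : 0 < m)
  have h1 := h.lower m (hv.trans hm.1) hm.2.le
  have hδ' : 0 < 1 - δ := by linarith
  have hw := h.pos v (by omega)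
  calc w v / wsum w m ≤ w v / ((θ - 1) * m * (1 - δ)) := by gcongr
    _ = _ := by field_simp

lemma le_sum (h : Regular θ δ N n w) (hθ : 1 < θ) (hδ0 : 0 ≤ δ) {v : ℕ} (hv : N ≤ v)
    (hN : 1 ≤ N) :
    w v * ((θ - 1)⁻¹ / (1 + δ)) * harm n v ≤ ∑ m ∈ Finset.Ico 1 n, attachProb w v m := by
  have hθ1 : 0 < θ - 1 := by linarith
  have := sum_attachProb w (n := n) (hN.trans hv) (fun _ => 1)
  simp only [mul_one] at this
  rw [this, harm, Finset.mul_sum]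
  refine Finset.sum_le_sum fun m hm => ?_
  rw [Finset.mem_Ico] at hm
  have hm0 : (0 : ℝ) < m := by exact_mod_cast (by omega : 0 < m)
  have h1 := h.upper m (hv.trans hm.1) hm.2.le
  have hw := h.pos v (by omega)
  have hs := wsum_pos h.pos (n := m) (by omega)
  calc w v * ((θ - 1)⁻¹ / (1 + δ)) * (m : ℝ)⁻¹ = w v / ((θ - 1) * m * (1 + δ)) := by field_simp
    _ ≤ _ := by gcongr

variable {ι : Type*} [Fintype ι] [DecidableEq ι] {v : ι → ℕ} {σ : ℝ}

lemma sum_attachProb_le (h : Regular θ δ N n w) (hθ : 1 < θ) (hδ : δ ≤ 1 / 2)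
    (hN : 1 ≤ N) (hvN : ∀ l, N ≤ v l)
    (hσ : Fintype.card ι * (2 * (θ - 1)⁻¹ / N) ≤ σ) {m : ℕ} (hm : m ≤ n) :
    ∑ l, attachProb w (v l) m ≤ σ := by
  refine le_trans ?_ hσ
  calc ∑ l, attachProb w (v l) m ≤ ∑ _l : ι, 2 * (θ - 1)⁻¹ / N :=
        Finset.sum_le_sum fun l _ => h.attachProb_le hθ hδ (hvN l) hN hm
    _ = _ := by simp

/-- For regular weights, the joint degree distribution is bounded by a product of Poisson
probabilities. -/
lemma degProb_le_pois (h : Regular θ δ N n w) (hθ : 1 < θ) (hδ0 : 0 ≤ δ) (hδ : δ ≤ 1 / 2)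
    (hN : 2 ≤ N) (hv : Function.Injective v) (hvN : ∀ l, N ≤ v l) (hvn : ∀ l, v l ≤ n)
    (hσ : Fintype.card ι * (2 * (θ - 1)⁻¹ / N) ≤ σ) (hσ1 : σ ≤ 1 / 2) (hn : 1 ≤ n) (D : ι → ℕ) :
    degProb w v (n - 1) D ≤
      Real.exp (Fintype.card ι * (((θ - 1)⁻¹ / ((1 - δ) * (1 - σ)) - (θ - 1)⁻¹ / (1 + δ)) *
        Real.log n)) *
      ∏ l, pois (w (v l) * ((θ - 1)⁻¹ / ((1 - δ) * (1 - σ))) * harm n (v l)) (D l) := by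
  have hθ1 : 0 < θ - 1 := by linarith
  have hδ' : 0 < 1 - δ := by linarith
  have hN1 : 1 ≤ N := by omega
  have hσ0 : 0 ≤ σ := le_trans (by positivity) hσ
  have hσ' : 0 < 1 - σ := by linarith
  -- The powers are bounded with the rate `t`, enlarged for the error `δ` of the partial sums and
  -- for the denominators `1 - ∑ p ≥ 1 - σ`; the exponentials are bounded with the smaller rate
  -- `t'`. Unifying the rates costs `exp ((t - t') log n)` per vertex, which tends to one when `δ`
  -- and `σ` are `o(1 / log n)`.
  set t := (θ - 1)⁻¹ / ((1 - δ) * (1 - σ)) with ht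
  set t' := (θ - 1)⁻¹ / (1 + δ) with ht'
  have hs : ∀ m ≤ n - 1, ∑ l, attachProb w (v l) m ≤ σ := fun m hm =>
    h.sum_attachProb_le hθ hδ hN1 hvN hσ (by omega)
  have h0 : ∀ l m, 0 ≤ attachProb w (v l) m := fun l m =>
    attachProb_nonneg h.pos (hN1.trans (hvN l)) m
  have h1 := degProb_le h.pos hv (fun l => hN1.trans (hvN l)) (M := n - 1)
    (fun m hm => (hs m hm).trans_lt (by linarith)) D
  rw [Nat.sub_add_cancel hn] at h1
  refine h1.trans ?_
  have htt : t' ≤ t := by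
    rw [ht, ht']
    have : (1 - δ) * (1 - σ) ≤ 1 + δ := by nlinarith
    gcongr
  -- the product
  have hprod : ∏ m ∈ Finset.Ico 1 n, (1 - ∑ l, attachProb w (v l) m) ≤
      ∏ l, Real.exp (-(w (v l) * t' * harm n (v l))) := by
    calc _ ≤ ∏ m ∈ Finset.Ico 1 n, Real.exp (-∑ l, attachProb w (v l) m) := by
          refine Finset.prod_le_prod (fun m hm => ?_) fun m hm => ?_
          · have := hs m (by have := (Finset.mem_Ico.1 hm).2; omega)
            linarith
          · have := Real.add_one_le_exp (-∑ l, attachProb w (v l) m)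
            linarith
      _ = Real.exp (-∑ l, ∑ m ∈ Finset.Ico 1 n, attachProb w (v l) m) := by
          rw [← Real.exp_sum, Finset.sum_neg_distrib, Finset.sum_comm]
      _ ≤ Real.exp (∑ l, -(w (v l) * t' * harm n (v l))) := by
          rw [Finset.sum_neg_distrib]
          refine Real.exp_le_exp.2 (neg_le_neg (Finset.sum_le_sum fun l _ => ?_))
          exact h.le_sum hθ hδ0 (hvN l) hN1
      _ = _ := Real.exp_sum _ _
  have hR : ∀ l, ∑ m ∈ Finset.Ico 1 n, attachProb w (v l) m / (1 - ∑ k, attachProb w (v k) m) ≤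
      w (v l) * t * harm n (v l) := by
    intro l
    calc _ ≤ ∑ m ∈ Finset.Ico 1 n, attachProb w (v l) m / (1 - σ) := by
          refine Finset.sum_le_sum fun m hm => ?_
          have := hs m (by have := (Finset.mem_Ico.1 hm).2; omega)
          have := h0 l m
          gcongr
      _ ≤ (w (v l) * ((θ - 1)⁻¹ / (1 - δ)) * harm n (v l)) / (1 - σ) := by
          rw [← Finset.sum_div]
          gcongr
          exact h.sum_le hθ hδ (hvN l) hN1
      _ = _ := by rw [ht]; field_simp
  have hR0 : ∀ l, 0 ≤ ∑ m ∈ Finset.Ico 1 n,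
      attachProb w (v l) m / (1 - ∑ k, attachProb w (v k) m) := fun l =>
    Finset.sum_nonneg fun m hm => div_nonneg (h0 l m) (by
      have := hs m (by have := (Finset.mem_Ico.1 hm).2; omega)
      linarith)
  have hterm : ∀ l, Real.exp (-(w (v l) * t' * harm n (v l))) *
      ((w (v l) * t * harm n (v l)) ^ D l / (D l).factorial) ≤
      Real.exp ((t - t') * Real.log n) * pois (w (v l) * t * harm n (v l)) (D l) := by
    intro l
    have hw0 := h.pos (v l) (hN1.trans (hvN l))
    have hw1 := h.le_one (v l) (hN1.trans (hvN l))
    have hh0 := harm_nonneg n (v l)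
    have hh1 := harm_le_log (hN.trans (hvN l)) (hvn l)
    have ht0 : 0 ≤ t := by positivity
    have e : Real.exp ((t - t') * Real.log n) * pois (w (v l) * t * harm n (v l)) (D l) =
        Real.exp ((t - t') * Real.log n + -(w (v l) * t * harm n (v l))) *
          ((w (v l) * t * harm n (v l)) ^ D l / (D l).factorial) := by
      unfold pois
      rw [Real.exp_add]
      ring
    rw [e]
    gcongr
    have : w (v l) * ((t - t') * harm n (v l)) ≤ 1 * ((t - t') * Real.log n) := by
      have : 0 ≤ t - t' := by linarith
      gcongr
    linarith
  calc _ ≤ (∏ l, Real.exp (-(w (v l) * t' * harm n (v l)))) *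
        ∏ l, (w (v l) * t * harm n (v l)) ^ D l / (D l).factorial := by
        refine mul_le_mul hprod ?_ ?_ ?_
        · refine Finset.prod_le_prod (fun l _ => ?_) fun l _ => ?_
          · have := hR0 l; positivity
          · have := hR0 l
            have := hR l
            gcongr
        · exact Finset.prod_nonneg fun l _ => by have := hR0 l; positivity
        · exact Finset.prod_nonneg fun l _ => (Real.exp_pos _).le
    _ = ∏ l, Real.exp (-(w (v l) * t' * harm n (v l))) *
        ((w (v l) * t * harm n (v l)) ^ D l / (D l).factorial) := by
        rw [← Finset.prod_mul_distrib]
    _ ≤ ∏ l, Real.exp ((t - t') * Real.log n) * pois (w (v l) * t * harm n (v l)) (D l) := by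
        refine Finset.prod_le_prod (fun l _ => ?_) fun l _ => hterm l
        have hw0 := h.pos (v l) (hN1.trans (hvN l))
        have hh0 := harm_nonneg n (v l)
        have ht0 : 0 ≤ t := by positivity
        positivity
    _ = _ := by
        rw [Finset.prod_mul_distrib, Finset.prod_const, Finset.card_univ, ← Real.exp_nat_mul]

/-- For regular weights, the joint degree distribution of vertices of weight one is bounded from
below by a product of Poisson probabilities. -/
lemma pois_le_degProb (h : Regular θ δ N n w) (hθ : 1 < θ) (hδ0 : 0 ≤ δ) (hδ : δ ≤ 1 / 2)
    (hN : 2 ≤ N) (hv : Function.Injective v) (hvN : ∀ l, N ≤ v l) (hvn : ∀ l, v l ≤ n)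
    (hσ : Fintype.card ι * (2 * (θ - 1)⁻¹ / N) ≤ σ) (hσ1 : σ ≤ 1 / 2) (hn : 1 ≤ n) {D : ι → ℕ}
    (hw1 : ∀ l, w (v l) = 1) (hh : ∀ l, 1 ≤ harm n (v l)) {Q : ℝ} (hQ : (∑ l, D l : ℕ) ≤ Q)
    (hQ2 : δ + Q * σ * (θ - 1) ≤ 1) :
    Real.exp (-(Fintype.card ι * (((θ - 1)⁻¹ / ((1 - δ) * (1 - σ)) - (θ - 1)⁻¹) * Real.log n))) *
      (1 - Q * (δ + Q * σ * (θ - 1))) * ∏ l, pois ((θ - 1)⁻¹ * harm n (v l)) (D l) ≤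
      degProb w v (n - 1) D := by
  have hθ1 : 0 < θ - 1 := by linarith
  have hδ' : 0 < 1 - δ := by linarith
  have hN1 : 1 ≤ N := by omega
  have hσ0 : 0 ≤ σ := le_trans (by positivity) hσ
  have hσ' : 0 < 1 - σ := by linarith
  have hQ0 : 0 ≤ Q := le_trans (by positivity) hQ
  set κ := (θ - 1)⁻¹ with hκ
  have hκ0 : 0 < κ := by positivity
  have hκθ : κ * (θ - 1) = 1 := by rw [hκ]; field_simp
  set t := κ / ((1 - δ) * (1 - σ)) with ht
  set χ := δ + Q * σ * (θ - 1) with hχ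
  have hχ0 : 0 ≤ χ := by positivity
  have hs : ∀ m ≤ n - 1, ∑ l, attachProb w (v l) m ≤ σ := fun m hm =>
    h.sum_attachProb_le hθ hδ hN1 hvN hσ (by omega)
  have h0 : ∀ l m, 0 ≤ attachProb w (v l) m := fun l m =>
    attachProb_nonneg h.pos (hN1.trans (hvN l)) m
  have h1 := le_degProb h.pos hv (fun l => hN1.trans (hvN l)) (M := n - 1)
    (fun m hm => (hs m hm).trans_lt (by linarith)) hσ0
    (fun l m hm => (Finset.single_le_sum (f := fun l => attachProb w (v l) m)
      (fun l _ => h0 l m) (Finset.mem_univ l)).trans (hs m hm)) D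
  rw [Nat.sub_add_cancel hn] at h1
  refine le_trans ?_ h1
  have hκt : κ ≤ t := by
    rw [ht, le_div_iff₀ (by positivity)]
    have : (1 - δ) * (1 - σ) ≤ 1 := by nlinarith
    nlinarith
  have hprod : ∏ l, Real.exp (-(t * harm n (v l))) ≤
      ∏ m ∈ Finset.Ico 1 n, (1 - ∑ l, attachProb w (v l) m) := by
    calc _ = Real.exp (∑ l, -(t * harm n (v l))) := (Real.exp_sum _ _).symm
      _ ≤ Real.exp (-∑ l, ∑ m ∈ Finset.Ico 1 n, attachProb w (v l) m / (1 - σ)) := by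
          rw [Finset.sum_neg_distrib]
          refine Real.exp_le_exp.2 (neg_le_neg (Finset.sum_le_sum fun l _ => ?_))
          rw [← Finset.sum_div, div_le_iff₀ hσ']
          refine (h.sum_le hθ hδ (hvN l) hN1).trans (le_of_eq ?_)
          rw [ht, hw1 l, hκ]
          field_simp
      _ = ∏ m ∈ Finset.Ico 1 n, Real.exp (-((∑ l, attachProb w (v l) m) / (1 - σ))) := by
          rw [← Real.exp_sum, Finset.sum_neg_distrib, Finset.sum_comm]
          simp_rw [Finset.sum_div]
      _ ≤ _ := by
          refine Finset.prod_le_prod (fun m hm => (Real.exp_pos _).le) fun m hm => ?_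
          have hsm := hs m (by have := (Finset.mem_Ico.1 hm).2; omega)
          set S := ∑ l, attachProb w (v l) m with hS
          have hS0 : 0 ≤ S := Finset.sum_nonneg fun l _ => h0 l m
          have hS1 : 0 < 1 - S := by linarith
          have h2 : S / (1 - S) ≤ S / (1 - σ) := by gcongr
          have h3 : Real.log (1 - S) ≥ -(S / (1 - S)) := by
            have := Real.log_le_sub_one_of_pos (inv_pos.2 hS1)
            rw [Real.log_inv] at this
            have e : (1 - S)⁻¹ - 1 = S / (1 - S) := by field_simp; ring
            linarith
          rw [← Real.exp_log hS1]
          exact Real.exp_le_exp.2 (by linarith)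
  -- The condition `1 ≤ harm` turns the additive loss `Q σ` into the relative loss `Q σ (θ - 1)`,
  -- because `κ (θ - 1) = 1`.
  have hmax : ∀ l, κ * harm n (v l) * (1 - χ) ≤
      max (∑ m ∈ Finset.Ico 1 n, attachProb w (v l) m - (∑ k, D k : ℕ) * σ) 0 := by
    intro l
    refine le_max_of_le_left ?_
    have h2 := h.le_sum hθ hδ0 (hvN l) hN1
    rw [hw1 l, one_mul] at h2
    have h3 : ((∑ k, D k : ℕ) : ℝ) * σ ≤ Q * σ := by gcongr
    have h4 : κ * (1 - δ) ≤ κ / (1 + δ) := by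
      rw [le_div_iff₀ (by linarith)]
      nlinarith [mul_nonneg hκ0.le (mul_nonneg hδ0 hδ0)]
    have h5 : κ * (1 - δ) * harm n (v l) ≤ κ / (1 + δ) * harm n (v l) :=
      mul_le_mul_of_nonneg_right h4 (harm_nonneg _ _)
    have h6 : Q * σ * 1 ≤ Q * σ * harm n (v l) :=
      mul_le_mul_of_nonneg_left (hh l) (by positivity)
    have h7 : κ * harm n (v l) * (1 - χ) =
        κ * (1 - δ) * harm n (v l) - (κ * (θ - 1)) * (Q * σ * harm n (v l)) := by
      rw [hχ]; ring
    rw [h7, hκθ]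
    linarith
  have hterm : ∀ l, Real.exp (-((t - κ) * Real.log n)) * ((1 - χ) ^ D l *
      pois (κ * harm n (v l)) (D l)) ≤ Real.exp (-(t * harm n (v l))) *
      ((κ * harm n (v l) * (1 - χ)) ^ D l / (D l).factorial) := by
    intro l
    have hh0 := harm_nonneg n (v l)
    have hh1 := harm_le_log (hN.trans (hvN l)) (hvn l)
    have hχ1 : 0 ≤ 1 - χ := by linarith
    have e : Real.exp (-((t - κ) * Real.log n)) * ((1 - χ) ^ D l * pois (κ * harm n (v l)) (D l)) =
        Real.exp (-((t - κ) * Real.log n) + -(κ * harm n (v l))) *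
          ((κ * harm n (v l) * (1 - χ)) ^ D l / (D l).factorial) := by
      unfold pois
      rw [Real.exp_add, mul_pow (κ * harm n (v l))]
      ring
    rw [e]
    gcongr
    have : (t - κ) * harm n (v l) ≤ (t - κ) * Real.log n :=
      mul_le_mul_of_nonneg_left hh1 (by linarith)
    linarith
  have hχ1 : 0 ≤ 1 - χ := by linarith
  have hpow : 1 - Q * χ ≤ ∏ l, (1 - χ) ^ D l := by
    rw [Finset.prod_pow_eq_pow_sum]
    have h2 := one_add_mul_le_pow (a := -χ) (by linarith) (∑ l, D l)
    have h3 : ((∑ l, D l : ℕ) : ℝ) * χ ≤ Q * χ := by gcongr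
    have e : 1 + -χ = 1 - χ := by ring
    rw [e] at h2
    push_cast at h2 h3
    linarith
  have hpn : ∀ l, 0 ≤ pois (κ * harm n (v l)) (D l) := fun l =>
    pois_nonneg (mul_nonneg hκ0.le (harm_nonneg _ _)) _
  calc _ ≤ Real.exp (-(Fintype.card ι * ((t - κ) * Real.log n))) * (∏ l, (1 - χ) ^ D l) *
        ∏ l, pois (κ * harm n (v l)) (D l) := by
        gcongr
        exact Finset.prod_nonneg fun l _ => hpn l
    _ = ∏ l, Real.exp (-((t - κ) * Real.log n)) * ((1 - χ) ^ D l *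
        pois (κ * harm n (v l)) (D l)) := by
        rw [Finset.prod_mul_distrib, Finset.prod_const, Finset.card_univ, ← Real.exp_nat_mul,
          Finset.prod_mul_distrib, mul_neg]
        ring
    _ ≤ ∏ l, Real.exp (-(t * harm n (v l))) *
        ((κ * harm n (v l) * (1 - χ)) ^ D l / (D l).factorial) := by
        refine Finset.prod_le_prod (fun l _ => ?_) fun l _ => hterm l
        have := hpn l
        positivity
    _ = (∏ l, Real.exp (-(t * harm n (v l)))) *
        ∏ l, (κ * harm n (v l) * (1 - χ)) ^ D l / (D l).factorial := Finset.prod_mul_distrib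
    _ ≤ _ := by
        have hnn : ∀ l, 0 ≤ κ * harm n (v l) * (1 - χ) := fun l =>
          mul_nonneg (mul_nonneg hκ0.le (harm_nonneg _ _)) hχ1
        refine mul_le_mul hprod ?_ ?_ ?_
        · refine Finset.prod_le_prod (fun l _ => ?_) fun l _ => ?_
          · have := hnn l; positivity
          · have := hnn l
            have := hmax l
            gcongr
        · exact Finset.prod_nonneg fun l _ => by have := hnn l; positivity
        · exact (Finset.prod_nonneg fun l _ => (Real.exp_pos _).le).trans hprod

end Regular

/-! ### Sums over tuples of vertices -/

section TupleSums

variable {ι : Type*} [Fintype ι] [DecidableEq ι]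

/-- Sum over the tuples having a component in a small set. -/
lemma sum_exists_le {s : Finset ℕ} {F : ι → ℕ → ℝ} (hF : ∀ l, ∀ v ∈ s, 0 ≤ F l v) (N : ℕ) :
    ∑ v ∈ Fintype.piFinset (fun _ : ι => s) with ∃ l, v l < N, ∏ l, F l (v l) ≤
      ∑ l₀, (∑ v ∈ s with v < N, F l₀ v) * ∏ l ∈ Finset.univ.erase l₀, ∑ v ∈ s, F l v := by
  have key : ∀ l₀ : ι, (∑ v ∈ s with v < N, F l₀ v) * ∏ l ∈ Finset.univ.erase l₀, ∑ v ∈ s, F l v =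
      ∑ v ∈ Fintype.piFinset (fun _ : ι => s), if v l₀ < N then ∏ l, F l (v l) else 0 := by
    intro l₀
    have h1 := Finset.prod_univ_sum (fun _ : ι => s)
      (fun l v => if l = l₀ then (if v < N then F l v else 0) else F l v)
    rw [← Finset.mul_prod_erase _ _ (Finset.mem_univ l₀)] at h1
    simp only [if_true] at h1
    rw [Finset.sum_filter]
    have h2 : ∏ l ∈ Finset.univ.erase l₀, ∑ v ∈ s, F l v = ∏ l ∈ Finset.univ.erase l₀, ∑ v ∈ s,
        (if l = l₀ then (if v < N then F l v else 0) else F l v) :=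
      Finset.prod_congr rfl fun l hl => by
        simp only [if_neg (Finset.ne_of_mem_erase hl)]
    rw [h2, h1]
    refine Finset.sum_congr rfl fun v _ => ?_
    split_ifs with h
    · refine Finset.prod_congr rfl fun l _ => ?_
      by_cases hl : l = l₀
      · subst hl; simp [h]
      · simp [hl]
    · exact Finset.prod_eq_zero (Finset.mem_univ l₀) (by simp [h])
  simp_rw [key]
  rw [Finset.sum_comm, Finset.sum_filter]
  refine Finset.sum_le_sum fun v hv => ?_
  have hnn : 0 ≤ ∏ l, F l (v l) :=
    Finset.prod_nonneg fun l _ => hF l _ (Fintype.mem_piFinset.1 hv l)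
  split_ifs with h
  · obtain ⟨l₀, hl₀⟩ := h
    refine le_trans (le_of_eq ?_) (Finset.single_le_sum (f := fun l₀ =>
      if v l₀ < N then ∏ l, F l (v l) else 0) (fun l _ => ?_) (Finset.mem_univ l₀))
    · simp [hl₀]
    · split_ifs <;> simp [hnn]
  · exact Finset.sum_nonneg fun l _ => by split_ifs <;> simp [hnn]

/-- Sum over the tuples with two given components equal. -/
lemma sum_eq_le {s : Finset ℕ} {F : ι → ℕ → ℝ} (hF : ∀ l, ∀ v ∈ s, 0 ≤ F l v) {R : ℝ}
    (hR : ∀ l, ∀ v ∈ s, F l v ≤ R) {l₁ l₂ : ι} (hne : l₁ ≠ l₂) :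
    ∑ v ∈ Fintype.piFinset (fun _ : ι => s), (if v l₁ = v l₂ then ∏ l, F l (v l) else 0) ≤
      R * ∏ l ∈ Finset.univ.erase l₁, ∑ v ∈ s, F l v := by
  set A : ι → ℝ := fun l => ∑ v ∈ s, F l v with hA
  -- Once the common value `u` of the two components is fixed, the sum over tuples factorises, and
  -- one of the two factors at `u` can be bounded by `R`.
  have h1 : ∑ v ∈ Fintype.piFinset (fun _ : ι => s),
      (if v l₁ = v l₂ then ∏ l, F l (v l) else 0) =
      ∑ u ∈ s, ∑ v ∈ Fintype.piFinset (fun _ : ι => s),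
        ∏ l, (if l = l₁ ∨ l = l₂ then (if v l = u then F l (v l) else 0) else F l (v l)) := by
    rw [Finset.sum_comm]
    refine Finset.sum_congr rfl fun v hv => ?_
    have h2 : ∀ u, ∏ l, (if l = l₁ ∨ l = l₂ then (if v l = u then F l (v l) else 0)
        else F l (v l)) = if u = v l₁ then (if v l₁ = v l₂ then ∏ l, F l (v l) else 0) else 0 := by
      intro u
      split_ifs with h3 h4
      · refine Finset.prod_congr rfl fun l _ => ?_
        by_cases hl : l = l₁ ∨ l = l₂
        · rw [if_pos hl]
          rcases hl with rfl | rfl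
          · rw [if_pos h3.symm]
          · rw [if_pos (h4.symm.trans h3.symm)]
        · rw [if_neg hl]
      · refine Finset.prod_eq_zero (Finset.mem_univ l₂) ?_
        rw [if_pos (Or.inr rfl), if_neg]
        intro h5
        exact h4 (h3.symm.trans h5.symm)
      · refine Finset.prod_eq_zero (Finset.mem_univ l₁) ?_
        rw [if_pos (Or.inl rfl), if_neg (fun h5 => h3 h5.symm)]
    simp_rw [h2]
    rw [Finset.sum_ite_eq', if_pos (Fintype.mem_piFinset.1 hv l₁)]
  have hl₂ : l₂ ∈ Finset.univ.erase l₁ := Finset.mem_erase.2 ⟨hne.symm, Finset.mem_univ _⟩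
  have h3 : ∀ u ∈ s, ∑ v ∈ Fintype.piFinset (fun _ : ι => s),
      ∏ l, (if l = l₁ ∨ l = l₂ then (if v l = u then F l (v l) else 0) else F l (v l)) =
      F l₁ u * (F l₂ u * ∏ l ∈ (Finset.univ.erase l₁).erase l₂, A l) := by
    intro u hu
    rw [← Finset.prod_univ_sum (fun _ : ι => s)
      (fun l v => if l = l₁ ∨ l = l₂ then (if v = u then F l v else 0) else F l v),
      ← Finset.mul_prod_erase _ _ (Finset.mem_univ l₁), ← Finset.mul_prod_erase _ _ hl₂]
    congr 1
    · simp [hu]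
    · congr 1
      · simp [hu]
      · refine Finset.prod_congr rfl fun l hl => ?_
        have h4 := Finset.ne_of_mem_erase hl
        have h5 := Finset.ne_of_mem_erase (Finset.mem_of_mem_erase hl)
        simp [h4, h5, hA]
  rw [h1, Finset.sum_congr rfl h3, ← Finset.mul_prod_erase _ _ hl₂]
  have hrest : 0 ≤ ∏ l ∈ (Finset.univ.erase l₁).erase l₂, A l :=
    Finset.prod_nonneg fun l _ => Finset.sum_nonneg fun v hv => hF l v hv
  calc _ ≤ ∑ u ∈ s, R * (F l₂ u * ∏ l ∈ (Finset.univ.erase l₁).erase l₂, A l) :=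
        Finset.sum_le_sum fun u hu => mul_le_mul_of_nonneg_right (hR l₁ u hu)
          (mul_nonneg (hF l₂ u hu) hrest)
    _ = _ := by rw [← Finset.mul_sum, ← Finset.sum_mul]

/-- Lower bound for a sum over tuples with distinct components. -/
lemma le_sum_injective {s : Finset ℕ} {F : ι → ℕ → ℝ} (hF : ∀ l, ∀ v ∈ s, 0 ≤ F l v) {R : ℝ}
    (hR : ∀ l, ∀ v ∈ s, F l v ≤ R) :
    ∏ l, ∑ v ∈ s, F l v -
      ∑ l₁ : ι, ∑ _l₂ : ι, |R| * ∏ l ∈ Finset.univ.erase l₁, ∑ v ∈ s, F l v ≤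
      ∑ v ∈ Fintype.piFinset (fun _ : ι => s) with Function.Injective v, ∏ l, F l (v l) := by
  classical
  have hrest : ∀ l₁ : ι, 0 ≤ ∏ l ∈ Finset.univ.erase l₁, ∑ v ∈ s, F l v := fun l₁ =>
    Finset.prod_nonneg fun l _ => Finset.sum_nonneg fun v hv => hF l v hv
  -- A tuple that is not injective has a coincident pair, so a union bound over ordered pairs
  -- suffices. Pairs with `l₁ = l₂` contribute nothing and are kept only to sum over the full
  -- square.
  have h1 : ∀ l₁ l₂ : ι, ∑ v ∈ Fintype.piFinset (fun _ : ι => s),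
      (if l₁ ≠ l₂ ∧ v l₁ = v l₂ then ∏ l, F l (v l) else 0) ≤
      |R| * ∏ l ∈ Finset.univ.erase l₁, ∑ v ∈ s, F l v := by
    intro l₁ l₂
    by_cases hne : l₁ = l₂
    · simp only [hne, ne_eq, not_true_eq_false, false_and, if_false, Finset.sum_const_zero]
      exact mul_nonneg (abs_nonneg _) (hrest l₂)
    · simp only [ne_eq, hne, not_false_eq_true, true_and]
      exact (sum_eq_le hF hR hne).trans
        (mul_le_mul_of_nonneg_right (le_abs_self R) (hrest l₁))
  rw [sub_le_iff_le_add, Finset.prod_univ_sum, Finset.sum_filter]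
  refine le_trans ?_ (add_le_add le_rfl (Finset.sum_le_sum fun l₁ _ =>
    Finset.sum_le_sum fun l₂ _ => h1 l₁ l₂))
  have h2 : ∑ l₁ : ι, ∑ l₂ : ι, ∑ v ∈ Fintype.piFinset (fun _ : ι => s),
      (if l₁ ≠ l₂ ∧ v l₁ = v l₂ then ∏ l, F l (v l) else 0) =
      ∑ v ∈ Fintype.piFinset (fun _ : ι => s), ∑ l₁ : ι, ∑ l₂ : ι,
        (if l₁ ≠ l₂ ∧ v l₁ = v l₂ then ∏ l, F l (v l) else 0) := by
    symm
    rw [Finset.sum_comm]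
    refine Finset.sum_congr rfl fun l₁ _ => ?_
    rw [Finset.sum_comm]
  rw [h2, ← Finset.sum_add_distrib]
  refine Finset.sum_le_sum fun v hv => ?_
  have hnn : 0 ≤ ∏ l, F l (v l) :=
    Finset.prod_nonneg fun l _ => hF l _ (Fintype.mem_piFinset.1 hv l)
  have hnn2 : ∀ l₁ l₂ : ι, 0 ≤ (if l₁ ≠ l₂ ∧ v l₁ = v l₂ then ∏ l, F l (v l) else 0) :=
    fun l₁ l₂ => by split_ifs <;> simp [hnn]
  by_cases hinj : Function.Injective v
  · rw [if_pos hinj]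
    exact le_add_of_nonneg_right (Finset.sum_nonneg fun l₁ _ => Finset.sum_nonneg fun l₂ _ =>
      hnn2 l₁ l₂)
  · rw [if_neg hinj, zero_add]
    rw [Function.Injective] at hinj
    push Not at hinj
    obtain ⟨l₁, l₂, h3, h4⟩ := hinj
    calc ∏ l, F l (v l) = (if l₁ ≠ l₂ ∧ v l₁ = v l₂ then ∏ l, F l (v l) else 0) := by
          rw [if_pos ⟨h4, h3⟩]
      _ ≤ ∑ l₂ : ι, (if l₁ ≠ l₂ ∧ v l₁ = v l₂ then ∏ l, F l (v l) else 0) :=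
          Finset.single_le_sum (f := fun l₂ =>
            (if l₁ ≠ l₂ ∧ v l₁ = v l₂ then ∏ l, F l (v l) else 0)) (fun l _ => hnn2 l₁ l)
            (Finset.mem_univ l₂)
      _ ≤ _ := Finset.single_le_sum (f := fun l₁ => ∑ l₂ : ι,
            (if l₁ ≠ l₂ ∧ v l₁ = v l₂ then ∏ l, F l (v l) else 0))
            (fun l _ => Finset.sum_nonneg fun l' _ => hnn2 l l') (Finset.mem_univ l₁)

end TupleSums

/-! ### Exponential moments of the degrees -/

section Chernoff

lemma Good.regular {θ η ε ε' : ℝ} {n : ℕ} {w : ℕ → ℝ} (h : Good θ η ε ε' n w) :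
    Regular θ ((n : ℝ) ^ (-(η / 4))) ⌈(n : ℝ) ^ η⌉₊ n w where
  pos := h.pos
  le_one := h.le_one
  lower m hm hmn := h.lower m hmn ((Nat.le_ceil _).trans (by exact_mod_cast hm))
  upper m hm hmn := h.upper m hmn ((Nat.le_ceil _).trans (by exact_mod_cast hm))

lemma prod_one_add_le_exp {s : Finset ℕ} {f : ℕ → ℝ} (hf : ∀ m ∈ s, 0 ≤ f m) :
    ∏ m ∈ s, (1 + f m) ≤ Real.exp (∑ m ∈ s, f m) := by
  rw [Real.exp_sum]
  refine Finset.prod_le_prod (fun m hm => by linarith [hf m hm]) fun m _ => ?_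
  linarith [Real.add_one_le_exp (f m)]

/-- At tilt `θ` the exponent is `(θ - 1) ∑ p ≤ harm n v / (1 - δ)`, and the harmonic sum is at most
`log (n / (v - 1))`. After normalisation by `n` a vertex therefore contributes about `1 / v`. -/
lemma Regular.prod_le {θ δ : ℝ} {N n : ℕ} {w : ℕ → ℝ} (h : Regular θ δ N n w) (hθ : 1 < θ)
    (hδ0 : 0 ≤ δ) (hδ : δ ≤ 1 / 2) (hN : 2 ≤ N) {v : ℕ} (hv : N ≤ v) (hvn : v ≤ n) :
    ∏ m ∈ Finset.Ico 1 n, (1 + (θ - 1) * attachProb w v m) ≤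
      Real.exp (2 * δ * Real.log n) * (n / (v - 1)) := by
  have hθ1 : 0 < θ - 1 := by linarith
  have hv' : (2 : ℝ) ≤ v := by exact_mod_cast hN.trans hv
  have hn' : (v : ℝ) ≤ n := by exact_mod_cast hvn
  have hδ' : 0 < 1 - δ := by linarith
  have hpos : 0 < (n : ℝ) / (v - 1) := div_pos (by linarith) (by linarith)
  refine (prod_one_add_le_exp fun m _ => mul_nonneg hθ1.le
    (attachProb_nonneg h.pos (by omega) m)).trans ?_
  rw [← Finset.mul_sum]
  have h1 := h.sum_le hθ hδ hv (by omega)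
  have hh0 := harm_nonneg n v
  have h2 : (θ - 1) * ∑ m ∈ Finset.Ico 1 n, attachProb w v m ≤ harm n v / (1 - δ) := by
    calc _ ≤ (θ - 1) * (w v * ((θ - 1)⁻¹ / (1 - δ)) * harm n v) := by gcongr
      _ = w v * (harm n v / (1 - δ)) := by field_simp
      _ ≤ 1 * (harm n v / (1 - δ)) := by
          gcongr
          exact h.le_one v (by omega)
      _ = _ := one_mul _
  have h3 : harm n v / (1 - δ) ≤ harm n v + 2 * δ * harm n v := by
    rw [div_le_iff₀ hδ']
    nlinarith [mul_nonneg hδ0 hh0]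
  have h4 : 2 * δ * harm n v ≤ 2 * δ * Real.log n := by
    have := harm_le_log (hN.trans hv) hvn
    gcongr
  have h5 := harm_le_log_div (hN.trans hv) hvn
  calc _ ≤ Real.exp (2 * δ * Real.log n + Real.log (n / (v - 1))) :=
        Real.exp_le_exp.2 (by linarith)
    _ = _ := by rw [Real.exp_add, Real.exp_log hpos]

lemma attachProb_le_div {w : ℕ → ℝ} (hw : ∀ i, 1 ≤ i → 0 < w i) (hw1 : ∀ i, 1 ≤ i → w i ≤ 1)
    {v m : ℕ} (hv : 1 ≤ v) (hm : 1 ≤ m) {c : ℝ} (hc : 0 < c) (hcm : c ≤ wsum w m) :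
    attachProb w v m ≤ 1 / c := by
  unfold attachProb
  split_ifs
  · have := wsum_pos hw hm
    have := hw1 v hv
    gcongr
  · positivity

lemma attachProb_le_one {w : ℕ → ℝ} (hw : ∀ i, 1 ≤ i → 0 < w i) {v : ℕ} (hv : 1 ≤ v) (m : ℕ) :
    attachProb w v m ≤ 1 := by
  unfold attachProb
  split_ifs with h
  · rw [div_le_one (wsum_pos hw (hv.trans h))]
    exact Finset.single_le_sum (f := w) (fun i hi => (hw i (Finset.mem_Icc.1 hi).1).le)
      (Finset.mem_Icc.2 ⟨hv, h⟩)
  · norm_num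

/-- Bound for the generating function of the degree of an arbitrary vertex. -/
lemma Good.prod_le {θ η ε ε' : ℝ} {n : ℕ} {w : ℕ → ℝ} (h : Good θ η ε ε' n w) (hθ : 1 < θ)
    (hε : 0 < ε) (hε' : 0 < ε') (hδ : (n : ℝ) ^ (-(η / 4)) ≤ 1 / 2)
    (hN : 2 ≤ ⌈(n : ℝ) ^ η⌉₊) (hNn : ⌈(n : ℝ) ^ η⌉₊ ≤ n) {x : ℝ} (hx1 : 1 ≤ x) (hx2 : x ≤ 2)
    {v : ℕ} (hv : 1 ≤ v) :
    ∏ m ∈ Finset.Ico 1 n, (1 + (x - 1) * attachProb w v m) ≤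
      Real.exp (ε' * Real.log n + (1 + Real.log ⌈(n : ℝ) ^ η⌉₊) / ε +
        (x - 1) * (θ - 1)⁻¹ / (1 - (n : ℝ) ^ (-(η / 4))) * Real.log n) := by
  have hθ1 : 0 < θ - 1 := by linarith
  set δ := (n : ℝ) ^ (-(η / 4)) with hδd
  set N := ⌈(n : ℝ) ^ η⌉₊ with hNd
  have hδ' : 0 < 1 - δ := by linarith
  have hlog : 0 ≤ Real.log n := Real.log_nonneg (by exact_mod_cast (by omega : 1 ≤ n))
  have hreg := h.regular
  have hx0 : 0 ≤ x - 1 := by linarith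
  -- Three regimes of attachment times. For `m < ε' log n` nothing is known about the partial sums,
  -- and each factor is at most `2 ≤ e`. Up to the cutoff the crude bound `S_m ≥ ε m` is used, and
  -- beyond it the law of large numbers. Overlaps are harmless since all three terms are
  -- nonnegative.
  set b₁ : ℕ → ℝ := fun m => if (m : ℝ) < ε' * Real.log n then 1 else 0 with hb₁
  set b₂ : ℕ → ℝ := fun m => if m < N then ε⁻¹ * (m : ℝ)⁻¹ else 0 with hb₂
  set b₃ : ℕ → ℝ := fun m => if N ≤ m then (x - 1) * (θ - 1)⁻¹ / (1 - δ) * (m : ℝ)⁻¹ else 0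
    with hb₃
  have h1 : ∀ m, 0 ≤ b₁ m := fun m => by simp only [hb₁]; split_ifs <;> norm_num
  have h2 : ∀ m, 0 ≤ b₂ m := fun m => by simp only [hb₂]; split_ifs <;> positivity
  have h3 : ∀ m, 0 ≤ b₃ m := fun m => by simp only [hb₃]; split_ifs <;> positivity
  have hfac : ∀ m ∈ Finset.Ico 1 n, 1 + (x - 1) * attachProb w v m ≤
      Real.exp (b₁ m + b₂ m + b₃ m) := by
    intro m hm
    rw [Finset.mem_Ico] at hm
    have hm0 : (0 : ℝ) < m := by exact_mod_cast (by omega : 0 < m)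
    have hp0 := attachProb_nonneg h.pos hv m
    by_cases hc1 : (m : ℝ) < ε' * Real.log n
    · have : 1 + (x - 1) * attachProb w v m ≤ 2 := by
        have := attachProb_le_one h.pos hv m
        nlinarith
      refine this.trans ?_
      have h4 : (1 : ℝ) ≤ b₁ m + b₂ m + b₃ m := by
        have : b₁ m = 1 := if_pos hc1
        linarith [h2 m, h3 m]
      have := Real.add_one_le_exp (b₁ m + b₂ m + b₃ m)
      linarith
    · have hkey : (x - 1) * attachProb w v m ≤ b₁ m + b₂ m + b₃ m := by
        by_cases hc2 : m < N
        · have hcr := h.crude m (by omega) (not_lt.1 hc1)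
          have := attachProb_le_div h.pos h.le_one hv hm.1 (by positivity) hcr
          have h4 : (x - 1) * attachProb w v m ≤ 1 * (1 / (ε * m)) := by
            gcongr
            linarith
          have h5 : b₂ m = ε⁻¹ * (m : ℝ)⁻¹ := if_pos hc2
          have h6 : 1 * (1 / (ε * m)) = ε⁻¹ * (m : ℝ)⁻¹ := by field_simp
          linarith [h1 m, h3 m]
        · have hlo := hreg.lower m (by omega) (by omega)
          have := attachProb_le_div h.pos h.le_one hv hm.1 (by positivity) hlo
          have h4 : (x - 1) * attachProb w v m ≤ (x - 1) * (1 / ((θ - 1) * m * (1 - δ))) := by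
            gcongr
          have h5 : b₃ m = (x - 1) * (θ - 1)⁻¹ / (1 - δ) * (m : ℝ)⁻¹ := if_pos (not_lt.1 hc2)
          have h6 : (x - 1) * (1 / ((θ - 1) * m * (1 - δ))) =
              (x - 1) * (θ - 1)⁻¹ / (1 - δ) * (m : ℝ)⁻¹ := by field_simp
          linarith [h1 m, h2 m]
      have := Real.add_one_le_exp (b₁ m + b₂ m + b₃ m)
      linarith
  have hs1 : ∑ m ∈ Finset.Ico 1 n, b₁ m ≤ ε' * Real.log n := by
    simp only [hb₁]
    rw [← Finset.sum_filter, Finset.sum_const, nsmul_eq_mul, mul_one]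
    have hsub : (Finset.Ico 1 n).filter (fun m : ℕ => (m : ℝ) < ε' * Real.log n) ⊆
        Finset.Icc 1 ⌊ε' * Real.log n⌋₊ := by
      intro m hm
      rw [Finset.mem_filter, Finset.mem_Ico] at hm
      exact Finset.mem_Icc.2 ⟨hm.1.1, Nat.le_floor hm.2.le⟩
    have := Finset.card_le_card hsub
    rw [Nat.card_Icc, Nat.add_sub_cancel] at this
    calc _ ≤ ((⌊ε' * Real.log n⌋₊ : ℕ) : ℝ) := by exact_mod_cast this
      _ ≤ _ := Nat.floor_le (by positivity)
  have hs2 : ∑ m ∈ Finset.Ico 1 n, b₂ m ≤ (1 + Real.log N) / ε := by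
    simp only [hb₂]
    rw [← Finset.sum_filter, ← Finset.mul_sum]
    have hsub : (Finset.Ico 1 n).filter (fun m : ℕ => m < N) ⊆ Finset.Ico 1 N := by
      intro m hm
      rw [Finset.mem_filter, Finset.mem_Ico] at hm
      exact Finset.mem_Ico.2 ⟨hm.1.1, hm.2⟩
    have h4 : ∑ m ∈ (Finset.Ico 1 n).filter (fun m : ℕ => m < N), (m : ℝ)⁻¹ ≤ 1 + Real.log N := by
      refine (Finset.sum_le_sum_of_subset_of_nonneg hsub fun m _ _ => by positivity).trans ?_
      rw [Finset.sum_eq_sum_Ico_succ_bot (by omega)]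
      have := harm_le_log (n := N) (v := 2) le_rfl hN
      unfold harm at this
      simp only [Nat.cast_one, inv_one]
      linarith
    calc _ ≤ ε⁻¹ * (1 + Real.log N) := by gcongr
      _ = _ := by field_simp
  have hs3 : ∑ m ∈ Finset.Ico 1 n, b₃ m ≤ (x - 1) * (θ - 1)⁻¹ / (1 - δ) * Real.log n := by
    simp only [hb₃]
    rw [← Finset.sum_filter, ← Finset.mul_sum]
    have hsub : (Finset.Ico 1 n).filter (fun m : ℕ => N ≤ m) ⊆ Finset.Ico N n := by
      intro m hm
      rw [Finset.mem_filter, Finset.mem_Ico] at hm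
      exact Finset.mem_Ico.2 ⟨hm.2, hm.1.2⟩
    have h4 : ∑ m ∈ (Finset.Ico 1 n).filter (fun m : ℕ => N ≤ m), (m : ℝ)⁻¹ ≤ Real.log n :=
      (Finset.sum_le_sum_of_subset_of_nonneg hsub fun m _ _ => by positivity).trans
        (harm_le_log hN hNn)
    gcongr
  calc _ ≤ ∏ m ∈ Finset.Ico 1 n, Real.exp (b₁ m + b₂ m + b₃ m) :=
        Finset.prod_le_prod (fun m _ => add_nonneg zero_le_one
          (mul_nonneg hx0 (attachProb_nonneg h.pos hv m))) hfac
    _ = Real.exp (∑ m ∈ Finset.Ico 1 n, b₁ m + ∑ m ∈ Finset.Ico 1 n, b₂ m +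
          ∑ m ∈ Finset.Ico 1 n, b₃ m) := by
        rw [← Real.exp_sum, Finset.sum_add_distrib, Finset.sum_add_distrib]
    _ ≤ _ := Real.exp_le_exp.2 (by linarith)

/-- Exponential Markov inequality for the joint degrees. -/
lemma pathSum_ge_le {ι : Type*} [Fintype ι] [DecidableEq ι] {w : ℕ → ℝ}
    (hw : ∀ i, 1 ≤ i → 0 < w i) {v : ι → ℕ} (hv : Function.Injective v) (hv1 : ∀ l, 1 ≤ v l)
    {x : ι → ℝ} (hx : ∀ l, 1 ≤ x l) {n : ℕ} (hn : 1 ≤ n) (d : ι → ℕ)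
    {f : (ℕ → ℕ) → ℝ} (hf1 : ∀ a, f a ≤ 1) (hf0 : ∀ a, (∃ l, deg a n (v l) < d l) → f a ≤ 0) :
    pathSum w (n - 1) f ≤
      ∏ l, ((x l ^ d l)⁻¹ * ∏ m ∈ Finset.Ico 1 n, (1 + (x l - 1) * attachProb w (v l) m)) := by
  have hx0 : ∀ l, 0 < x l := fun l => zero_lt_one.trans_le (hx l)
  have h1 := pathSum_prod_pow_le hw hv hv1 hx (n - 1)
  rw [Nat.sub_add_cancel hn] at h1
  have h2 : pathSum w (n - 1) f ≤ pathSum w (n - 1) (fun a => (∏ l, (x l ^ d l)⁻¹) *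
      ∏ l, x l ^ deg a n (v l)) := by
    refine pathSum_mono hw fun a => ?_
    have hnn : 0 ≤ (∏ l, (x l ^ d l)⁻¹) * ∏ l, x l ^ deg a n (v l) :=
      mul_nonneg (Finset.prod_nonneg fun l _ => by have := hx0 l; positivity)
        (Finset.prod_nonneg fun l _ => by have := hx0 l; positivity)
    by_cases h : ∃ l, deg a n (v l) < d l
    · exact (hf0 a h).trans hnn
    · push Not at h
      refine (hf1 a).trans ?_
      rw [← Finset.prod_mul_distrib]
      refine le_of_eq_of_le (Finset.prod_const_one (s := Finset.univ)).symm
        (Finset.prod_le_prod (fun _ _ => zero_le_one) fun l _ => ?_)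
      have := hx0 l
      rw [inv_mul_eq_div, one_le_div (by positivity)]
      exact pow_le_pow_right₀ (hx l) (h l)
  rw [pathSum_const_mul] at h2
  refine h2.trans ?_
  rw [Finset.prod_mul_distrib]
  refine mul_le_mul_of_nonneg_left h1 (Finset.prod_nonneg fun l _ => ?_)
  have := hx0 l
  positivity

end Chernoff

/-! ### Vanishing error terms and the label cutoff `n^η` -/

lemma tendsto_rpow_neg_mul_log_pow {r : ℝ} (hr : 0 < r) (k : ℕ) :
    Tendsto (fun n : ℕ => (n : ℝ) ^ (-r) * Real.log n ^ k) atTop (𝓝 0) := by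
  have h := (isLittleO_log_rpow_rpow_atTop (k : ℝ) hr).tendsto_div_nhds_zero
  have h2 := h.comp (tendsto_natCast_atTop_atTop (R := ℝ))
  refine h2.congr fun n => ?_
  simp only [Function.comp, Real.rpow_natCast]
  rw [Real.rpow_neg (Nat.cast_nonneg n), div_eq_inv_mul]

lemma tendsto_rpow_neg {r : ℝ} (hr : 0 < r) :
    Tendsto (fun n : ℕ => (n : ℝ) ^ (-r)) atTop (𝓝 0) := by
  simpa using tendsto_rpow_neg_mul_log_pow hr 0

lemma tendsto_of_mul_log {δ : ℕ → ℝ}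
    (hδ : Tendsto (fun n => δ n * Real.log n) atTop (𝓝 0)) : Tendsto δ atTop (𝓝 0) := by
  have := hδ.mul (tendsto_inv_atTop_zero.comp tendsto_log_natCast_atTop)
  rw [zero_mul] at this
  refine this.congr' ?_
  filter_upwards [tendsto_log_natCast_atTop.eventually_gt_atTop 0] with n hn
  simp only [Function.comp]
  field_simp

section Constants

variable {δ σ : ℕ → ℝ} {θ : ℝ}

lemma tendsto_const_rate (hθ : 1 < θ) :
    Tendsto (fun n : ℕ => ((θ - 1)⁻¹ * (θ - 1) - 1) * Real.log n) atTop (𝓝 0) := by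
  have : (θ - 1)⁻¹ * (θ - 1) - 1 = 0 := by
    rw [inv_mul_cancel₀ (by linarith), sub_self]
  simp [this]

lemma tendsto_perturbed_rate (hθ : 1 < θ)
    (hδ : Tendsto (fun n => δ n * Real.log n) atTop (𝓝 0))
    (hσ : Tendsto (fun n => σ n * Real.log n) atTop (𝓝 0)) :
    Tendsto (fun n : ℕ => ((θ - 1)⁻¹ / ((1 - δ n) * (1 - σ n)) * (θ - 1) - 1) * Real.log n)
      atTop (𝓝 0) := by
  have hθ1 : θ - 1 ≠ 0 := by linarith
  have hδ0 := tendsto_of_mul_log hδ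
  have hσ0 := tendsto_of_mul_log hσ
  have h1 : Tendsto (fun n => (δ n * Real.log n + σ n * Real.log n - δ n * (σ n * Real.log n)) /
      ((1 - δ n) * (1 - σ n))) atTop (𝓝 ((0 + 0 - 0 * 0) / ((1 - 0) * (1 - 0)))) :=
    ((hδ.add hσ).sub (hδ0.mul hσ)).div ((hδ0.const_sub 1).mul (hσ0.const_sub 1)) (by norm_num)
  simp only [mul_zero, add_zero, sub_zero, zero_div] at h1
  refine h1.congr' ?_
  filter_upwards [hδ0.eventually_lt_const (u := 1) one_pos,
    hσ0.eventually_lt_const (u := 1) one_pos] with n h2 h3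
  have : 1 - δ n ≠ 0 := by linarith
  have : 1 - σ n ≠ 0 := by linarith
  field_simp
  ring

lemma tendsto_upper_const (hθ : 1 < θ) (c : ℝ)
    (hδ : Tendsto (fun n => δ n * Real.log n) atTop (𝓝 0))
    (hσ : Tendsto (fun n => σ n * Real.log n) atTop (𝓝 0)) :
    Tendsto (fun n : ℕ => Real.exp (c * (((θ - 1)⁻¹ / ((1 - δ n) * (1 - σ n)) -
      (θ - 1)⁻¹ / (1 + δ n)) * Real.log n))) atTop (𝓝 1) := by
  have hθ1 : θ - 1 ≠ 0 := by linarith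
  have hδ0 := tendsto_of_mul_log hδ
  have h1 := tendsto_perturbed_rate hθ hδ hσ
  have h2 : Tendsto (fun n => c * ((θ - 1)⁻¹ * (((θ - 1)⁻¹ / ((1 - δ n) * (1 - σ n)) * (θ - 1) - 1) *
      Real.log n + δ n * Real.log n / (1 + δ n)))) atTop
      (𝓝 (c * ((θ - 1)⁻¹ * (0 + 0 / (1 + 0))))) :=
    ((h1.add (hδ.div (hδ0.const_add 1) (by norm_num))).const_mul _).const_mul c
  simp only [add_zero, zero_div, mul_zero] at h2
  have h3 := (Real.continuous_exp.tendsto 0).comp h2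
  rw [Real.exp_zero] at h3
  refine h3.congr' ?_
  filter_upwards [hδ0.eventually_const_lt (u := -1) (by norm_num)] with n h4
  have : 1 + δ n ≠ 0 := by linarith
  simp only [Function.comp]
  congr 2
  generalize (1 - δ n) * (1 - σ n) = y
  -- Division by zero yields zero, and the identity survives in this degenerate case.
  by_cases hy : y = 0
  · subst hy
    field_simp
    simp
  field_simp
  ring

/-- The bound `q log n` on the total degree enters twice in front of `σ`, hence the stronger
requirement `σ log² n → 0`. -/
lemma tendsto_lower_const (hθ : 1 < θ) (c q : ℝ)
    (hδ : Tendsto (fun n => δ n * Real.log n) atTop (𝓝 0))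
    (hσ : Tendsto (fun n => σ n * Real.log n ^ 2) atTop (𝓝 0)) :
    Tendsto (fun n : ℕ => Real.exp (-(c * (((θ - 1)⁻¹ / ((1 - δ n) * (1 - σ n)) -
      (θ - 1)⁻¹) * Real.log n))) *
      (1 - q * Real.log n * (δ n + q * Real.log n * σ n * (θ - 1)))) atTop (𝓝 1) := by
  have hθ1 : θ - 1 ≠ 0 := by linarith
  have hσ1 : Tendsto (fun n => σ n * Real.log n) atTop (𝓝 0) := by
    have := hσ.mul (tendsto_inv_atTop_zero.comp tendsto_log_natCast_atTop)
    rw [zero_mul] at this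
    refine this.congr' ?_
    filter_upwards [tendsto_log_natCast_atTop.eventually_gt_atTop 0] with n hn
    simp only [Function.comp]
    field_simp
  have h1 := tendsto_perturbed_rate hθ hδ hσ1
  have h2 := (h1.const_mul (-(c * (θ - 1)⁻¹)))
  rw [mul_zero] at h2
  have h3 := (Real.continuous_exp.tendsto 0).comp h2
  have h4 : Tendsto (fun n => 1 - (q * (δ n * Real.log n) +
      q ^ 2 * (θ - 1) * (σ n * Real.log n ^ 2))) atTop
      (𝓝 (1 - (q * 0 + q ^ 2 * (θ - 1) * 0))) :=
    ((hδ.const_mul q).add (hσ.const_mul _)).const_sub 1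
  have h5 := h3.mul h4
  simp only [Real.exp_zero, mul_zero, add_zero, sub_zero, mul_one] at h5
  refine h5.congr fun n => ?_
  simp only [Function.comp]
  congr 1
  · congr 1
    generalize (θ - 1)⁻¹ / ((1 - δ n) * (1 - σ n)) = y
    field_simp
  · ring

end Constants

section Cutoff

variable {η : ℝ}

lemma tendsto_cutoff_inv_mul_log_pow (hη : 0 < η) (C : ℝ) (k : ℕ) :
    Tendsto (fun n : ℕ => C / ⌈(n : ℝ) ^ η⌉₊ * Real.log n ^ k) atTop (𝓝 0) := by
  have h := (tendsto_rpow_neg_mul_log_pow hη k).const_mul |C|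
  rw [mul_zero] at h
  refine squeeze_zero_norm' ?_ h
  filter_upwards [eventually_ge_atTop 1] with n hn
  have hn' : (0 : ℝ) < (n : ℝ) ^ η := Real.rpow_pos_of_pos (by exact_mod_cast hn) _
  have hlog : 0 ≤ Real.log n := Real.log_natCast_nonneg n
  rw [Real.norm_eq_abs, abs_mul, abs_div, abs_of_nonneg (pow_nonneg hlog k), ← mul_assoc,
    Real.rpow_neg (Nat.cast_nonneg n), ← div_eq_mul_inv, Nat.abs_cast]
  have := Nat.le_ceil ((n : ℝ) ^ η)
  gcongr

lemma tendsto_cutoff_atTop (hη : 0 < η) : Tendsto (fun n : ℕ => ⌈(n : ℝ) ^ η⌉₊) atTop atTop :=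
  tendsto_nat_ceil_atTop.comp ((tendsto_rpow_atTop hη).comp tendsto_natCast_atTop_atTop)

lemma cutoff_le_two_mul (hη : 0 < η) {n : ℕ} (hn : 1 ≤ n) :
    (⌈(n : ℝ) ^ η⌉₊ : ℝ) ≤ 2 * (n : ℝ) ^ η := by
  have h1 : 1 ≤ (n : ℝ) ^ η := Real.one_le_rpow (by exact_mod_cast hn) hη.le
  have := Nat.ceil_lt_add_one (zero_le_one.trans h1)
  linarith

lemma log_cutoff_le (hη : 0 < η) {n : ℕ} (hn : 1 ≤ n) :
    Real.log ⌈(n : ℝ) ^ η⌉₊ ≤ 1 + η * Real.log n := by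
  have hn' : (0 : ℝ) < n := by exact_mod_cast hn
  have hp : (0 : ℝ) < (n : ℝ) ^ η := Real.rpow_pos_of_pos hn' _
  have h := Real.log_le_log (by exact_mod_cast Nat.ceil_pos.2 hp) (cutoff_le_two_mul hη hn)
  rw [Real.log_mul two_ne_zero hp.ne', Real.log_rpow hn'] at h
  have := Real.log_two_lt_d9
  linarith

lemma eventually_cutoff_le (hη : 0 < η) (hη1 : η < 1) :
    ∀ᶠ n : ℕ in atTop, ⌈(n : ℝ) ^ η⌉₊ ≤ n := by
  have h := (tendsto_rpow_neg (r := 1 - η) (by linarith)).eventually_lt_const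
    (u := 1 / 2) (by norm_num)
  filter_upwards [h, eventually_ge_atTop 1] with n h1 hn
  have hn' : (0 : ℝ) < n := by exact_mod_cast hn
  have h2 : (n : ℝ) ^ η = n * (n : ℝ) ^ (-(1 - η)) := by
    rw [← Real.rpow_one_add' hn'.le (by linarith)]
    congr 1
    ring
  have := cutoff_le_two_mul hη hn
  rw [h2] at this
  have h3 : (⌈(n : ℝ) ^ η⌉₊ : ℝ) ≤ n := by
    rw [h2]
    nlinarith
  exact_mod_cast h3

/-- A vertex at rescaled position `z` has label at least `n^(1 - a b)` up to a factor `exp (O(√(log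
n)))`. The slack `1 - a b - η > 0` absorbs this factor, so such labels stay above the cutoff. -/
lemma Admissible.of_log_le {a b : ℝ} (ha : 0 ≤ a) {d : ℕ → ℕ} {D : ℕ → ℝ}
    (hd : Tendsto d atTop atTop) (hD : Tendsto D atTop atTop)
    (hdiff : Tendsto (fun n => ((d n : ℝ) - D n) / √(D n)) atTop (𝓝 0))
    (hDb : ∀ᶠ n : ℕ in atTop, D n ≤ b * Real.log n) (hη : 0 < η) (hηb : η < 1 - a * b) :
    Admissible a d D (fun n => ⌈(n : ℝ) ^ η⌉₊) where
  tendsto_degree := hd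
  tendsto_norm := hD
  tendsto_diff := hdiff
  le_log := ⟨b, hDb⟩
  tendsto_cutoff := tendsto_cutoff_atTop hη
  cutoff_le := by
    intro z
    set ν := 1 - a * b - η with hν
    have hν0 : 0 < ν := by rw [hν]; linarith
    have h1 : ∀ᶠ n : ℕ in atTop, 1 + a * |z| * √(b * Real.log n) ≤ ν * Real.log n := by
      have h2 : Tendsto (fun n : ℕ => √(Real.log n)) atTop atTop :=
        Real.tendsto_sqrt_atTop.comp tendsto_log_natCast_atTop
      filter_upwards [h2.eventually_ge_atTop 1,
        h2.eventually_ge_atTop ((1 + a * |z| * √b) / ν),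
        tendsto_log_natCast_atTop.eventually_ge_atTop 0] with n h3 h4 h5
      rw [div_le_iff₀ hν0] at h4
      rw [Real.sqrt_mul' _ h5]
      have h6 := Real.mul_self_sqrt h5
      nlinarith
    filter_upwards [h1, hDb, eventually_ge_atTop 1, hD.eventually_ge_atTop 0] with n h2 h3 hn h4
    have hn' : (0 : ℝ) < n := by exact_mod_cast hn
    have hp : (0 : ℝ) < (n : ℝ) ^ η := Real.rpow_pos_of_pos hn' _
    rw [← Real.log_le_iff_le_exp (by exact_mod_cast Nat.ceil_pos.2 hp)]
    have h5 := log_cutoff_le hη hn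
    have h6 : √(D n) ≤ √(b * Real.log n) := Real.sqrt_le_sqrt h3
    have h7 : a * √(D n) * |z| ≤ a * |z| * √(b * Real.log n) := by
      calc a * √(D n) * |z| = a * |z| * √(D n) := by ring
        _ ≤ _ := by gcongr
    have h8 : -(a * √(D n) * |z|) ≤ a * √(D n) * z := by
      have := neg_abs_le z
      have h9 : 0 ≤ a * √(D n) := by positivity
      nlinarith
    have h10 : a * D n ≤ a * (b * Real.log n) := by gcongr
    have h11 : ν * Real.log n = Real.log n - a * (b * Real.log n) - η * Real.log n := by
      rw [hν]; ring
    linarith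

end Cutoff

/-! ### Tuples with a small label are negligible -/

/-- The bound for the normalised probability that vertex `v` has degree at least `d`. -/
noncomputable def tailBound (θ x η ε ε' : ℝ) (n d v : ℕ) : ℝ :=
  if v < ⌈(n : ℝ) ^ η⌉₊ then
    θ ^ d / n * ((x ^ d)⁻¹ * Real.exp (ε' * Real.log n + (1 + Real.log ⌈(n : ℝ) ^ η⌉₊) / ε +
      (x - 1) * (θ - 1)⁻¹ / (1 - (n : ℝ) ^ (-(η / 4))) * Real.log n))
  else Real.exp (2 * (n : ℝ) ^ (-(η / 4)) * Real.log n) / (v - 1)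

section

variable {θ x η ε ε' : ℝ} {n : ℕ}

lemma tailBound_nonneg (hθ : 1 < θ) (hx : 1 ≤ x) {d v : ℕ} (hv : 1 ≤ v) :
    0 ≤ tailBound θ x η ε ε' n d v := by
  have hv' : (1 : ℝ) ≤ v := by exact_mod_cast hv
  unfold tailBound
  split_ifs
  · positivity
  · exact div_nonneg (Real.exp_pos _).le (by linarith)

/-- Exponential Markov inequality with the tilt `θ` above the cutoff, where it cancels `θ^d`
exactly, and a tilt `x` below it. For small labels the tilt `θ` would leave no negative power of
`n`. -/
lemma Good.pathSum_le_tailBound {ι : Type*} [Fintype ι] [DecidableEq ι] {w : ℕ → ℝ}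
    (h : Good θ η ε ε' n w) (hθ : 1 < θ) (hε : 0 < ε) (hε' : 0 < ε')
    (hδ : (n : ℝ) ^ (-(η / 4)) ≤ 1 / 2) (hN : 2 ≤ ⌈(n : ℝ) ^ η⌉₊) (hNn : ⌈(n : ℝ) ^ η⌉₊ ≤ n)
    (hx1 : 1 ≤ x) (hx2 : x ≤ 2) {v : ι → ℕ} (hv : Function.Injective v) (hv1 : ∀ l, 1 ≤ v l)
    (hvn : ∀ l, v l ≤ n) (d : ι → ℕ) {f : (ℕ → ℕ) → ℝ} (hf1 : ∀ a, f a ≤ 1)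
    (hf0 : ∀ a, (∃ l, deg a n (v l) < d l) → f a ≤ 0) :
    (∏ l, θ ^ d l / (n : ℝ)) * pathSum w (n - 1) f ≤
      ∏ l, tailBound θ x η ε ε' n (d l) (v l) := by
  have hn : 1 ≤ n := by omega
  have hn' : (0 : ℝ) < n := by exact_mod_cast hn
  have h1 := pathSum_ge_le h.pos hv hv1
    (x := fun l => if v l < ⌈(n : ℝ) ^ η⌉₊ then x else θ)
    (fun l => by split_ifs; exacts [hx1, hθ.le]) hn d hf1 hf0
  have h2 : (0 : ℝ) ≤ ∏ l, θ ^ d l / (n : ℝ) :=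
    Finset.prod_nonneg fun l _ => by positivity
  refine (mul_le_mul_of_nonneg_left h1 h2).trans ?_
  rw [← Finset.prod_mul_distrib]
  refine Finset.prod_le_prod (fun l _ => ?_) fun l _ => ?_
  · refine mul_nonneg (by positivity) (mul_nonneg ?_ ?_)
    · split_ifs <;> positivity
    · refine Finset.prod_nonneg fun m _ => add_nonneg zero_le_one
        (mul_nonneg ?_ (attachProb_nonneg h.pos (hv1 l) m))
      split_ifs <;> linarith
  · unfold tailBound
    by_cases hl : v l < ⌈(n : ℝ) ^ η⌉₊
    · simp only [if_pos hl]
      have := h.prod_le hθ hε hε' hδ hN hNn hx1 hx2 (hv1 l)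
      gcongr
    · simp only [if_neg hl]
      have := h.regular.prod_le hθ (by positivity) hδ hN (not_lt.1 hl) (hvn l)
      calc _ ≤ θ ^ d l / n * ((θ ^ d l)⁻¹ *
            (Real.exp (2 * (n : ℝ) ^ (-(η / 4)) * Real.log n) * (n / (v l - 1)))) := by gcongr
        _ = _ := by
          field_simp

/-- There are at most `2 n^η` labels below the cutoff, and the exponent of `n` in each contribution
is, up to `o(1)`, the remainder of the expression in `hexp`. The rate `r` is half of the resulting
negative exponent, the other half covering the `o(1)`. -/
lemma eventually_sum_tailBound_small_le {b : ℝ} (hθ : 1 < θ) (hη : 0 < η) (hε : 0 < ε)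
    (hx1 : 1 ≤ x) (hxθ : x ≤ θ)
    (hexp : η + b * Real.log (θ / x) - 1 + ε' + η / ε + (x - 1) * (θ - 1)⁻¹ < 0) :
    ∃ r > (0 : ℝ), ∀ᶠ n : ℕ in atTop, ∀ d : ℕ, (d : ℝ) ≤ b * Real.log n →
      ∑ v ∈ Finset.Icc 1 n with v < ⌈(n : ℝ) ^ η⌉₊, tailBound θ x η ε ε' n d v ≤
        2 * Real.exp (2 / ε) * (n : ℝ) ^ (-r) := by
  set E := η + b * Real.log (θ / x) - 1 + ε' + η / ε + (x - 1) * (θ - 1)⁻¹ with hE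
  have hlim : Tendsto (fun n : ℕ => η + b * Real.log (θ / x) - 1 + ε' + η / ε +
      (x - 1) * (θ - 1)⁻¹ / (1 - (n : ℝ) ^ (-(η / 4)))) atTop (𝓝 E) := by
    have h1 := (tendsto_rpow_neg (r := η / 4) (by linarith)).const_sub 1
    rw [sub_zero] at h1
    have h2 := (tendsto_const_nhds (x := (x - 1) * (θ - 1)⁻¹)).div h1 one_ne_zero
    rw [div_one] at h2
    exact h2.const_add _
  refine ⟨-(E / 2), by linarith, ?_⟩
  filter_upwards [hlim.eventually_lt_const (show E < E / 2 by linarith), eventually_ge_atTop 1]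
    with n hlt hn d hd
  have hn' : (0 : ℝ) < n := by exact_mod_cast hn
  have hlog : 0 ≤ Real.log n := Real.log_natCast_nonneg n
  have hx0 : 0 < x := by linarith
  have hθ0 : 0 < θ := by linarith
  set N := ⌈(n : ℝ) ^ η⌉₊ with hNdef
  have hNle := log_cutoff_le hη hn
  rw [← hNdef] at hNle
  set T := θ ^ d / n * ((x ^ d)⁻¹ * Real.exp (ε' * Real.log n + (1 + Real.log N) / ε +
      (x - 1) * (θ - 1)⁻¹ / (1 - (n : ℝ) ^ (-(η / 4))) * Real.log n)) with hTdef
  have hT0 : 0 ≤ T := by positivity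
  have h1 : ∑ v ∈ Finset.Icc 1 n with v < N, tailBound θ x η ε ε' n d v ≤ N * T := by
    have h2 : ∑ v ∈ Finset.Icc 1 n with v < N, tailBound θ x η ε ε' n d v =
        ∑ v ∈ Finset.Icc 1 n with v < N, T :=
      Finset.sum_congr rfl fun v hv => by
        rw [Finset.mem_filter] at hv
        rw [tailBound, if_pos hv.2]
    rw [h2, Finset.sum_const, nsmul_eq_mul]
    gcongr
    refine (Finset.card_le_card (t := Finset.Ico 1 N) fun v hv => ?_).trans ?_
    · simp only [Finset.mem_filter, Finset.mem_Icc, Finset.mem_Ico] at hv ⊢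
      omega
    · simp
  refine h1.trans ?_
  have h3 : T ≤ Real.exp (b * Real.log (θ / x) * Real.log n) * Real.exp (-Real.log n) *
      Real.exp (ε' * Real.log n + (2 + η * Real.log n) / ε +
      (x - 1) * (θ - 1)⁻¹ / (1 - (n : ℝ) ^ (-(η / 4))) * Real.log n) := by
    have h4 : T = (θ / x) ^ d * (n : ℝ)⁻¹ * Real.exp (ε' * Real.log n + (1 + Real.log N) / ε +
      (x - 1) * (θ - 1)⁻¹ / (1 - (n : ℝ) ^ (-(η / 4))) * Real.log n) := by
      rw [hTdef, div_pow]
      field_simp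
    rw [h4, Real.exp_neg, Real.exp_log hn']
    have h5 : (θ / x) ^ d ≤ Real.exp (b * Real.log (θ / x) * Real.log n) := by
      have hq : 0 < θ / x := by positivity
      rw [← Real.log_le_iff_le_exp (by positivity), Real.log_pow]
      have : 0 ≤ Real.log (θ / x) := Real.log_nonneg ((one_le_div hx0).2 hxθ)
      nlinarith
    have h6 : (1 + Real.log N) / ε ≤ (2 + η * Real.log n) / ε :=
      div_le_div_of_nonneg_right (by linarith) hε.le
    refine mul_le_mul (mul_le_mul_of_nonneg_right h5 (by positivity))
      (Real.exp_le_exp.2 (by linarith)) (Real.exp_pos _).le (by positivity)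
  calc N * T ≤ 2 * (n : ℝ) ^ η * (Real.exp (b * Real.log (θ / x) * Real.log n) *
        Real.exp (-Real.log n) *
        Real.exp (ε' * Real.log n + (2 + η * Real.log n) / ε +
        (x - 1) * (θ - 1)⁻¹ / (1 - (n : ℝ) ^ (-(η / 4))) * Real.log n)) :=
        mul_le_mul (cutoff_le_two_mul hη hn) h3 hT0 (by positivity)
    _ = 2 * Real.exp (2 / ε) * Real.exp (Real.log n * (η + b * Real.log (θ / x) - 1 + ε' + η / ε +
      (x - 1) * (θ - 1)⁻¹ / (1 - (n : ℝ) ^ (-(η / 4))))) := by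
        rw [Real.rpow_def_of_pos hn', ← Real.exp_add, ← Real.exp_add, mul_assoc 2, mul_assoc 2,
          ← Real.exp_add, ← Real.exp_add]
        congr 2
        ring
    _ ≤ _ := by
        rw [neg_neg, Real.rpow_def_of_pos hn' (E / 2)]
        exact mul_le_mul_of_nonneg_left (Real.exp_le_exp.2
          (mul_le_mul_of_nonneg_left hlt.le hlog)) (by positivity)

/-- Labels below the cutoff contribute at most one, and the others a harmonic sum of order `log n`.
The logarithm is harmless, being multiplied by a negative power of `n` in the next lemma. -/
lemma eventually_sum_tailBound_le {b : ℝ} (hθ : 1 < θ) (hη : 0 < η) (hε : 0 < ε)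
    (hx1 : 1 ≤ x) (hxθ : x ≤ θ)
    (hexp : η + b * Real.log (θ / x) - 1 + ε' + η / ε + (x - 1) * (θ - 1)⁻¹ < 0) :
    ∀ᶠ n : ℕ in atTop, ∀ d : ℕ, (d : ℝ) ≤ b * Real.log n →
      ∑ v ∈ Finset.Icc 1 n, tailBound θ x η ε ε' n d v ≤ 8 * Real.log n := by
  obtain ⟨r, hr, hev⟩ := eventually_sum_tailBound_small_le hθ hη hε hx1 hxθ hexp
  have hδ := (tendsto_rpow_neg_mul_log_pow (r := η / 4) (by linarith) 1).eventually_lt_const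
    (u := 1 / 4) (by norm_num)
  have hsmall := ((tendsto_rpow_neg hr).const_mul (2 * Real.exp (2 / ε)))
  rw [mul_zero] at hsmall
  filter_upwards [hev, hδ, hsmall.eventually_lt_const one_pos,
    (tendsto_cutoff_atTop hη).eventually_ge_atTop 2, eventually_ge_atTop 2,
    tendsto_log_natCast_atTop.eventually_ge_atTop 1] with n h1 h2 h3 hN hn hlog d hd
  rw [pow_one] at h2
  rw [← Finset.sum_filter_add_sum_filter_not _ (fun v => v < ⌈(n : ℝ) ^ η⌉₊)]
  have h4 := h1 d hd
  have h5 : ∑ v ∈ Finset.Icc 1 n with ¬ v < ⌈(n : ℝ) ^ η⌉₊, tailBound θ x η ε ε' n d v ≤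
      2 * (1 + Real.log n) := by
    have h6 : Real.exp (2 * (n : ℝ) ^ (-(η / 4)) * Real.log n) ≤ 2 := by
      rw [← Real.le_log_iff_exp_le two_pos]
      have := Real.log_two_gt_d9
      nlinarith
    calc ∑ v ∈ Finset.Icc 1 n with ¬ v < ⌈(n : ℝ) ^ η⌉₊, tailBound θ x η ε ε' n d v
        ≤ ∑ v ∈ Finset.Icc 1 n with ¬ v < ⌈(n : ℝ) ^ η⌉₊, 2 * ((v : ℝ) - 1)⁻¹ := by
          refine Finset.sum_le_sum fun v hv => ?_
          rw [Finset.mem_filter] at hv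
          rw [tailBound, if_neg hv.2, div_eq_mul_inv]
          have h7 : (1 : ℝ) ≤ v := by exact_mod_cast (Finset.mem_Icc.1 hv.1).1
          have : 0 ≤ ((v : ℝ) - 1)⁻¹ := inv_nonneg.2 (by linarith)
          gcongr
      _ ≤ ∑ v ∈ Finset.Icc 2 n, 2 * ((v : ℝ) - 1)⁻¹ := by
          refine Finset.sum_le_sum_of_subset_of_nonneg (fun v hv => ?_) fun v hv _ => ?_
          · simp only [Finset.mem_filter, Finset.mem_Icc] at hv ⊢
            omega
          · have h7 : (2 : ℝ) ≤ v := by exact_mod_cast (Finset.mem_Icc.1 hv).1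
            have : 0 ≤ ((v : ℝ) - 1)⁻¹ := inv_nonneg.2 (by linarith)
            positivity
      _ = 2 * harm n 1 := by
          rw [harm, Finset.mul_sum]
          refine (Finset.sum_bij (fun m _ => m + 1) (fun m hm => ?_) (fun _ _ _ _ h => by
            simpa using h) (fun v hv => ?_) fun m _ => ?_).symm
          · simp only [Finset.mem_Ico, Finset.mem_Icc] at hm ⊢
            omega
          · simp only [Finset.mem_Ico, Finset.mem_Icc] at hv ⊢
            exact ⟨v - 1, by omega, by omega⟩
          · push_cast
            rw [add_sub_cancel_right]
      _ ≤ 2 * (1 + Real.log n) := by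
          have h8 := harm_le_log (n := n) (v := 2) le_rfl hn
          have h9 : harm n 1 = 1 + harm n 2 := by
            rw [harm, Finset.sum_eq_sum_Ico_succ_bot (by omega)]
            simp [harm]
          linarith
  linarith

lemma tendsto_sum_prod_tailBound {ι : Type*} [Fintype ι] [DecidableEq ι] {b : ℝ} (hθ : 1 < θ)
    (hη : 0 < η) (hε : 0 < ε) (hx1 : 1 ≤ x) (hxθ : x ≤ θ)
    (hexp : η + b * Real.log (θ / x) - 1 + ε' + η / ε + (x - 1) * (θ - 1)⁻¹ < 0)
    {d : ι → ℕ → ℕ} (hd : ∀ l, ∀ᶠ n : ℕ in atTop, (d l n : ℝ) ≤ b * Real.log n) :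
    Tendsto (fun n : ℕ => ∑ v ∈ Fintype.piFinset (fun _ : ι => Finset.Icc 1 n) with
      ∃ l, v l < ⌈(n : ℝ) ^ η⌉₊, ∏ l, tailBound θ x η ε ε' n (d l n) (v l)) atTop (𝓝 0) := by
  obtain ⟨r, hr, hev⟩ := eventually_sum_tailBound_small_le hθ hη hε hx1 hxθ hexp
  have hev2 := eventually_sum_tailBound_le hθ hη hε hx1 hxθ hexp
  have hlim : Tendsto (fun n : ℕ => ∑ _l₀ : ι, 2 * Real.exp (2 / ε) *
      8 ^ (Fintype.card ι - 1) * ((n : ℝ) ^ (-r) * Real.log n ^ (Fintype.card ι - 1)))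
      atTop (𝓝 0) := by
    have := tendsto_finsetSum (Finset.univ : Finset ι) fun l _ =>
      (tendsto_rpow_neg_mul_log_pow hr (Fintype.card ι - 1)).const_mul
        (2 * Real.exp (2 / ε) * 8 ^ (Fintype.card ι - 1))
    simpa using this
  have hnn : ∀ n (d : ℕ), ∀ v ∈ Finset.Icc 1 n, 0 ≤ tailBound θ x η ε ε' n d v := fun n d v hv =>
    tailBound_nonneg hθ hx1 (Finset.mem_Icc.1 hv).1
  refine squeeze_zero' (.of_forall fun n => ?_) ?_ hlim
  · refine Finset.sum_nonneg fun v hv => Finset.prod_nonneg fun l _ => ?_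
    exact hnn _ _ _ (Fintype.mem_piFinset.1 (Finset.mem_filter.1 hv).1 l)
  · filter_upwards [hev, hev2, eventually_all.2 hd] with n h1 h2 h3
    refine (sum_exists_le (F := fun l v => tailBound θ x η ε ε' n (d l n) v)
      (fun l v hv => hnn n _ v hv) _).trans ?_
    refine Finset.sum_le_sum fun l₀ _ => ?_
    have h4 : ∏ l ∈ Finset.univ.erase l₀, ∑ v ∈ Finset.Icc 1 n, tailBound θ x η ε ε' n (d l n) v ≤
        ∏ _l ∈ Finset.univ.erase l₀, 8 * Real.log n :=
      Finset.prod_le_prod (fun l _ => Finset.sum_nonneg fun v hv => hnn n _ v hv)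
        fun l _ => h2 _ (h3 l)
    rw [Finset.prod_const, Finset.card_erase_of_mem (Finset.mem_univ _), Finset.card_univ,
      mul_pow] at h4
    refine (mul_le_mul (h1 _ (h3 l₀)) h4 (Finset.prod_nonneg fun l _ =>
      Finset.sum_nonneg fun v hv => hnn n _ v hv) (by positivity)).trans (le_of_eq ?_)
    ring

end

/-- The choice of the exponential tilt. -/
lemma exists_tilt {θ b : ℝ} (hθ : 1 < θ) (hb : b < θ / (θ - 1)) :
    ∃ x, 1 ≤ x ∧ x < θ ∧ b * Real.log (θ / x) - 1 + (x - 1) * (θ - 1)⁻¹ < 0 := by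
  have hθ1 : 0 < θ - 1 := by linarith
  -- The exponent vanishes at `x = θ`, with derivative `1 / (θ - 1) - b / θ`, positive precisely for
  -- `b < θ / (θ - 1)`; so some `x < θ` makes it negative. For `x > b (θ - 1)` the inequality `log
  -- (θ / x) ≤ (θ - x) / x` makes this explicit.
  have h1 : max 1 (b * (θ - 1)) < θ := max_lt hθ ((lt_div_iff₀ hθ1).1 hb)
  obtain ⟨x, hx1, hx2⟩ := exists_between h1
  have hx1' : 1 < x := (le_max_left _ _).trans_lt hx1
  have hx3 : b * (θ - 1) < x := (le_max_right _ _).trans_lt hx1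
  refine ⟨x, hx1'.le, hx2, ?_⟩
  have hx0 : 0 < x := by linarith
  have hlog0 : 0 < Real.log (θ / x) := Real.log_pos ((one_lt_div hx0).2 hx2)
  have hlog : Real.log (θ / x) ≤ (θ - x) / x := by
    have := Real.log_le_sub_one_of_pos (show 0 < θ / x by positivity)
    rw [sub_div, div_self hx0.ne']
    exact this
  have h2 : b * Real.log (θ / x) < x * (θ - 1)⁻¹ * Real.log (θ / x) := by
    rw [← div_eq_mul_inv]
    exact mul_lt_mul_of_pos_right ((lt_div_iff₀ hθ1).2 hx3) hlog0
  have h3 : x * (θ - 1)⁻¹ * Real.log (θ / x) ≤ (θ - x) * (θ - 1)⁻¹ := by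
    have hi : 0 < (θ - 1)⁻¹ := by positivity
    calc _ ≤ x * (θ - 1)⁻¹ * ((θ - x) / x) := by gcongr
      _ = _ := by field_simp
  have h4 : (θ - x) * (θ - 1)⁻¹ - 1 + (x - 1) * (θ - 1)⁻¹ = 0 := by
    field_simp
    ring
  linarith

/-! ### Expected number of tuples: the upper bound -/

/-- The indicator of `d ≤ k < d + r`. -/
def degInd (d r k : ℕ) : ℝ := if d ≤ k ∧ k < d + r then 1 else 0

lemma degInd_nonneg (d r k : ℕ) : 0 ≤ degInd d r k := by unfold degInd; split_ifs <;> norm_num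

lemma degInd_le_one (d r k : ℕ) : degInd d r k ≤ 1 := by unfold degInd; split_ifs <;> norm_num

lemma degInd_mono {d r r' k : ℕ} (h : r ≤ r') : degInd d r k ≤ degInd d r' k := by
  unfold degInd
  split_ifs with h1 h2
  · exact le_rfl
  · exact absurd ⟨h1.1, by omega⟩ h2
  · exact zero_le_one
  · exact le_rfl

lemma degInd_eq_sum (d r k : ℕ) :
    degInd d r k = ∑ s ∈ Finset.range r, if k = d + s then (1 : ℝ) else 0 := by
  unfold degInd
  by_cases h : d ≤ k ∧ k < d + r
  · rw [if_pos h, Finset.sum_eq_single (k - d)]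
    · rw [if_pos (by omega)]
    · intro s _ hs
      rw [if_neg (by omega)]
    · intro hs
      exact absurd (Finset.mem_range.2 (by omega)) hs
  · rw [if_neg h]
    refine (Finset.sum_eq_zero fun s hs => if_neg ?_).symm
    have := Finset.mem_range.1 hs
    omega

section Tuples

variable {ι : Type*} [Fintype ι] [DecidableEq ι]

/-- The number of tuples of distinct vertices whose degrees are in the windows `[d l, d l + r l)`,
weighted by a function `L` of the labels. -/
noncomputable def tupleCount (L : ι → ℕ → ℝ) (d r : ι → ℕ) (n : ℕ) (a : ℕ → ℕ) : ℝ :=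
  ∑ v ∈ Fintype.piFinset (fun _ : ι => Finset.Icc 1 n) with Function.Injective v,
    ∏ l, (L l (v l) * degInd (d l) (r l) (deg a n (v l)))

lemma deg_congr {n : ℕ} {a b : ℕ → ℕ} (h : ∀ m ∈ Finset.Ico 1 n, a m = b m) (v : ℕ) :
    deg a n v = deg b n v := by
  unfold deg
  congr 1
  exact Finset.filter_congr fun m hm => by rw [h m hm]

lemma tupleCount_congr {L : ι → ℕ → ℝ} {d r : ι → ℕ} {n : ℕ} {a b : ℕ → ℕ}
    (h : ∀ m ∈ Finset.Ico 1 n, a m = b m) : tupleCount L d r n a = tupleCount L d r n b := by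
  simp only [tupleCount, deg_congr h]

lemma tupleCount_nonneg {L : ι → ℕ → ℝ} (hL : ∀ l v, 0 ≤ L l v) (d r : ι → ℕ) (n : ℕ)
    (a : ℕ → ℕ) : 0 ≤ tupleCount L d r n a :=
  Finset.sum_nonneg fun _ _ => Finset.prod_nonneg fun l _ =>
    mul_nonneg (hL l _) (degInd_nonneg _ _ _)

lemma tupleCount_le {L : ι → ℕ → ℝ} (hL : ∀ l v, 0 ≤ L l v) (hL1 : ∀ l v, L l v ≤ 1)
    (d r : ι → ℕ) (n : ℕ) (a : ℕ → ℕ) : tupleCount L d r n a ≤ (n : ℝ) ^ Fintype.card ι := by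
  have h1 : tupleCount L d r n a ≤
      ∑ v ∈ Fintype.piFinset (fun _ : ι => Finset.Icc 1 n) with Function.Injective v, (1 : ℝ) := by
    refine Finset.sum_le_sum fun v _ => ?_
    refine Finset.prod_le_one (fun l _ => mul_nonneg (hL l _) (degInd_nonneg _ _ _)) fun l _ => ?_
    exact mul_le_one₀ (hL1 l _) (degInd_nonneg _ _ _) (degInd_le_one _ _ _)
  refine h1.trans ?_
  rw [Finset.sum_const, nsmul_eq_mul, mul_one]
  refine le_trans (Nat.cast_le.2 (Finset.card_filter_le _ _)) ?_
  simp

lemma pathSum_prod_degInd (w : ℕ → ℝ) (v : ι → ℕ) (d r : ι → ℕ) {n : ℕ} (hn : 1 ≤ n) :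
    pathSum w (n - 1) (fun a => ∏ l, degInd (d l) (r l) (deg a n (v l))) =
      ∑ s ∈ Fintype.piFinset (fun l => Finset.range (r l)),
        degProb w v (n - 1) (fun l => d l + s l) := by
  unfold degProb
  rw [Nat.sub_add_cancel hn, ← pathSum_sum]
  congr 1
  funext a
  simp_rw [degInd_eq_sum]
  rw [Finset.prod_univ_sum]
  refine Finset.sum_congr rfl fun s _ => ?_
  split_ifs with h
  · refine Finset.prod_eq_one fun l _ => if_pos (congrFun h l)
  · obtain ⟨l, hl⟩ := Function.ne_iff.1 h
    exact Finset.prod_eq_zero (Finset.mem_univ l) (if_neg hl)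

lemma pathSum_tupleCount (w : ℕ → ℝ) (L : ι → ℕ → ℝ) (d r : ι → ℕ) (n : ℕ) :
    pathSum w (n - 1) (tupleCount L d r n) =
      ∑ v ∈ Fintype.piFinset (fun _ : ι => Finset.Icc 1 n) with Function.Injective v,
        (∏ l, L l (v l)) *
          pathSum w (n - 1) (fun a => ∏ l, degInd (d l) (r l) (deg a n (v l))) := by
  simp_rw [← pathSum_const_mul]
  rw [← pathSum_sum]
  congr 1
  funext a
  simp_rw [tupleCount, Finset.prod_mul_distrib]

end Tuples

namespace IsWRT

variable {ι : Type*} [Fintype ι] [DecidableEq ι]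
variable {Ω : Type*} [mΩ : MeasurableSpace Ω] {P : Measure Ω} [IsProbabilityMeasure P]
  {W : ℕ → Ω → ℝ} {A : ℕ → Ω → ℕ} {q₀ θ : ℝ}

lemma integral_prod_weight (hT : IsWRT P W A) {v : ι → ℕ} (hv : Function.Injective v)
    (hv1 : ∀ l, 1 ≤ v l) {g : ι → ℝ → ℝ} (hg : ∀ l, Measurable (g l)) :
    ∫ ω, ∏ l, g l (W (v l) ω) ∂P = ∏ l, ∫ ω, g l (W 1 ω) ∂P := by
  have hinj : Function.Injective fun l => v l - 1 := fun l l' h => hv (by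
    have := hv1 l
    have := hv1 l'
    simp only at h
    omega)
  have h1 := hT.indep_weight.precomp hinj
  have e : ∀ l, v l - 1 + 1 = v l := fun l => Nat.sub_add_cancel (hv1 l)
  simp only [e] at h1
  rw [h1.integral_fun_prod_comp (fun l => (hT.measurable_weight _ (hv1 l)).aemeasurable)
    fun l => (hg l).aestronglyMeasurable]
  exact Finset.prod_congr rfl fun l _ =>
    ((hT.identDistrib_weight _ (hv1 l)).comp (hg l)).integral_eq

lemma integrable_prod_weight (hT : IsWRT P W A) {v : ι → ℕ} (hv1 : ∀ l, 1 ≤ v l)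
    {g : ι → ℝ → ℝ} (hg : ∀ l, Measurable (g l)) {C : ι → ℝ}
    (hg0 : ∀ l y, 0 < y → 0 ≤ g l y) (hgC : ∀ l y, 0 < y → g l y ≤ C l) :
    Integrable (fun ω => ∏ l, g l (W (v l) ω)) P := by
  refine Integrable.of_mem_Icc 0 (∏ l, C l) ?_ ?_
  · exact (Finset.measurable_prod _ fun l _ =>
      (hg l).comp (hT.measurable_weight _ (hv1 l))).aemeasurable
  · filter_upwards [hT.ae_pos] with ω h
    exact ⟨Finset.prod_nonneg fun l _ => hg0 l _ (h _ (hv1 l)),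
      Finset.prod_le_prod (fun l _ => hg0 l _ (h _ (hv1 l))) fun l _ => hgC l _ (h _ (hv1 l))⟩

lemma integrable_pois (hT : IsWRT P W A) {t : ℝ} (ht : 0 ≤ t) (k : ℕ) :
    Integrable (fun ω => pois (W 1 ω * t) k) P := by
  refine Integrable.of_mem_Icc 0 1 ?_ ?_
  · exact ((continuous_pois k).measurable.comp
      ((hT.measurable_weight 1 le_rfl).mul_const t)).aemeasurable
  · filter_upwards [hT.ae_pos] with ω h
    have : 0 ≤ W 1 ω * t := mul_nonneg (h 1 le_rfl).le ht
    exact ⟨pois_nonneg this k, pois_le_one this k⟩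

/-- The contribution of a tuple of large labels. -/
lemma sum_integral_windowSum_eq (hT : IsWRT P W A) {d : ℕ → ℕ} {D : ℕ → ℝ} {N : ℕ → ℕ} {t : ℕ → ℝ}
    {n : ℕ} (ht : 0 ≤ t n) (B : Set ℝ) (r : ℕ) :
    ∑ s ∈ Finset.range r, ∫ ω, Admissible.windowSum θ d D N t B s n (W 1 ω) ∂P =
      ∑ v ∈ Finset.Icc (N n) n, θ ^ d n / n *
        (B.indicator (1 : ℝ → ℝ) (lab (1 - θ⁻¹) n (D n) v) *
        ∫ ω, ∑ s ∈ Finset.range r, pois (W 1 ω * t n * harm n v) (d n + s) ∂P) := by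
  have hi : ∀ v k, Integrable (fun ω => pois (W 1 ω * t n * harm n v) k) P := fun v k => by
    simp_rw [mul_assoc]
    exact hT.integrable_pois (mul_nonneg ht (harm_nonneg n v)) k
  unfold Admissible.windowSum
  simp_rw [integral_const_mul]
  simp_rw [integral_finsetSum _ fun v _ => (hi v _).const_mul _]
  simp_rw [integral_finsetSum _ fun s _ => hi _ _, integral_const_mul, Finset.mul_sum]
  exact Finset.sum_comm

end IsWRT

section

variable {ι : Type*} [Fintype ι] [DecidableEq ι]

/-- Tuples with an entry below the cutoff are handled by the tail bounds, discarding the label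
weights. For the others each degree window is resolved into exact degrees, to which the Poisson
comparison applies; the sum over degree vectors is again a product. -/
lemma Good.pathSum_tupleCount_le {θ η ε ε' x : ℝ} {n : ℕ} {w : ℕ → ℝ}
    (h : Good θ η ε ε' n w) (hθ : 1 < θ) (hε : 0 < ε) (hε' : 0 < ε')
    (hδ : (n : ℝ) ^ (-(η / 4)) ≤ 1 / 2) (hN : 2 ≤ ⌈(n : ℝ) ^ η⌉₊) (hNn : ⌈(n : ℝ) ^ η⌉₊ ≤ n)
    (hx1 : 1 ≤ x) (hx2 : x ≤ 2) {σ : ℝ}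
    (hσ : Fintype.card ι * (2 * (θ - 1)⁻¹ / ⌈(n : ℝ) ^ η⌉₊) ≤ σ) (hσ1 : σ ≤ 1 / 2)
    {L : ι → ℕ → ℝ} (hL : ∀ l v, 0 ≤ L l v) (hL1 : ∀ l v, L l v ≤ 1) (d r : ι → ℕ) :
    (∏ l, θ ^ d l / (n : ℝ)) * pathSum w (n - 1) (tupleCount L d r n) ≤
      ∑ v ∈ Fintype.piFinset (fun _ : ι => Finset.Icc 1 n) with ∃ l, v l < ⌈(n : ℝ) ^ η⌉₊,
        ∏ l, tailBound θ x η ε ε' n (d l) (v l) +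
      Real.exp (Fintype.card ι * (((θ - 1)⁻¹ / ((1 - (n : ℝ) ^ (-(η / 4))) * (1 - σ)) -
        (θ - 1)⁻¹ / (1 + (n : ℝ) ^ (-(η / 4)))) * Real.log n)) *
      ∑ v ∈ Fintype.piFinset (fun _ : ι => Finset.Icc ⌈(n : ℝ) ^ η⌉₊ n) with Function.Injective v,
        (∏ l, (θ ^ d l / n * L l (v l))) * ∏ l, ∑ s ∈ Finset.range (r l),
          pois (w (v l) * ((θ - 1)⁻¹ / ((1 - (n : ℝ) ^ (-(η / 4))) * (1 - σ))) * harm n (v l))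
            (d l + s) := by
  have hn : 1 ≤ n := by omega
  set N := ⌈(n : ℝ) ^ η⌉₊ with hNdef
  have hM : (0 : ℝ) ≤ ∏ l, θ ^ d l / (n : ℝ) := Finset.prod_nonneg fun l _ => by positivity
  rw [pathSum_tupleCount, ← Finset.sum_filter_add_sum_filter_not _ (fun v => ∃ l, v l < N),
    mul_add]
  have hp0 : ∀ v : ι → ℕ, 0 ≤ pathSum w (n - 1)
      (fun a => ∏ l, degInd (d l) (r l) (deg a n (v l))) := fun v =>
    pathSum_nonneg h.pos fun a => Finset.prod_nonneg fun l _ => degInd_nonneg _ _ _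
  refine add_le_add ?_ ?_
  · rw [Finset.mul_sum]
    refine (Finset.sum_le_sum fun v hv => ?_).trans
      (Finset.sum_le_sum_of_subset_of_nonneg (s := (Finset.filter Function.Injective
        (Fintype.piFinset fun _ : ι => Finset.Icc 1 n)).filter (fun v => ∃ l, v l < N))
        (fun v hv => ?_) fun v hv _ => ?_)
    · simp only [Finset.mem_filter, Fintype.mem_piFinset, Finset.mem_Icc] at hv
      have h1 := h.pathSum_le_tailBound hθ hε hε' hδ hN hNn hx1 hx2 hv.1.2
        (fun l => (hv.1.1 l).1) (fun l => (hv.1.1 l).2) d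
        (f := fun a => ∏ l, degInd (d l) (r l) (deg a n (v l)))
        (fun a => Finset.prod_le_one (fun l _ => degInd_nonneg _ _ _)
          fun l _ => degInd_le_one _ _ _)
        (fun a ⟨l, hl⟩ => (Finset.prod_eq_zero (Finset.mem_univ l)
          (if_neg fun h => absurd h.1 (not_le.2 hl))).le)
      refine le_trans ?_ h1
      refine mul_le_mul_of_nonneg_left ?_ hM
      exact mul_le_of_le_one_left (hp0 v)
        (Finset.prod_le_one (fun l _ => hL l _) fun l _ => hL1 l _)
    · simp only [Finset.mem_filter] at hv ⊢
      exact ⟨hv.1.1, hv.2⟩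
    · simp only [Finset.mem_filter, Fintype.mem_piFinset, Finset.mem_Icc] at hv
      exact Finset.prod_nonneg fun l _ => tailBound_nonneg hθ hx1 (hv.1 l).1
  · have hset : (Finset.filter Function.Injective
        (Fintype.piFinset fun _ : ι => Finset.Icc 1 n)).filter (fun v => ¬ ∃ l, v l < N) =
        Finset.filter Function.Injective (Fintype.piFinset fun _ : ι => Finset.Icc N n) := by
      ext v
      simp only [Finset.mem_filter, Fintype.mem_piFinset, Finset.mem_Icc, not_exists, not_lt]
      constructor
      · rintro ⟨⟨h1, h2⟩, h3⟩
        exact ⟨fun l => ⟨h3 l, (h1 l).2⟩, h2⟩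
      · rintro ⟨h1, h2⟩
        exact ⟨⟨fun l => ⟨by have := (h1 l).1; omega, (h1 l).2⟩, h2⟩, fun l => (h1 l).1⟩
    rw [hset, Finset.mul_sum, Finset.mul_sum]
    refine Finset.sum_le_sum fun v hv => ?_
    simp only [Finset.mem_filter, Fintype.mem_piFinset, Finset.mem_Icc] at hv
    rw [pathSum_prod_degInd w v d r hn, Finset.prod_univ_sum, Finset.prod_mul_distrib]
    have hsum := Finset.sum_le_sum fun (s : ι → ℕ)
      (_ : s ∈ Fintype.piFinset fun l => Finset.range (r l)) =>
      h.regular.degProb_le_pois hθ (by positivity) hδ hN hv.2 (fun l => (hv.1 l).1)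
        (fun l => (hv.1 l).2) hσ hσ1 hn (fun l => d l + s l)
    rw [← Finset.mul_sum] at hsum
    have hL0 : 0 ≤ ∏ l, L l (v l) := Finset.prod_nonneg fun l _ => hL l _
    calc _ ≤ _ := mul_le_mul_of_nonneg_left (mul_le_mul_of_nonneg_left hsum hL0) hM
      _ = _ := by ring

namespace IsWRT

variable {Ω : Type*} [mΩ : MeasurableSpace Ω] {P : Measure Ω} [IsProbabilityMeasure P]
  {W : ℕ → Ω → ℝ} {A : ℕ → Ω → ℕ} {θ : ℝ}

/-- Integral of the dominating product over the tuples of large labels. -/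
lemma integral_sum_prod_pois_le (hT : IsWRT P W A) (hθ : 1 < θ) {n : ℕ} {N : ℕ → ℕ}
    (hN : 1 ≤ N n) {t : ℕ → ℝ} (ht : 0 ≤ t n) (d : ι → ℕ → ℕ) (D : ι → ℕ → ℝ) (B : ι → Set ℝ)
    (r : ι → ℕ) :
    Integrable (fun ω => ∑ v ∈ Fintype.piFinset (fun _ : ι => Finset.Icc (N n) n) with
        Function.Injective v,
      (∏ l, (θ ^ d l n / n * (B l).indicator (1 : ℝ → ℝ) (lab (1 - θ⁻¹) n (D l n) (v l)))) *
      ∏ l, ∑ s ∈ Finset.range (r l), pois (W (v l) ω * t n * harm n (v l)) (d l n + s)) P ∧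
    ∫ ω, ∑ v ∈ Fintype.piFinset (fun _ : ι => Finset.Icc (N n) n) with Function.Injective v,
      (∏ l, (θ ^ d l n / n * (B l).indicator (1 : ℝ → ℝ) (lab (1 - θ⁻¹) n (D l n) (v l)))) *
      ∏ l, ∑ s ∈ Finset.range (r l), pois (W (v l) ω * t n * harm n (v l)) (d l n + s) ∂P ≤
    ∏ l, ∑ s ∈ Finset.range (r l),
      ∫ ω, Admissible.windowSum θ (d l) (D l) N t (B l) s n (W 1 ω) ∂P := by
  have hg : ∀ (l : ι) (u : ℕ), Measurable fun y : ℝ =>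
      ∑ s ∈ Finset.range (r l), pois (y * t n * harm n u) (d l n + s) := fun l u =>
    (continuous_finsetSum _ fun s _ => (continuous_pois _).comp (by fun_prop)).measurable
  have hpos : ∀ (l : ι) (u : ℕ) (y : ℝ), 0 < y →
      0 ≤ ∑ s ∈ Finset.range (r l), pois (y * t n * harm n u) (d l n + s) := fun l u y hy =>
    Finset.sum_nonneg fun s _ => pois_nonneg (mul_nonneg (mul_nonneg hy.le ht) (harm_nonneg n u)) _
  have hle : ∀ (l : ι) (u : ℕ) (y : ℝ), 0 < y →
      ∑ s ∈ Finset.range (r l), pois (y * t n * harm n u) (d l n + s) ≤ r l := fun l u y hy => by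
    refine (Finset.sum_le_sum fun s _ => pois_le_one
      (mul_nonneg (mul_nonneg hy.le ht) (harm_nonneg n u)) _).trans ?_
    simp
  have hmem : ∀ v ∈ (Fintype.piFinset (fun _ : ι => Finset.Icc (N n) n)), ∀ l, 1 ≤ v l :=
    fun v hv l => hN.trans (Finset.mem_Icc.1 (Fintype.mem_piFinset.1 hv l)).1
  have hint : ∀ v ∈ (Fintype.piFinset (fun _ : ι => Finset.Icc (N n) n)),
      Integrable (fun ω => ∏ l, ∑ s ∈ Finset.range (r l),
        pois (W (v l) ω * t n * harm n (v l)) (d l n + s)) P := fun v hv =>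
    hT.integrable_prod_weight (hmem v hv) (g := fun l y => ∑ s ∈ Finset.range (r l),
        pois (y * t n * harm n (v l)) (d l n + s)) (C := fun l => r l)
      (fun l => hg l _) (fun l => hpos l _) (fun l => hle l _)
  have hint' := fun v hv => (hint v hv).const_mul
    (∏ l, (θ ^ d l n / n * (B l).indicator (1 : ℝ → ℝ) (lab (1 - θ⁻¹) n (D l n) (v l))))
  refine ⟨integrable_finsetSum _ fun v hv => hint' v (Finset.mem_filter.1 hv).1, ?_⟩
  rw [integral_finsetSum _ fun v hv => hint' v (Finset.mem_filter.1 hv).1]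
  simp_rw [hT.sum_integral_windowSum_eq ht]
  rw [Finset.prod_univ_sum]
  have hterm : ∀ v ∈ Fintype.piFinset (fun _ : ι => Finset.Icc (N n) n), 0 ≤
      ∏ l, (θ ^ d l n / n * ((B l).indicator (1 : ℝ → ℝ) (lab (1 - θ⁻¹) n (D l n) (v l)) *
        ∫ ω, ∑ s ∈ Finset.range (r l), pois (W 1 ω * t n * harm n (v l)) (d l n + s) ∂P)) := by
    intro v _
    refine Finset.prod_nonneg fun l _ => mul_nonneg (by positivity) (mul_nonneg
      (Set.indicator_nonneg (fun _ _ => zero_le_one) _) (integral_nonneg_of_ae ?_))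
    filter_upwards [hT.ae_pos] with ω h using hpos l _ _ (h 1 le_rfl)
  -- Distinctness of the vertices is used to factorise the expectation over independent weights;
  -- afterwards it is dropped, the remaining terms being nonnegative, so that the full sum becomes a
  -- product.
  refine (Finset.sum_le_sum fun v hv => ?_).trans
    (Finset.sum_le_sum_of_subset_of_nonneg (Finset.filter_subset Function.Injective _)
      fun v hv _ => hterm v hv)
  rw [integral_const_mul, hT.integral_prod_weight (Finset.mem_filter.1 hv).2
    (hmem v (Finset.mem_filter.1 hv).1) (g := fun l y => ∑ s ∈ Finset.range (r l),
        pois (y * t n * harm n (v l)) (d l n + s)) (fun l => hg l _), ← Finset.prod_mul_distrib]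
  refine le_of_eq (Finset.prod_congr rfl fun l _ => ?_)
  ring

/-- Off the good event the count is bounded by `n ^ card ι`. The good event is determined by the
weights, so on it the attachments can be integrated out before the weights. -/
lemma integral_tupleCount_le (hT : IsWRT P W A) (hθ : 1 < θ) {η ε ε' x : ℝ} {n : ℕ}
    (hε : 0 < ε) (hε' : 0 < ε')
    (hδ : (n : ℝ) ^ (-(η / 4)) ≤ 1 / 2) (hN : 2 ≤ ⌈(n : ℝ) ^ η⌉₊) (hNn : ⌈(n : ℝ) ^ η⌉₊ ≤ n)
    (hx1 : 1 ≤ x) (hx2 : x ≤ 2) {σ : ℕ → ℝ}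
    (hσ : Fintype.card ι * (2 * (θ - 1)⁻¹ / ⌈(n : ℝ) ^ η⌉₊) ≤ σ n) (hσ1 : σ n ≤ 1 / 2)
    (d : ι → ℕ → ℕ) (D : ι → ℕ → ℝ) (B : ι → Set ℝ) (r : ι → ℕ) :
    (∏ l, θ ^ d l n / (n : ℝ)) * ∫ ω, tupleCount
        (fun l v => (B l).indicator (1 : ℝ → ℝ) (lab (1 - θ⁻¹) n (D l n) v))
        (fun l => d l n) r n (fun m => A m ω) ∂P ≤
      (∏ l, θ ^ d l n / (n : ℝ)) * ((n : ℝ) ^ Fintype.card ι *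
        P.real {ω | ¬ Good θ η ε ε' n fun i => W i ω}) +
      (∑ v ∈ Fintype.piFinset (fun _ : ι => Finset.Icc 1 n) with ∃ l, v l < ⌈(n : ℝ) ^ η⌉₊,
        ∏ l, tailBound θ x η ε ε' n (d l n) (v l) +
      Real.exp (Fintype.card ι * (((θ - 1)⁻¹ / ((1 - (n : ℝ) ^ (-(η / 4))) * (1 - σ n)) -
        (θ - 1)⁻¹ / (1 + (n : ℝ) ^ (-(η / 4)))) * Real.log n)) *
      ∏ l, ∑ s ∈ Finset.range (r l),
        ∫ ω, Admissible.windowSum θ (d l) (D l) (fun n => ⌈(n : ℝ) ^ η⌉₊)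
          (fun n => (θ - 1)⁻¹ / ((1 - (n : ℝ) ^ (-(η / 4))) * (1 - σ n))) (B l) s n (W 1 ω) ∂P) := by
  have hθ1 : 0 < θ - 1 := by linarith
  have hn : 1 ≤ n := by omega
  set L : ι → ℕ → ℝ := fun l v => (B l).indicator (1 : ℝ → ℝ) (lab (1 - θ⁻¹) n (D l n) v) with hLdef
  have hL : ∀ l v, 0 ≤ L l v := fun l v => Set.indicator_nonneg (fun _ _ => zero_le_one) _
  have hL1 : ∀ l v, L l v ≤ 1 := fun l v => Set.indicator_le_self' (fun _ _ => zero_le_one) _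
  set M : ℝ := ∏ l, θ ^ d l n / (n : ℝ) with hMdef
  have hM : 0 ≤ M := Finset.prod_nonneg fun l _ => by positivity
  set f : (ℕ → ℕ) → ℝ := tupleCount L (fun l => d l n) r n with hfdef
  have hf : ∀ a b : ℕ → ℕ, (∀ m ∈ Finset.Ico 1 (n - 1 + 1), a m = b m) → f a = f b := by
    rw [Nat.sub_add_cancel hn]
    exact fun a b h => tupleCount_congr h
  set G : Set Ω := {ω | Good θ η ε ε' n fun i => W i ω} with hGdef
  have hGs : MeasurableSet[weightSigma W] G := measurableSet_good θ η ε ε' n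
  have hG : MeasurableSet G := hT.weightSigma_le _ hGs
  have hfi := hT.integrable_comp_attach (n - 1) hf
  rw [← integral_add_compl hG hfi, mul_add, add_comm]
  refine add_le_add ?_ ?_
  · refine mul_le_mul_of_nonneg_left ?_ hM
    have h1 : ∫ ω in Gᶜ, f (fun m => A m ω) ∂P ≤ ∫ _ω in Gᶜ, (n : ℝ) ^ Fintype.card ι ∂P :=
      setIntegral_mono hfi.integrableOn (integrable_const _)
        fun ω => tupleCount_le hL hL1 _ _ _ _
    refine h1.trans (le_of_eq ?_)
    rw [setIntegral_const, smul_eq_mul, mul_comm]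
    rfl
  · rw [hT.setIntegral_comp_attach (n - 1) hf hGs, ← integral_const_mul]
    have hr0 : (0 : ℝ) ≤ (n : ℝ) ^ (-(η / 4)) := by positivity
    have ht : 0 ≤ (θ - 1)⁻¹ / ((1 - (n : ℝ) ^ (-(η / 4))) * (1 - σ n)) :=
      div_nonneg (by positivity) (mul_nonneg (by linarith) (by linarith))
    obtain ⟨hI, hle⟩ := hT.integral_sum_prod_pois_le hθ (n := n)
      (N := fun n => ⌈(n : ℝ) ^ η⌉₊) (show 1 ≤ ⌈(n : ℝ) ^ η⌉₊ by omega)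
      (t := fun n => (θ - 1)⁻¹ / ((1 - (n : ℝ) ^ (-(η / 4))) * (1 - σ n))) ht d D B r
    set S := ∑ v ∈ Fintype.piFinset (fun _ : ι => Finset.Icc 1 n) with ∃ l, v l < ⌈(n : ℝ) ^ η⌉₊,
        ∏ l, tailBound θ x η ε ε' n (d l n) (v l) with hSdef
    have hS : 0 ≤ S := Finset.sum_nonneg fun v hv => by
      simp only [Finset.mem_filter, Fintype.mem_piFinset, Finset.mem_Icc] at hv
      exact Finset.prod_nonneg fun l _ => tailBound_nonneg hθ hx1 (hv.1 l).1
    set C := Real.exp (Fintype.card ι * (((θ - 1)⁻¹ / ((1 - (n : ℝ) ^ (-(η / 4))) * (1 - σ n)) -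
        (θ - 1)⁻¹ / (1 + (n : ℝ) ^ (-(η / 4)))) * Real.log n)) with hCdef
    have h2 : ∫ ω in G, M * pathSum (fun i => W i ω) (n - 1) f ∂P ≤
        ∫ ω in G, (S + C * _) ∂P :=
      setIntegral_mono_on ((hT.integrable_pathSum (n - 1) f).const_mul M).integrableOn
        ((integrable_const S).add (hI.const_mul C)).integrableOn hG
        fun ω hω => hω.pathSum_tupleCount_le hθ hε hε' hδ hN hNn hx1 hx2 hσ hσ1 hL hL1 _ _
    refine h2.trans ?_
    refine (setIntegral_le_integral ((integrable_const S).add (hI.const_mul C)) ?_).trans ?_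
    · filter_upwards [hT.ae_pos] with ω h
      refine add_nonneg hS (mul_nonneg (Real.exp_pos _).le (Finset.sum_nonneg fun v hv => ?_))
      simp only [Finset.mem_filter, Fintype.mem_piFinset, Finset.mem_Icc] at hv
      refine mul_nonneg (Finset.prod_nonneg fun l _ => mul_nonneg (by positivity) (hL l _))
        (Finset.prod_nonneg fun l _ => Finset.sum_nonneg fun s _ => pois_nonneg
          (mul_nonneg (mul_nonneg (h _ ?_).le ht) (harm_nonneg _ _)) _)
      have := (hv.1 l).1
      omega
    · have h3 := integral_add (integrable_const (μ := P) S) (hI.const_mul C)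
      simp only [integral_const_mul, integral_const, probReal_univ, smul_eq_mul, one_mul] at h3
      refine h3.le.trans ?_
      exact add_le_add le_rfl (mul_le_mul_of_nonneg_left hle (Real.exp_pos _).le)

end IsWRT

end

/-- The number of degree levels in a window: all of them, or a single one. -/
noncomputable def width (g : Prop) (n : ℕ) : ℕ := by classical exact if g then n else 1

/-- The normalising constant belonging to `width`. -/
noncomputable def modeFactor (θ : ℝ) (g : Prop) : ℝ := by classical exact if g then 1 else (1 - θ⁻¹)⁻¹

lemma one_sub_inv_pos {θ : ℝ} (hθ : 1 < θ) : 0 < 1 - θ⁻¹ := by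
  have := inv_lt_one_of_one_lt₀ hθ
  linarith

lemma modeFactor_pos {θ : ℝ} (hθ : 1 < θ) (g : Prop) : 0 < modeFactor θ g := by
  have := one_sub_inv_pos hθ
  unfold modeFactor
  split_ifs <;> positivity

lemma modeFactor_le {θ : ℝ} (hθ : 1 < θ) (g : Prop) : modeFactor θ g ≤ (1 - θ⁻¹)⁻¹ := by
  have h1 := one_sub_inv_pos hθ
  have h2 : 0 < θ⁻¹ := by positivity
  unfold modeFactor
  split_ifs
  · exact (one_le_inv₀ h1).2 (by linarith)
  · exact le_rfl

namespace IsWRT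

variable {ι : Type*} [Fintype ι] [DecidableEq ι]
  {Ω : Type*} [mΩ : MeasurableSpace Ω] {P : Measure Ω} [IsProbabilityMeasure P]
  {W : ℕ → Ω → ℝ} {A : ℕ → Ω → ℕ} {q₀ θ b β : ℝ}

/-- Simultaneous choice of the tilt and of the parameters of the good event. -/
lemma exists_parameters (hT : IsWRT P W A) (hatom : AtomCase P W q₀) (hθ : θ = theta P W)
    (hb : b < θ / (θ - 1)) (hβ : (1 - θ⁻¹) * β < 1) (γ : ℝ) :
    ∃ x ε' ε η : ℝ, 1 ≤ x ∧ x ≤ θ ∧ 0 < ε' ∧ 0 < ε ∧ 0 < η ∧ η < 1 ∧ η < 1 - (1 - θ⁻¹) * β ∧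
      η + b * Real.log (θ / x) - 1 + ε' + η / ε + (x - 1) * (θ - 1)⁻¹ < 0 ∧
      ∀ᶠ n : ℕ in atTop, P.real {ω | ¬ Good θ η ε ε' n fun i => W i ω} ≤ (n : ℝ) ^ (-γ) := by
  have hθ1 := hT.theta_gt_one hatom hθ
  obtain ⟨x, hx1, hx2, hx⟩ := exists_tilt hθ1 hb
  set E := b * Real.log (θ / x) - 1 + (x - 1) * (θ - 1)⁻¹ with hE
  -- The order of choice matters: the tilt leaves a slack `-E`, of which `ε'` takes half; `ε`
  -- depends on `ε'` and `γ`; only then is `η` taken so small that `η + η / ε` stays below the other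
  -- half.
  obtain ⟨ε, hε, hgood⟩ := hT.exists_prob_not_good_le hatom hθ
    (show 0 < -E / 2 by linarith) γ
  have hη : ∀ᶠ η : ℝ in 𝓝[>] 0, η < 1 ∧ η < 1 - (1 - θ⁻¹) * β ∧ η + η / ε < -E / 2 := by
    refine nhdsWithin_le_nhds ?_
    refine (eventually_lt_nhds one_pos).and ((eventually_lt_nhds (by linarith)).and ?_)
    have hc : ContinuousAt (fun η : ℝ => η + η / ε) 0 := by fun_prop
    exact hc.eventually_lt_const (by simp; linarith)
  obtain ⟨η, ⟨h1, h2, h3⟩, h4⟩ := (hη.and self_mem_nhdsWithin).exists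
  exact ⟨x, -E / 2, ε, η, hx1, hx2.le, by linarith, hε, h4, h1, h2, by rw [hE] at h3; linarith,
    hgood η h4⟩

/-- Each normalising factor is at most `n^(b log θ - 1)`, so the prescribed power of `n` beats both
the normalisation and the trivial count, with a factor `n⁻¹` to spare. -/
lemma tendsto_bad_part (hθ : 1 < θ) {d : ι → ℕ → ℕ}
    (hd : ∀ l, ∀ᶠ n : ℕ in atTop, (d l n : ℝ) ≤ b * Real.log n) {p : ℕ → ℝ} (hp0 : ∀ n, 0 ≤ p n)
    (hp : ∀ᶠ n : ℕ in atTop, p n ≤ (n : ℝ) ^ (-(Fintype.card ι * (b * Real.log θ) + 1))) :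
    Tendsto (fun n : ℕ => (∏ l, θ ^ d l n / (n : ℝ)) * ((n : ℝ) ^ Fintype.card ι * p n))
      atTop (𝓝 0) := by
  refine squeeze_zero' (.of_forall fun n => ?_) ?_ (tendsto_rpow_neg one_pos)
  · have := hp0 n
    have : 0 ≤ ∏ l, θ ^ d l n / (n : ℝ) := Finset.prod_nonneg fun l _ => by positivity
    positivity
  · filter_upwards [eventually_all.2 hd, hp, eventually_ge_atTop 1] with n h1 h2 hn
    have hn' : (0 : ℝ) < n := by exact_mod_cast hn
    have h3 : ∏ l, θ ^ d l n / (n : ℝ) ≤ ∏ _l : ι, (n : ℝ) ^ (b * Real.log θ) / n := by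
      refine Finset.prod_le_prod (fun l _ => by positivity) fun l _ => ?_
      gcongr
      rw [← Real.rpow_natCast, Real.rpow_def_of_pos (by linarith), Real.rpow_def_of_pos hn']
      refine Real.exp_le_exp.2 ?_
      have := mul_le_mul_of_nonneg_left (h1 l) (Real.log_nonneg hθ.le)
      linarith
    rw [Finset.prod_const, Finset.card_univ, div_pow] at h3
    calc _ ≤ ((n : ℝ) ^ (b * Real.log θ)) ^ Fintype.card ι / (n : ℝ) ^ Fintype.card ι *
          ((n : ℝ) ^ Fintype.card ι *
            (n : ℝ) ^ (-(Fintype.card ι * (b * Real.log θ) + 1))) := by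
          have := hp0 n
          gcongr
      _ = ((n : ℝ) ^ (b * Real.log θ)) ^ Fintype.card ι *
            (n : ℝ) ^ (-(Fintype.card ι * (b * Real.log θ) + 1)) := by
          field_simp
      _ = _ := by
          rw [← Real.rpow_natCast, ← Real.rpow_mul hn'.le, ← Real.rpow_add hn']
          congr 1
          ring

/-- Both kinds of windows have the same normalised limit. -/
lemma tendsto_modeFactor_mul (hT : IsWRT P W A) (hatom : AtomCase P W q₀) (hθ : 1 < θ)
    {d : ℕ → ℕ} {D : ℕ → ℝ} {N : ℕ → ℕ} {t : ℕ → ℝ} (h : Admissible (1 - θ⁻¹) d D N)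
    (ht : Tendsto (fun n => (t n * (θ - 1) - 1) * Real.log n) atTop (𝓝 0)) {B : Set ℝ}
    (hB : MeasurableSet B) (hBf : Phi (frontier B) = 0) (g : ℕ → Prop) :
    Tendsto (fun n => modeFactor θ (g n) * ∑ s ∈ Finset.range (width (g n) n),
      ∫ ω, Admissible.windowSum θ d D N t B s n (W 1 ω) ∂P) atTop (𝓝 (q₀ * Phi B)) := by
  classical
  have hY0 : ∀ᵐ ω ∂P, 0 < W 1 ω := hT.pos_weight 1 le_rfl
  have hY1 : ∀ᵐ ω ∂P, W 1 ω ≤ 1 := by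
    filter_upwards [hT.ae_le_one hatom] with ω h using h 1 le_rfl
  have h1 := h.tendsto_sum_integral_windowSum hθ ht hB hBf (hT.measurable_weight 1 le_rfl) hY0 hY1
  have h2 := (h.tendsto_integral_windowSum hθ ht hB hBf
    (hT.measurable_weight 1 le_rfl) hY0 hY1 0).const_mul (1 - θ⁻¹)⁻¹
  rw [hatom.atom] at h1 h2
  have e : (1 - θ⁻¹)⁻¹ * (q₀ * ((1 - θ⁻¹) * θ⁻¹ ^ 0 * Phi B)) = q₀ * Phi B := by
    have := (one_sub_inv_pos hθ).ne'
    rw [pow_zero, mul_one]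
    generalize 1 - θ⁻¹ = a at *
    field_simp
  rw [e] at h2
  -- Whether a window is a single level or all levels may vary with `n`, as `K'` does. The factor
  -- `modeFactor` gives both modes the same limit, so they can be merged.
  refine (h1.if' (p := g) h2).congr fun n => ?_
  unfold modeFactor width
  split_ifs <;> simp

/-- Upper bound for the joint factorial moments. -/
lemma eventually_integral_tupleCount_lt (hT : IsWRT P W A) (hatom : AtomCase P W q₀)
    (hθ : θ = theta P W) (hb : b < θ / (θ - 1)) (hβ : (1 - θ⁻¹) * β < 1)
    {d : ι → ℕ → ℕ} {D : ι → ℕ → ℝ} (hdt : ∀ l, Tendsto (d l) atTop atTop)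
    (hd : ∀ l, ∀ᶠ n : ℕ in atTop, (d l n : ℝ) ≤ b * Real.log n)
    (hDt : ∀ l, Tendsto (D l) atTop atTop)
    (hD : ∀ l, ∀ᶠ n : ℕ in atTop, D l n ≤ β * Real.log n)
    (hdD : ∀ l, Tendsto (fun n => ((d l n : ℝ) - D l n) / √(D l n)) atTop (𝓝 0))
    {B : ι → Set ℝ} (hB : ∀ l, MeasurableSet (B l)) (hBf : ∀ l, Phi (frontier (B l)) = 0)
    (g : ι → ℕ → Prop) {u : ℝ} (hu : ∏ l, (q₀ * Phi (B l)) < u) :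
    ∀ᶠ n : ℕ in atTop, (∏ l, modeFactor θ (g l n) * (θ ^ d l n / n)) *
      ∫ ω, tupleCount (fun l v => (B l).indicator (1 : ℝ → ℝ) (lab (1 - θ⁻¹) n (D l n) v))
        (fun l => d l n) (fun l => width (g l n) n) n (fun m => A m ω) ∂P < u := by
  have hθ1 := hT.theta_gt_one hatom hθ
  have hθ2 := hT.theta_le_two hatom hθ
  have ha := one_sub_inv_pos hθ1
  obtain ⟨x, ε', ε, η, hx1, hxθ, hε', hε, hη, hη1, hηβ, hexp, hgood⟩ :=
    hT.exists_parameters hatom hθ hb hβ (Fintype.card ι * (b * Real.log θ) + 1)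
  set σ : ℕ → ℝ := fun n => Fintype.card ι * (2 * (θ - 1)⁻¹) / ⌈(n : ℝ) ^ η⌉₊ with hσdef
  set t : ℕ → ℝ := fun n => (θ - 1)⁻¹ / ((1 - (n : ℝ) ^ (-(η / 4))) * (1 - σ n)) with htdef
  have hadm : ∀ l, Admissible (1 - θ⁻¹) (d l) (D l) (fun n => ⌈(n : ℝ) ^ η⌉₊) := fun l =>
    .of_log_le ha.le (hdt l) (hDt l) (hdD l) (hD l) hη hηβ
  have hδlog : Tendsto (fun n : ℕ => (n : ℝ) ^ (-(η / 4)) * Real.log n) atTop (𝓝 0) := by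
    simpa using tendsto_rpow_neg_mul_log_pow (r := η / 4) (by linarith) 1
  have hσlog : Tendsto (fun n : ℕ => σ n * Real.log n) atTop (𝓝 0) := by
    simpa using tendsto_cutoff_inv_mul_log_pow hη (Fintype.card ι * (2 * (θ - 1)⁻¹)) 1
  have ht := tendsto_perturbed_rate hθ1 hδlog hσlog
  have hC := tendsto_upper_const hθ1 (Fintype.card ι) hδlog hσlog
  have hbad := tendsto_bad_part hθ1 hd (fun n => measureReal_nonneg) hgood
  have hsmall := tendsto_sum_prod_tailBound hθ1 hη hε hx1 hxθ hexp hd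
  have hmain := hC.mul (tendsto_finsetProd Finset.univ fun l _ =>
    hT.tendsto_modeFactor_mul hatom hθ1 (hadm l) ht (hB l) (hBf l) (g l))
  have hlim := ((hbad.add hsmall).const_mul (∏ _l : ι, (1 - θ⁻¹)⁻¹)).add hmain
  rw [add_zero, mul_zero, zero_add, one_mul] at hlim
  filter_upwards [hlim.eventually_lt_const hu, (tendsto_of_mul_log hδlog).eventually_le_const
    (show (0 : ℝ) < 1 / 2 by norm_num), (tendsto_of_mul_log hσlog).eventually_le_const
    (show (0 : ℝ) < 1 / 2 by norm_num), (tendsto_cutoff_atTop hη).eventually_ge_atTop 2,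
    eventually_cutoff_le hη hη1] with n h1 h2 h3 h4 h5
  refine lt_of_le_of_lt ?_ h1
  have h6 := hT.integral_tupleCount_le hθ1 hε hε' h2 h4 h5 hx1 (hxθ.trans hθ2) (σ := σ)
    (mul_div_assoc _ _ _).ge h3 d D B (fun l => width (g l n) n)
  have hm0 : (0 : ℝ) ≤ ∏ l, modeFactor θ (g l n) :=
    Finset.prod_nonneg fun l _ => (modeFactor_pos hθ1 _).le
  have hm1 : ∏ l, modeFactor θ (g l n) ≤ ∏ _l : ι, (1 - θ⁻¹)⁻¹ :=
    Finset.prod_le_prod (fun l _ => (modeFactor_pos hθ1 _).le) fun l _ => modeFactor_le hθ1 _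
  rw [Finset.prod_mul_distrib, mul_assoc]
  refine (mul_le_mul_of_nonneg_left h6 hm0).trans ?_
  rw [← add_assoc, mul_add]
  refine add_le_add (mul_le_mul_of_nonneg_right hm1 (add_nonneg ?_ ?_)) (le_of_eq ?_)
  · exact mul_nonneg (Finset.prod_nonneg fun l _ => by positivity)
      (mul_nonneg (by positivity) measureReal_nonneg)
  · refine Finset.sum_nonneg fun v hv => ?_
    simp only [Finset.mem_filter, Fintype.mem_piFinset, Finset.mem_Icc] at hv
    exact Finset.prod_nonneg fun l _ => tailBound_nonneg hθ1 hx1 (hv.1 l).1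
  · rw [Finset.prod_mul_distrib]
    ring

end IsWRT

/-! ### Expected number of tuples: the lower bound -/

/-- The normalised contribution of vertex `v` to the lower bound. -/
noncomputable def lowerTerm (θ : ℝ) (d : ℕ) (D : ℝ) (B : Set ℝ) (n s v : ℕ) : ℝ :=
  θ ^ d / n * (B.indicator (1 : ℝ → ℝ) (lab (1 - θ⁻¹) n D v) *
    if 1 ≤ harm n v then pois ((θ - 1)⁻¹ * harm n v) (d + s) else 0)

section LowerTerm

variable {θ : ℝ}

lemma lowerTerm_nonneg (hθ : 1 < θ) (d : ℕ) (D : ℝ) (B : Set ℝ) (n s v : ℕ) :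
    0 ≤ lowerTerm θ d D B n s v := by
  have hθ1 : 0 < θ - 1 := by linarith
  refine mul_nonneg (by positivity) (mul_nonneg
    (Set.indicator_nonneg (fun _ _ => zero_le_one) _) ?_)
  split_ifs
  · exact pois_nonneg (mul_nonneg (by positivity) (harm_nonneg n v)) _
  · exact le_rfl

/-- By tilting, `θ^(d + s) pois (h / (θ - 1)) (d + s) = e^h pois (θ h / (θ - 1)) (d + s) ≤ e^h`, and
`e^h ≤ n / (v - 1)` for `h = harm n v`. Smallness of single terms is what makes tuples with repeated
entries negligible. -/
lemma lowerTerm_le (hθ : 1 < θ) (d : ℕ) (D : ℝ) (B : Set ℝ) {n N s v : ℕ} (hN : 2 ≤ N)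
    (hv : N ≤ v) (hvn : v ≤ n) : lowerTerm θ d D B n s v ≤ 1 / (N - 1) := by
  have hθ1 : 0 < θ - 1 := by linarith
  have hN' : (2 : ℝ) ≤ N := by exact_mod_cast hN
  have hv' : (N : ℝ) ≤ v := by exact_mod_cast hv
  have hn' : (v : ℝ) ≤ n := by exact_mod_cast hvn
  have hn0 : (0 : ℝ) < n := by linarith
  have hh := harm_nonneg n v
  set h := harm n v with hhdef
  have hp0 : 0 ≤ pois ((θ - 1)⁻¹ * h) (d + s) := pois_nonneg (by positivity) _
  have h1 : lowerTerm θ d D B n s v ≤ θ ^ (d + s) / n * pois ((θ - 1)⁻¹ * h) (d + s) := by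
    unfold lowerTerm
    rw [← hhdef]
    have h2 : (B.indicator (1 : ℝ → ℝ) (lab (1 - θ⁻¹) n D v) *
        if 1 ≤ h then pois ((θ - 1)⁻¹ * h) (d + s) else 0) ≤ pois ((θ - 1)⁻¹ * h) (d + s) := by
      refine (mul_le_of_le_one_left ?_ (Set.indicator_le_self' (fun _ _ => zero_le_one) _)).trans ?_
      · split_ifs
        exacts [hp0, le_rfl]
      · split_ifs
        exacts [le_rfl, hp0]
    have h3 : θ ^ d ≤ θ ^ (d + s) := pow_le_pow_right₀ hθ.le (by omega)
    refine (mul_le_mul_of_nonneg_left h2 (by positivity)).trans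
      (mul_le_mul_of_nonneg_right ?_ hp0)
    gcongr
  have h4 : θ ^ (d + s) * pois ((θ - 1)⁻¹ * h) (d + s) =
      Real.exp h * pois (θ * ((θ - 1)⁻¹ * h)) (d + s) := by
    unfold pois
    have e : Real.exp (-((θ - 1)⁻¹ * h)) = Real.exp h * Real.exp (-(θ * ((θ - 1)⁻¹ * h))) := by
      rw [← Real.exp_add]
      congr 1
      field_simp
      ring
    rw [e, mul_pow θ]
    ring
  have h5 : Real.exp h ≤ n / (v - 1) := by
    rw [← Real.le_log_iff_exp_le (div_pos hn0 (by linarith))]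
    exact harm_le_log_div (hN.trans hv) hvn
  have h6 : pois (θ * ((θ - 1)⁻¹ * h)) (d + s) ≤ 1 := pois_le_one (by positivity) _
  calc _ ≤ θ ^ (d + s) / n * pois ((θ - 1)⁻¹ * h) (d + s) := h1
    _ = Real.exp h * pois (θ * ((θ - 1)⁻¹ * h)) (d + s) / n := by rw [← h4]; ring
    _ ≤ n / (v - 1) * 1 / n := by
        have : 0 ≤ (n : ℝ) / (v - 1) := div_nonneg hn0.le (by linarith)
        have : 0 ≤ pois (θ * ((θ - 1)⁻¹ * h)) (d + s) := pois_nonneg (by positivity) _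
        gcongr
    _ = 1 / (v - 1) := by field_simp
    _ ≤ 1 / (N - 1) := one_div_le_one_div_of_le (by linarith) (by linarith)

variable {d : ℕ → ℕ} {D : ℕ → ℝ} {N : ℕ → ℕ}

/-- Compared with `windowSum` at weight one only the vertices with `harm n v < 1` are missing. Their
Poisson means are below `(θ - 1)⁻¹`, so together they contribute at most `(θ / (θ - 1))^(d + s) / (d
+ s)!`, which vanishes. -/
lemma Admissible.tendsto_sum_lowerTerm (h : Admissible (1 - θ⁻¹) d D N) (hθ : 1 < θ) {B : Set ℝ}
    (hB : MeasurableSet B) (hBf : Phi (frontier B) = 0) (s : ℕ) :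
    Tendsto (fun n => ∑ v ∈ Finset.Icc (N n) n, lowerTerm θ (d n) (D n) B n s v) atTop
      (𝓝 ((1 - θ⁻¹) * θ⁻¹ ^ s * Phi B)) := by
  have hθ1 : 0 < θ - 1 := by linarith
  have h1 := h.windowSum_tendsto_one hθ (tendsto_const_rate hθ) hB hBf s
  have hfac : Tendsto (fun n => (θ * (θ - 1)⁻¹) ^ (d n + s) / ((d n + s).factorial : ℝ)) atTop
      (𝓝 0) :=
    (FloorSemiring.tendsto_pow_div_factorial_atTop (θ * (θ - 1)⁻¹)).comp
      (h.add s).tendsto_degree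
  have hdiff : Tendsto (fun n => Admissible.windowSum θ d D N (fun _ => (θ - 1)⁻¹) B s n 1 -
      ∑ v ∈ Finset.Icc (N n) n, lowerTerm θ (d n) (D n) B n s v) atTop (𝓝 0) := by
    have e : ∀ n, Admissible.windowSum θ d D N (fun _ => (θ - 1)⁻¹) B s n 1 -
        ∑ v ∈ Finset.Icc (N n) n, lowerTerm θ (d n) (D n) B n s v =
        ∑ v ∈ Finset.Icc (N n) n, θ ^ d n / n * (B.indicator (1 : ℝ → ℝ)
          (lab (1 - θ⁻¹) n (D n) v) *
          if 1 ≤ harm n v then 0 else pois ((θ - 1)⁻¹ * harm n v) (d n + s)) := by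
      intro n
      rw [Admissible.windowSum, Finset.mul_sum, ← Finset.sum_sub_distrib]
      refine Finset.sum_congr rfl fun v _ => ?_
      unfold lowerTerm
      rw [one_mul]
      split_ifs <;> ring
    have hpn : ∀ n v, 0 ≤ pois ((θ - 1)⁻¹ * harm n v) (d n + s) := fun n v =>
      pois_nonneg (mul_nonneg (by positivity) (harm_nonneg n v)) _
    refine squeeze_zero' (.of_forall fun n => ?_) ?_ hfac
    · rw [e]
      refine Finset.sum_nonneg fun v _ => mul_nonneg (by positivity) (mul_nonneg
        (Set.indicator_nonneg (fun _ _ => zero_le_one) _) ?_)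
      split_ifs
      exacts [le_rfl, hpn n v]
    · filter_upwards [h.tendsto_cutoff.eventually_ge_atTop 1, eventually_ge_atTop 1] with n hN hn
      have hn0 : (0 : ℝ) < n := by exact_mod_cast hn
      rw [e]
      have h2 : ∀ v ∈ Finset.Icc (N n) n, θ ^ d n / n * (B.indicator (1 : ℝ → ℝ)
          (lab (1 - θ⁻¹) n (D n) v) *
          if 1 ≤ harm n v then 0 else pois ((θ - 1)⁻¹ * harm n v) (d n + s)) ≤
          (θ * (θ - 1)⁻¹) ^ (d n + s) / ((d n + s).factorial : ℝ) / n := by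
        intro v _
        have h3 : (if 1 ≤ harm n v then 0 else pois ((θ - 1)⁻¹ * harm n v) (d n + s)) ≤
            (θ - 1)⁻¹ ^ (d n + s) / ((d n + s).factorial : ℝ) := by
          split_ifs with hh
          · positivity
          · have hx := harm_nonneg n v
            unfold pois
            have h4 : Real.exp (-((θ - 1)⁻¹ * harm n v)) ≤ 1 :=
              Real.exp_le_one_iff.2 (neg_nonpos.2 (by positivity))
            have h5 : ((θ - 1)⁻¹ * harm n v) ^ (d n + s) ≤ (θ - 1)⁻¹ ^ (d n + s) :=
              pow_le_pow_left₀ (by positivity)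
                (mul_le_of_le_one_right (by positivity) (not_le.1 hh).le) _
            refine div_le_div_of_nonneg_right ?_ (by positivity)
            calc _ ≤ 1 * (θ - 1)⁻¹ ^ (d n + s) := by gcongr
              _ = _ := one_mul _
        have h3' : 0 ≤ (if 1 ≤ harm n v then 0 else pois ((θ - 1)⁻¹ * harm n v) (d n + s)) := by
          split_ifs
          exacts [le_rfl, hpn n v]
        have h4 : θ ^ d n ≤ θ ^ (d n + s) := pow_le_pow_right₀ hθ.le (by omega)
        calc _ ≤ θ ^ (d n + s) / n * ((θ - 1)⁻¹ ^ (d n + s) / ((d n + s).factorial : ℝ)) := by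
              refine mul_le_mul (by gcongr) ?_ (mul_nonneg
                (Set.indicator_nonneg (fun _ _ => zero_le_one) _) h3') (by positivity)
              exact (mul_le_of_le_one_left h3'
                (Set.indicator_le_self' (fun _ _ => zero_le_one) _)).trans h3
          _ = _ := by rw [mul_pow]; ring
      refine (Finset.sum_le_sum h2).trans ?_
      rw [Finset.sum_const, nsmul_eq_mul, Nat.card_Icc]
      have h6 : ((n + 1 - N n : ℕ) : ℝ) ≤ n := by exact_mod_cast (by omega)
      calc _ ≤ (n : ℝ) * ((θ * (θ - 1)⁻¹) ^ (d n + s) / ((d n + s).factorial : ℝ) / n) := by gcongr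
        _ = _ := by field_simp
  have h2 := h1.sub hdiff
  simpa using h2

end LowerTerm

namespace IsWRT

variable {ι : Type*} [Fintype ι] [DecidableEq ι]
  {Ω : Type*} [mΩ : MeasurableSpace Ω] {P : Measure Ω} [IsProbabilityMeasure P]
  {W : ℕ → Ω → ℝ} {A : ℕ → Ω → ℕ} {q₀ θ b β : ℝ}

lemma prob_weights_eq_one (hT : IsWRT P W A) (hatom : AtomCase P W q₀) {v : ι → ℕ}
    (hv : Function.Injective v) (hv1 : ∀ l, 1 ≤ v l) :
    P.real {ω | ∀ l, W (v l) ω = 1} = q₀ ^ Fintype.card ι := by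
  have hm : ∀ l, MeasurableSet {ω | W (v l) ω = 1} := fun l =>
    hT.measurable_weight _ (hv1 l) (measurableSet_singleton 1)
  have hset : MeasurableSet {ω | ∀ l, W (v l) ω = 1} := by
    rw [Set.ofPred_forall]
    exact MeasurableSet.iInter hm
  have h1 := hT.integral_prod_weight hv hv1 (g := fun _ => Set.indicator {1} 1)
    (fun _ => measurable_one.indicator (measurableSet_singleton 1))
  have h2 : ∀ ω, ∏ l, (Set.indicator {1} 1 (W (v l) ω) : ℝ) =
      Set.indicator {ω | ∀ l, W (v l) ω = 1} 1 ω := by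
    intro ω
    by_cases h : ∀ l, W (v l) ω = 1
    · rw [Set.indicator_of_mem (show ω ∈ {ω | ∀ l, W (v l) ω = 1} from h)]
      exact Finset.prod_eq_one fun l _ => by rw [h l]; simp
    · rw [Set.indicator_of_notMem (show ω ∉ {ω | ∀ l, W (v l) ω = 1} from h)]
      push Not at h
      obtain ⟨l, hl⟩ := h
      exact Finset.prod_eq_zero (Finset.mem_univ l) (by simp [hl])
  simp_rw [h2] at h1
  rw [integral_indicator_one hset] at h1
  have h3 : ∫ ω, (Set.indicator {1} 1 (W 1 ω) : ℝ) ∂P = q₀ := by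
    have h4 : MeasurableSet {ω | W 1 ω = 1} :=
      hT.measurable_weight 1 le_rfl (measurableSet_singleton 1)
    rw [← hatom.atom, ← integral_indicator_one h4]
    rfl
  rw [h1, h3]
  simp

/-- Lower bound for the probability that given vertices have given degrees. -/
lemma le_integral_prod_degInd (hT : IsWRT P W A) (hatom : AtomCase P W q₀) (hθ : 1 < θ)
    {η ε ε' : ℝ} {n : ℕ} (hδ : (n : ℝ) ^ (-(η / 4)) ≤ 1 / 2) (hN : 2 ≤ ⌈(n : ℝ) ^ η⌉₊)
    {v : ι → ℕ} (hv : Function.Injective v) (hvN : ∀ l, ⌈(n : ℝ) ^ η⌉₊ ≤ v l)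
    (hvn : ∀ l, v l ≤ n) {σ : ℝ}
    (hσ : Fintype.card ι * (2 * (θ - 1)⁻¹ / ⌈(n : ℝ) ^ η⌉₊) ≤ σ) (hσ1 : σ ≤ 1 / 2) (hn : 1 ≤ n)
    (hh : ∀ l, 1 ≤ harm n (v l)) {d r r' : ι → ℕ} (hr : ∀ l, r' l ≤ r l) {Q : ℝ}
    (hQ : ∑ l, ((d l : ℝ) + r' l) ≤ Q)
    (hQ2 : (n : ℝ) ^ (-(η / 4)) + Q * σ * (θ - 1) ≤ 1)
    (hQ3 : 0 ≤ 1 - Q * ((n : ℝ) ^ (-(η / 4)) + Q * σ * (θ - 1))) :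
    (q₀ ^ Fintype.card ι - P.real {ω | ¬ Good θ η ε ε' n fun i => W i ω}) *
      (Real.exp (-(Fintype.card ι * (((θ - 1)⁻¹ / ((1 - (n : ℝ) ^ (-(η / 4))) * (1 - σ)) -
        (θ - 1)⁻¹) * Real.log n))) * (1 - Q * ((n : ℝ) ^ (-(η / 4)) + Q * σ * (θ - 1))) *
        ∏ l, ∑ s ∈ Finset.range (r' l), pois ((θ - 1)⁻¹ * harm n (v l)) (d l + s)) ≤
      ∫ ω, ∏ l, degInd (d l) (r l) (deg (fun m => A m ω) n (v l)) ∂P := by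
  have hθ1 : 0 < θ - 1 := by linarith
  have hv1 : ∀ l, 1 ≤ v l := fun l => by have := hvN l; omega
  set C := Real.exp (-(Fintype.card ι * (((θ - 1)⁻¹ / ((1 - (n : ℝ) ^ (-(η / 4))) * (1 - σ)) -
        (θ - 1)⁻¹) * Real.log n))) * (1 - Q * ((n : ℝ) ^ (-(η / 4)) + Q * σ * (θ - 1))) with hC
  set G : Set Ω := {ω | Good θ η ε ε' n fun i => W i ω} with hGdef
  set E : Set Ω := {ω | ∀ l, W (v l) ω = 1} with hEdef
  have hGs : MeasurableSet[weightSigma W] G := measurableSet_good θ η ε ε' n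
  have hEs : MeasurableSet[weightSigma W] E := by
    rw [hEdef, Set.ofPred_forall]
    exact MeasurableSet.iInter fun l =>
      measurable_weightSigma (hv1 l) (measurableSet_singleton 1)
  have hGE := hGs.inter hEs
  have hGEm : MeasurableSet (G ∩ E) := hT.weightSigma_le _ hGE
  set f : (ℕ → ℕ) → ℝ := fun a => ∏ l, degInd (d l) (r l) (deg a n (v l)) with hfdef
  have hf : ∀ a b : ℕ → ℕ, (∀ m ∈ Finset.Ico 1 (n - 1 + 1), a m = b m) → f a = f b := by
    rw [Nat.sub_add_cancel hn]
    exact fun a b h => by simp only [hfdef, deg_congr h]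
  have hprod : 0 ≤ ∏ l, ∑ s ∈ Finset.range (r' l), pois ((θ - 1)⁻¹ * harm n (v l)) (d l + s) :=
    Finset.prod_nonneg fun l _ => Finset.sum_nonneg fun s _ =>
      pois_nonneg (mul_nonneg (by positivity) (harm_nonneg n _)) _
  have hC0 : 0 ≤ C := mul_nonneg (Real.exp_pos _).le hQ3
  -- The good event involves the same weights, so no independence is available; a union bound
  -- suffices because `Gᶜ` has vanishing probability.
  have hP : q₀ ^ Fintype.card ι - P.real Gᶜ ≤ P.real (G ∩ E) := by
    rw [← hT.prob_weights_eq_one hatom hv hv1, ← hEdef]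
    have h1 : P.real E ≤ P.real ((G ∩ E) ∪ Gᶜ) := measureReal_mono fun ω hω => by
      by_cases h : ω ∈ G
      · exact Or.inl ⟨h, hω⟩
      · exact Or.inr h
    have h2 := measureReal_union_le (μ := P) (G ∩ E) Gᶜ
    linarith
  have hpt : ∀ ω ∈ G ∩ E, C * ∏ l, ∑ s ∈ Finset.range (r' l),
      pois ((θ - 1)⁻¹ * harm n (v l)) (d l + s) ≤ pathSum (fun i => W i ω) (n - 1) f := by
    rintro ω ⟨hω, hω1⟩
    have h1 : pathSum (fun i => W i ω) (n - 1)
        (fun a => ∏ l, degInd (d l) (r' l) (deg a n (v l))) ≤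
        pathSum (fun i => W i ω) (n - 1) f :=
      pathSum_mono hω.pos fun a => Finset.prod_le_prod (fun l _ => degInd_nonneg _ _ _)
        fun l _ => degInd_mono (hr l)
    refine le_trans ?_ h1
    rw [pathSum_prod_degInd _ v d r' hn, Finset.prod_univ_sum, Finset.mul_sum]
    refine Finset.sum_le_sum fun s hs => ?_
    refine hω.regular.pois_le_degProb hθ (by positivity) hδ hN hv hvN hvn hσ hσ1 hn hω1 hh ?_ hQ2
    refine le_trans ?_ hQ
    push_cast
    refine Finset.sum_le_sum fun l _ => ?_
    have := Finset.mem_range.1 (Fintype.mem_piFinset.1 hs l)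
    have : (s l : ℝ) ≤ r' l := by exact_mod_cast this.le
    linarith
  have hfi := hT.integrable_comp_attach (n - 1) hf
  calc _ ≤ P.real (G ∩ E) * (C * ∏ l, ∑ s ∈ Finset.range (r' l),
        pois ((θ - 1)⁻¹ * harm n (v l)) (d l + s)) :=
        mul_le_mul_of_nonneg_right hP (mul_nonneg hC0 hprod)
    _ = ∫ _ω in G ∩ E, (C * ∏ l, ∑ s ∈ Finset.range (r' l),
        pois ((θ - 1)⁻¹ * harm n (v l)) (d l + s)) ∂P := by
        rw [setIntegral_const, smul_eq_mul]
    _ ≤ ∫ ω in G ∩ E, pathSum (fun i => W i ω) (n - 1) f ∂P :=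
        setIntegral_mono_on (integrable_const _)
          (hT.integrable_pathSum (n - 1) f).integrableOn hGEm hpt
    _ = ∫ ω in G ∩ E, f (fun m => A m ω) ∂P :=
        (hT.setIntegral_comp_attach (n - 1) hf hGE).symm
    _ ≤ _ := setIntegral_le_integral hfi (ae_of_all _ fun ω =>
        Finset.prod_nonneg fun l _ => degInd_nonneg _ _ _)

end IsWRT

namespace IsWRT

variable {ι : Type*} [Fintype ι] [DecidableEq ι]
  {Ω : Type*} [mΩ : MeasurableSpace Ω] {P : Measure Ω} [IsProbabilityMeasure P]
  {W : ℕ → Ω → ℝ} {A : ℕ → Ω → ℕ} {q₀ θ b β : ℝ}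

lemma integral_tupleCount (hT : IsWRT P W A) (L : ι → ℕ → ℝ) (d r : ι → ℕ) {n : ℕ} (hn : 1 ≤ n) :
    ∫ ω, tupleCount L d r n (fun m => A m ω) ∂P =
      ∑ v ∈ Fintype.piFinset (fun _ : ι => Finset.Icc 1 n) with Function.Injective v,
        (∏ l, L l (v l)) *
          ∫ ω, ∏ l, degInd (d l) (r l) (deg (fun m => A m ω) n (v l)) ∂P := by
  have hi : ∀ v : ι → ℕ, Integrable (fun ω => ∏ l, degInd (d l) (r l)
      (deg (fun m => A m ω) n (v l))) P := fun v =>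
    hT.integrable_comp_attach (n - 1) (f := fun a => ∏ l, degInd (d l) (r l) (deg a n (v l))) (by
      rw [Nat.sub_add_cancel hn]
      exact fun a b h => by simp only [deg_congr h])
  unfold tupleCount
  simp_rw [Finset.prod_mul_distrib]
  rw [integral_finsetSum _ fun v _ => (hi v).const_mul _]
  simp_rw [integral_const_mul]

/-- Tuples with an entry below the cutoff are discarded. Those with some `harm n (v l) < 1`, where
the Poisson lower bound does not apply, cost nothing because `lowerTerm` vanishes there. -/
lemma le_integral_tupleCount (hT : IsWRT P W A) (hatom : AtomCase P W q₀) (hθ : 1 < θ)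
    {η ε ε' : ℝ} {n : ℕ} (hδ : (n : ℝ) ^ (-(η / 4)) ≤ 1 / 2) (hN : 2 ≤ ⌈(n : ℝ) ^ η⌉₊) {σ : ℝ}
    (hσ : Fintype.card ι * (2 * (θ - 1)⁻¹ / ⌈(n : ℝ) ^ η⌉₊) ≤ σ) (hσ1 : σ ≤ 1 / 2) (hn : 1 ≤ n)
    {d r r' : ι → ℕ} (hr : ∀ l, r' l ≤ r l) (D : ι → ℝ) (B : ι → Set ℝ) {Q : ℝ}
    (hQ : ∑ l, ((d l : ℝ) + r' l) ≤ Q)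
    (hQ2 : (n : ℝ) ^ (-(η / 4)) + Q * σ * (θ - 1) ≤ 1)
    (hQ3 : 0 ≤ 1 - Q * ((n : ℝ) ^ (-(η / 4)) + Q * σ * (θ - 1))) :
    (q₀ ^ Fintype.card ι - P.real {ω | ¬ Good θ η ε ε' n fun i => W i ω}) *
      (Real.exp (-(Fintype.card ι * (((θ - 1)⁻¹ / ((1 - (n : ℝ) ^ (-(η / 4))) * (1 - σ)) -
        (θ - 1)⁻¹) * Real.log n))) * (1 - Q * ((n : ℝ) ^ (-(η / 4)) + Q * σ * (θ - 1)))) *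
      ∑ v ∈ Fintype.piFinset (fun _ : ι => Finset.Icc ⌈(n : ℝ) ^ η⌉₊ n) with Function.Injective v,
        ∏ l, ∑ s ∈ Finset.range (r' l), lowerTerm θ (d l) (D l) (B l) n s (v l) ≤
      (∏ l, θ ^ d l / (n : ℝ)) * ∫ ω, tupleCount
        (fun l v => (B l).indicator (1 : ℝ → ℝ) (lab (1 - θ⁻¹) n (D l) v)) d r n
        (fun m => A m ω) ∂P := by
  have hM : (0 : ℝ) ≤ ∏ l, θ ^ d l / (n : ℝ) := Finset.prod_nonneg fun l _ => by positivity
  have hnn : ∀ v : ι → ℕ, 0 ≤ (∏ l, (B l).indicator (1 : ℝ → ℝ) (lab (1 - θ⁻¹) n (D l) (v l))) *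
      ∫ ω, ∏ l, degInd (d l) (r l) (deg (fun m => A m ω) n (v l)) ∂P := fun v =>
    mul_nonneg (Finset.prod_nonneg fun l _ => Set.indicator_nonneg (fun _ _ => zero_le_one) _)
      (integral_nonneg fun ω => Finset.prod_nonneg fun l _ => degInd_nonneg _ _ _)
  rw [hT.integral_tupleCount _ d r hn, Finset.mul_sum, Finset.mul_sum]
  refine (Finset.sum_le_sum fun v hv => ?_).trans
    (Finset.sum_le_sum_of_subset_of_nonneg
      (s := Finset.filter Function.Injective
        (Fintype.piFinset fun _ : ι => Finset.Icc ⌈(n : ℝ) ^ η⌉₊ n)) (fun v hv => ?_)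
      fun v _ _ => mul_nonneg hM (hnn v))
  · simp only [Finset.mem_filter, Fintype.mem_piFinset, Finset.mem_Icc] at hv
    by_cases hh : ∀ l, 1 ≤ harm n (v l)
    · have h1 := hT.le_integral_prod_degInd hatom hθ hδ hN hv.2 (fun l => (hv.1 l).1)
        (fun l => (hv.1 l).2) hσ hσ1 hn hh hr hQ hQ2 hQ3 (ε := ε) (ε' := ε')
      have h2 : ∏ l, ∑ s ∈ Finset.range (r' l), lowerTerm θ (d l) (D l) (B l) n s (v l) =
          (∏ l, θ ^ d l / (n : ℝ)) *
            ((∏ l, (B l).indicator (1 : ℝ → ℝ) (lab (1 - θ⁻¹) n (D l) (v l))) *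
            ∏ l, ∑ s ∈ Finset.range (r' l), pois ((θ - 1)⁻¹ * harm n (v l)) (d l + s)) := by
        rw [← Finset.prod_mul_distrib, ← Finset.prod_mul_distrib]
        refine Finset.prod_congr rfl fun l _ => ?_
        simp_rw [lowerTerm, if_pos (hh l), Finset.mul_sum]
      rw [h2]
      have h3 : 0 ≤ ∏ l, (B l).indicator (1 : ℝ → ℝ) (lab (1 - θ⁻¹) n (D l) (v l)) :=
        Finset.prod_nonneg fun l _ => Set.indicator_nonneg (fun _ _ => zero_le_one) _
      refine le_trans (le_of_eq ?_)
        (mul_le_mul_of_nonneg_left (mul_le_mul_of_nonneg_left h1 h3) hM)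
      ring
    · push Not at hh
      obtain ⟨l, hl⟩ := hh
      have h2 : ∏ l, ∑ s ∈ Finset.range (r' l), lowerTerm θ (d l) (D l) (B l) n s (v l) = 0 :=
        Finset.prod_eq_zero (Finset.mem_univ l) (Finset.sum_eq_zero fun s _ => by
          rw [lowerTerm, if_neg (not_le.2 hl), mul_zero, mul_zero])
      rw [h2, mul_zero]
      exact mul_nonneg hM (hnn v)
  · simp only [Finset.mem_filter, Fintype.mem_piFinset, Finset.mem_Icc] at hv ⊢
    exact ⟨fun l => ⟨by have := (hv.1 l).1; omega, (hv.1 l).2⟩, hv.2⟩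

end IsWRT

/-- The normalising constant for the lower bound, with all but the first `S` levels left out. -/
noncomputable def lowerFactor (θ : ℝ) (S : ℕ) (g : Prop) : ℝ := by
  classical exact if g then 1 else (1 - θ⁻¹)⁻¹ * (1 - θ⁻¹ ^ S)

lemma one_sub_inv_pow_mem {θ : ℝ} (hθ : 1 < θ) (S : ℕ) :
    0 ≤ 1 - θ⁻¹ ^ S ∧ 1 - θ⁻¹ ^ S ≤ 1 := by
  have h1 : θ⁻¹ ^ S ≤ 1 := pow_le_one₀ (by positivity) (inv_le_one_of_one_le₀ hθ.le)
  have h2 : 0 ≤ θ⁻¹ ^ S := by positivity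
  constructor <;> linarith

lemma lowerFactor_nonneg {θ : ℝ} (hθ : 1 < θ) (S : ℕ) (g : Prop) : 0 ≤ lowerFactor θ S g := by
  have h1 := one_sub_inv_pos hθ
  have h2 := (one_sub_inv_pow_mem hθ S).1
  unfold lowerFactor
  split_ifs <;> positivity

lemma lowerFactor_le {θ : ℝ} (hθ : 1 < θ) (S : ℕ) (g : Prop) :
    lowerFactor θ S g ≤ modeFactor θ g := by
  have h1 := one_sub_inv_pos hθ
  have h2 := (one_sub_inv_pow_mem hθ S).2
  unfold lowerFactor modeFactor
  split_ifs
  · exact le_rfl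
  · exact mul_le_of_le_one_right (by positivity) h2

/-- Keeping `S` levels of the geometric law leaves the fraction `1 - θ⁻¹ ^ S`. The single-level mode
loses nothing, but `lowerFactor` imposes the same fraction on it so that the limit does not depend
on the mode. -/
lemma Admissible.tendsto_lowerFactor_mul {θ : ℝ} (hθ : 1 < θ)
    {d : ℕ → ℕ} {D : ℕ → ℝ} {N : ℕ → ℕ} (h : Admissible (1 - θ⁻¹) d D N) {B : Set ℝ}
    (hB : MeasurableSet B) (hBf : Phi (frontier B) = 0) (S : ℕ) (g : ℕ → Prop) :
    Tendsto (fun n => ∑ v ∈ Finset.Icc (N n) n, lowerFactor θ S (g n) *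
      ∑ s ∈ Finset.range (width (g n) S), lowerTerm θ (d n) (D n) B n s v) atTop
      (𝓝 ((1 - θ⁻¹ ^ S) * Phi B)) := by
  classical
  have ha := one_sub_inv_pos hθ
  have h1 := tendsto_finsetSum (Finset.range S) fun s _ => h.tendsto_sum_lowerTerm hθ hB hBf s
  have e1 : ∑ s ∈ Finset.range S, (1 - θ⁻¹) * θ⁻¹ ^ s * Phi B = (1 - θ⁻¹ ^ S) * Phi B := by
    rw [← Finset.sum_mul, ← Finset.mul_sum, mul_neg_geom_sum]
  rw [e1] at h1
  have h2 := (h.tendsto_sum_lowerTerm hθ hB hBf 0).const_mul ((1 - θ⁻¹)⁻¹ * (1 - θ⁻¹ ^ S))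
  have e2 : (1 - θ⁻¹)⁻¹ * (1 - θ⁻¹ ^ S) * ((1 - θ⁻¹) * θ⁻¹ ^ 0 * Phi B) =
      (1 - θ⁻¹ ^ S) * Phi B := by
    rw [pow_zero, mul_one]
    generalize 1 - θ⁻¹ ^ S = y
    generalize 1 - θ⁻¹ = a at *
    field_simp
  rw [e2] at h2
  refine (h1.if' (p := g) h2).congr fun n => ?_
  unfold lowerFactor width
  split_ifs
  · simp_rw [one_mul]
    exact Finset.sum_comm
  · rw [Finset.mul_sum]
    simp

namespace IsWRT

variable {ι : Type*} [Fintype ι] [DecidableEq ι]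
  {Ω : Type*} [mΩ : MeasurableSpace Ω] {P : Measure Ω} [IsProbabilityMeasure P]
  {W : ℕ → Ω → ℝ} {A : ℕ → Ω → ℕ} {q₀ θ b β : ℝ}

/-- Lower bound for the joint factorial moments. -/
lemma eventually_lt_integral_tupleCount (hT : IsWRT P W A) (hatom : AtomCase P W q₀)
    (hθ : θ = theta P W) (hb : b < θ / (θ - 1)) (hβ : (1 - θ⁻¹) * β < 1)
    {d : ι → ℕ → ℕ} {D : ι → ℕ → ℝ} (hdt : ∀ l, Tendsto (d l) atTop atTop)
    (hd : ∀ l, ∀ᶠ n : ℕ in atTop, (d l n : ℝ) ≤ b * Real.log n)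
    (hDt : ∀ l, Tendsto (D l) atTop atTop)
    (hD : ∀ l, ∀ᶠ n : ℕ in atTop, D l n ≤ β * Real.log n)
    (hdD : ∀ l, Tendsto (fun n => ((d l n : ℝ) - D l n) / √(D l n)) atTop (𝓝 0))
    {B : ι → Set ℝ} (hB : ∀ l, MeasurableSet (B l)) (hBf : ∀ l, Phi (frontier (B l)) = 0)
    (g : ι → ℕ → Prop) {u : ℝ} (hu : u < ∏ l, (q₀ * Phi (B l))) :
    ∀ᶠ n : ℕ in atTop, u < (∏ l, modeFactor θ (g l n) * (θ ^ d l n / n)) *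
      ∫ ω, tupleCount (fun l v => (B l).indicator (1 : ℝ → ℝ) (lab (1 - θ⁻¹) n (D l n) v))
        (fun l => d l n) (fun l => width (g l n) n) n (fun m => A m ω) ∂P := by
  have hθ1 := hT.theta_gt_one hatom hθ
  have ha := one_sub_inv_pos hθ1
  obtain ⟨x, ε', ε, η, hx1, hxθ, hε', hε, hη, hη1, hηβ, hexp, hgood⟩ :=
    hT.exists_parameters hatom hθ hb hβ 1
  set σ : ℕ → ℝ := fun n => Fintype.card ι * (2 * (θ - 1)⁻¹) / ⌈(n : ℝ) ^ η⌉₊ with hσdef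
  have hadm : ∀ l, Admissible (1 - θ⁻¹) (d l) (D l) (fun n => ⌈(n : ℝ) ^ η⌉₊) := fun l =>
    .of_log_le ha.le (hdt l) (hDt l) (hdD l) (hD l) hη hηβ
  have hδlog : Tendsto (fun n : ℕ => (n : ℝ) ^ (-(η / 4)) * Real.log n) atTop (𝓝 0) := by
    simpa using tendsto_rpow_neg_mul_log_pow (r := η / 4) (by linarith) 1
  have hσlog : Tendsto (fun n : ℕ => σ n * Real.log n) atTop (𝓝 0) := by
    simpa using tendsto_cutoff_inv_mul_log_pow hη (Fintype.card ι * (2 * (θ - 1)⁻¹)) 1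
  have hσlog2 : Tendsto (fun n : ℕ => σ n * Real.log n ^ 2) atTop (𝓝 0) :=
    tendsto_cutoff_inv_mul_log_pow hη (Fintype.card ι * (2 * (θ - 1)⁻¹)) 2
  have hδ0 := tendsto_of_mul_log hδlog
  -- The bound `q log n` covers all degrees, each at most `b log n`, and all window widths, each at
  -- most `S + 1 ≤ log n` eventually. Without the truncation to `S` levels the widths would be of
  -- order `n` and the error terms would not vanish.
  set q : ℝ := Fintype.card ι * (b + 1) with hq
  have hC := tendsto_lower_const hθ1 (Fintype.card ι) q hδlog hσlog2
  have hQ2 : Tendsto (fun n : ℕ => (n : ℝ) ^ (-(η / 4)) + q * Real.log n * σ n * (θ - 1)) atTop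
      (𝓝 0) := by
    have := hδ0.add (hσlog.const_mul (q * (θ - 1)))
    rw [mul_zero, add_zero] at this
    exact this.congr fun n => by ring
  have hQ3 : Tendsto (fun n : ℕ => 1 - q * Real.log n *
      ((n : ℝ) ^ (-(η / 4)) + q * Real.log n * σ n * (θ - 1))) atTop (𝓝 1) := by
    have := ((hδlog.const_mul q).add (hσlog2.const_mul (q ^ 2 * (θ - 1)))).const_sub 1
    simp only [mul_zero, add_zero, sub_zero] at this
    exact this.congr fun n => by ring
  have hp : Tendsto (fun n : ℕ => P.real {ω | ¬ Good θ η ε ε' n fun i => W i ω}) atTop (𝓝 0) :=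
    squeeze_zero' (.of_forall fun n => measureReal_nonneg) hgood (tendsto_rpow_neg one_pos)
  have hprob := (hp.const_sub (q₀ ^ Fintype.card ι)).mul hC
  rw [sub_zero, mul_one] at hprob
  -- the number of levels kept in the lower bound
  obtain ⟨S, hS⟩ : ∃ S : ℕ, u < q₀ ^ Fintype.card ι * ∏ l, ((1 - θ⁻¹ ^ S) * Phi (B l)) := by
    have h1 : Tendsto (fun S : ℕ => θ⁻¹ ^ S) atTop (𝓝 0) :=
      tendsto_pow_atTop_nhds_zero_of_lt_one (by positivity) (inv_lt_one_of_one_lt₀ hθ1)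
    have h2 := (tendsto_finsetProd (Finset.univ : Finset ι) fun l _ =>
      (h1.const_sub 1).mul_const (Phi (B l))).const_mul (q₀ ^ Fintype.card ι)
    simp only [sub_zero, one_mul] at h2
    rw [Finset.prod_mul_distrib, Finset.prod_const, Finset.card_univ] at hu
    exact (h2.eventually_const_lt hu).exists
  have hF := fun l => (hadm l).tendsto_lowerFactor_mul hθ1 (hB l) (hBf l) S (g l)
  -- A bound for the contribution of one vertex. It tends to zero, so the correction for repeated
  -- entries disappears in the limit.
  set R : ℕ → ℝ := fun n => (1 - θ⁻¹)⁻¹ * ((S + 1 : ℕ) * (1 / ((⌈(n : ℝ) ^ η⌉₊ : ℝ) - 1))) with hR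
  have hRlim : Tendsto R atTop (𝓝 0) := by
    have h1 : Tendsto (fun n : ℕ => (⌈(n : ℝ) ^ η⌉₊ : ℝ) - 1) atTop atTop :=
      tendsto_atTop_add_const_right _ _
        (tendsto_natCast_atTop_atTop.comp (tendsto_cutoff_atTop hη))
    have h2 := ((tendsto_inv_atTop_zero.comp h1).const_mul ((S + 1 : ℕ) : ℝ)).const_mul (1 - θ⁻¹)⁻¹
    simp only [mul_zero] at h2
    exact h2.congr fun n => by simp [hR]
  have herr := (tendsto_finsetProd (Finset.univ : Finset ι) fun l _ => hF l).sub
    (tendsto_finsetSum (Finset.univ : Finset ι) fun l₁ _ =>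
      tendsto_finsetSum (Finset.univ : Finset ι) fun l₂ _ =>
        hRlim.abs.mul (tendsto_finsetProd (Finset.univ.erase l₁) fun l _ => hF l))
  simp only [abs_zero, zero_mul, Finset.sum_const_zero, sub_zero] at herr
  have hlim := hprob.mul herr
  filter_upwards [hlim.eventually_const_lt hS, hδ0.eventually_le_const
    (show (0 : ℝ) < 1 / 2 by norm_num), (tendsto_of_mul_log hσlog).eventually_le_const
    (show (0 : ℝ) < 1 / 2 by norm_num), (tendsto_cutoff_atTop hη).eventually_ge_atTop 2,
    eventually_ge_atTop (S + 1), hQ2.eventually_le_const one_pos,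
    hQ3.eventually_const_le one_pos, hprob.eventually_const_le (u := 0) (by
      have := hatom.q₀_mem.1
      positivity),
    eventually_all.2 hd, tendsto_log_natCast_atTop.eventually_ge_atTop ((S + 1 : ℕ) : ℝ)]
    with n h1 h2 h3 h4 h5 h6 h7 h8 h9 h10
  refine lt_of_lt_of_le h1 ?_
  have hwidth : ∀ g : Prop, width g S ≤ S + 1 := fun g => by
    unfold width
    split_ifs <;> omega
  have hwidth' : ∀ g : Prop, width g S ≤ width g n := fun g => by
    unfold width
    split_ifs <;> omega
  have hn : 1 ≤ n := by omega
  have hQ : ∑ l, ((d l n : ℝ) + width (g l n) S) ≤ q * Real.log n := by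
    have : ∑ l, ((d l n : ℝ) + width (g l n) S) ≤ ∑ _l : ι, (b + 1) * Real.log n := by
      refine Finset.sum_le_sum fun l _ => ?_
      have h11 : (width (g l n) S : ℝ) ≤ ((S + 1 : ℕ) : ℝ) := by exact_mod_cast hwidth _
      have := h9 l
      linarith
    refine this.trans (le_of_eq ?_)
    rw [Finset.sum_const, nsmul_eq_mul, Finset.card_univ, hq]
    ring
  have hlow := hT.le_integral_tupleCount hatom hθ1 (ε := ε) (ε' := ε') h2 h4
    (σ := σ n) (mul_div_assoc _ _ _).ge h3 hn (d := fun l => d l n)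
    (r := fun l => width (g l n) n) (r' := fun l => width (g l n) S)
    (fun l => hwidth' _) (fun l => D l n) B hQ h6 h7
  set M : ℝ := ∏ l, θ ^ d l n / (n : ℝ) with hM
  set I := ∫ ω, tupleCount (fun l v => (B l).indicator (1 : ℝ → ℝ) (lab (1 - θ⁻¹) n (D l n) v))
        (fun l => d l n) (fun l => width (g l n) n) n (fun m => A m ω) ∂P with hI
  have hM0 : 0 ≤ M := Finset.prod_nonneg fun l _ => by positivity
  have hI0 : 0 ≤ I := integral_nonneg fun ω =>
    tupleCount_nonneg (fun l v => Set.indicator_nonneg (fun _ _ => zero_le_one) _) _ _ _ _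
  have hlf0 : 0 ≤ ∏ l, lowerFactor θ S (g l n) :=
    Finset.prod_nonneg fun l _ => lowerFactor_nonneg hθ1 _ _
  have hinj := le_sum_injective (s := Finset.Icc ⌈(n : ℝ) ^ η⌉₊ n)
    (F := fun l v => lowerFactor θ S (g l n) *
      ∑ s ∈ Finset.range (width (g l n) S), lowerTerm θ (d l n) (D l n) (B l) n s v) (R := R n)
    (fun l v _ => mul_nonneg (lowerFactor_nonneg hθ1 _ _)
      (Finset.sum_nonneg fun s _ => lowerTerm_nonneg hθ1 _ _ _ _ _ _))
    (fun l v hv => by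
      rw [Finset.mem_Icc] at hv
      have h11 : (1 : ℝ) < ⌈(n : ℝ) ^ η⌉₊ := by exact_mod_cast h4
      have h12 : ∑ s ∈ Finset.range (width (g l n) S), lowerTerm θ (d l n) (D l n) (B l) n s v ≤
          (S + 1 : ℕ) * (1 / ((⌈(n : ℝ) ^ η⌉₊ : ℝ) - 1)) := by
        refine (Finset.sum_le_sum fun s _ => lowerTerm_le hθ1 _ _ _ h4 hv.1 hv.2).trans ?_
        rw [Finset.sum_const, Finset.card_range, nsmul_eq_mul]
        refine mul_le_mul_of_nonneg_right (by exact_mod_cast hwidth _)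
          (one_div_nonneg.2 (by linarith))
      refine mul_le_mul ((lowerFactor_le hθ1 _ _).trans (modeFactor_le hθ1 _)) h12
        (Finset.sum_nonneg fun s _ => lowerTerm_nonneg hθ1 _ _ _ _ _ _) (by positivity))
  calc _ ≤ _ := mul_le_mul_of_nonneg_left hinj h8
    _ = (∏ l, lowerFactor θ S (g l n)) * _ := by
        simp_rw [Finset.prod_mul_distrib]
        rw [← Finset.mul_sum, mul_left_comm]
    _ ≤ (∏ l, lowerFactor θ S (g l n)) * (M * I) := mul_le_mul_of_nonneg_left hlow hlf0
    _ ≤ (∏ l, modeFactor θ (g l n)) * (M * I) := by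
        refine mul_le_mul_of_nonneg_right (Finset.prod_le_prod
          (fun l _ => lowerFactor_nonneg hθ1 _ _) fun l _ => lowerFactor_le hθ1 _ _)
          (mul_nonneg hM0 hI0)
    _ = _ := by rw [Finset.prod_mul_distrib, mul_assoc]

/-- Convergence of the normalised joint factorial moments. -/
theorem tendsto_integral_tupleCount (hT : IsWRT P W A) (hatom : AtomCase P W q₀)
    (hθ : θ = theta P W) (hb : b < θ / (θ - 1)) (hβ : (1 - θ⁻¹) * β < 1)
    {d : ι → ℕ → ℕ} {D : ι → ℕ → ℝ} (hdt : ∀ l, Tendsto (d l) atTop atTop)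
    (hd : ∀ l, ∀ᶠ n : ℕ in atTop, (d l n : ℝ) ≤ b * Real.log n)
    (hDt : ∀ l, Tendsto (D l) atTop atTop)
    (hD : ∀ l, ∀ᶠ n : ℕ in atTop, D l n ≤ β * Real.log n)
    (hdD : ∀ l, Tendsto (fun n => ((d l n : ℝ) - D l n) / √(D l n)) atTop (𝓝 0))
    {B : ι → Set ℝ} (hB : ∀ l, MeasurableSet (B l)) (hBf : ∀ l, Phi (frontier (B l)) = 0)
    (g : ι → ℕ → Prop) :
    Tendsto (fun n : ℕ => (∏ l, modeFactor θ (g l n) * (θ ^ d l n / n)) *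
      ∫ ω, tupleCount (fun l v => (B l).indicator (1 : ℝ → ℝ) (lab (1 - θ⁻¹) n (D l n) v))
        (fun l => d l n) (fun l => width (g l n) n) n (fun m => A m ω) ∂P) atTop
      (𝓝 (∏ l, (q₀ * Phi (B l)))) :=
  tendsto_order.2
    ⟨fun _ hu => hT.eventually_lt_integral_tupleCount hatom hθ hb hβ hdt hd hDt hD hdD hB hBf g hu,
      fun _ hu => hT.eventually_integral_tupleCount_lt hatom hθ hb hβ hdt hd hDt hD hdD hB hBf g hu⟩

end IsWRT

/-! ### Factorial powers as tuple counts -/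

/-- Tuples of distinct elements of disjoint sets, blockwise. -/
def blockEmbeddingEquiv {κ : Type*} (c : κ → ℕ) (S : κ → Finset ℕ)
    (hS : ∀ k k', k ≠ k' → Disjoint (S k) (S k')) :
    (∀ k, Fin (c k) ↪ S k) ≃
      {v : (Σ k, Fin (c k)) → ℕ // Function.Injective v ∧ ∀ l, v l ∈ S l.1} where
  toFun f := ⟨fun l => f l.1 l.2, by
    rintro ⟨k, i⟩ ⟨k', i'⟩ h
    by_cases hk : k = k'
    · subst hk
      simp only at h
      rw [(f k).injective (Subtype.ext h)]
    · exact absurd h (Finset.disjoint_iff_ne.1 (hS k k' hk) _ (f k i).2 _ (f k' i').2),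
    fun l => (f l.1 l.2).2⟩
  invFun v k := ⟨fun i => ⟨v.1 ⟨k, i⟩, v.2.2 ⟨k, i⟩⟩, fun i i' h => by
    have := v.2.1 (Subtype.ext_iff.1 h)
    simpa using this⟩
  left_inv f := rfl
  right_inv v := rfl

lemma prod_descFactorial_eq_card {κ : Type*} [Fintype κ] [DecidableEq κ] (c : κ → ℕ)
    (S : κ → Finset ℕ) (hS : ∀ k k', k ≠ k' → Disjoint (S k) (S k')) {T : Finset ℕ}
    (hST : ∀ k, S k ⊆ T) :
    ∏ k, (S k).card.descFactorial (c k) =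
      (((Fintype.piFinset fun _ : (Σ k, Fin (c k)) => T).filter Function.Injective).filter
        fun v => ∀ l, v l ∈ S l.1).card := by
  have h1 : Fintype.card (∀ k, Fin (c k) ↪ S k) = ∏ k, (S k).card.descFactorial (c k) := by
    rw [Fintype.card_pi]
    exact Finset.prod_congr rfl fun k _ => by simp [Fintype.card_embedding_eq]
  rw [← h1, ← Nat.card_eq_fintype_card, Nat.card_congr (blockEmbeddingEquiv c S hS)]
  refine Nat.subtype_card _ fun v => ?_
  simp only [Finset.mem_filter, Fintype.mem_piFinset]
  exact ⟨fun h => ⟨h.1.2, h.2⟩, fun h => ⟨⟨fun l => hST _ (h.2 l), h.1⟩, h.2⟩⟩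

lemma prod_Icc_mul_prod_Icc {M : Type*} [CommMonoid M] {K' K : ℕ} (h : K' ≤ K) (f g : ℕ → M) :
    (∏ k ∈ Finset.Icc 1 K', f k) * ∏ k ∈ Finset.Icc (K' + 1) K, g k =
      ∏ k : Finset.Icc 1 K, if K' < (k : ℕ) then g k else f k := by
  rw [Finset.prod_coe_sort (Finset.Icc 1 K) (fun k => if K' < k then g k else f k)]
  have h1 : ∏ k ∈ Finset.Icc 1 K', f k = ∏ k ∈ Finset.Ioc 0 K', if K' < k then g k else f k :=
    Finset.prod_congr (by ext; simp only [Finset.mem_Icc, Finset.mem_Ioc]; omega) fun k hk => by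
      rw [if_neg (by have := (Finset.mem_Ioc.1 hk).2; omega)]
  have h2 : ∏ k ∈ Finset.Icc (K' + 1) K, g k =
      ∏ k ∈ Finset.Ioc K' K, if K' < k then g k else f k :=
    Finset.prod_congr (by ext; simp only [Finset.mem_Icc, Finset.mem_Ioc]; omega) fun k hk => by
      rw [if_pos (Finset.mem_Ioc.1 hk).1]
  have h3 : Finset.Icc 1 K = Finset.Ioc 0 K := by ext; simp only [Finset.mem_Icc, Finset.mem_Ioc]; omega
  rw [h1, h2, h3, Finset.prod_Ioc_consecutive _ (Nat.zero_le _) h]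

lemma deg_lt (a : ℕ → ℕ) {n : ℕ} (hn : 1 ≤ n) (v : ℕ) : deg a n v < n := by
  have h := Finset.card_filter_le (Finset.Ico 1 n) (fun m => a m = v)
  rw [Nat.card_Ico] at h
  unfold deg
  omega

lemma degInd_one (d k : ℕ) : degInd d 1 k = if k = d then 1 else 0 := by
  unfold degInd
  congr 1
  simp only [eq_iff_iff]
  omega

lemma degInd_of_lt {d n k : ℕ} (h : k < n) : degInd d n k = if d ≤ k then 1 else 0 := by
  unfold degInd
  congr 1
  simp only [eq_iff_iff]
  omega

open Classical in
/-- The product of factorial powers counts tuples of distinct vertices. -/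
lemma prod_descFactorial_eq_tupleCount {K' K n : ℕ} (hK : K' ≤ K) (hn : 1 ≤ n) (d : ℕ → ℕ)
    (p : ℕ → ℕ → Prop) (c : ℕ → ℕ) (a : ℕ → ℕ)
    (hge : ∀ k, K' < k → k ≤ K → d k = d K) (hlt : ∀ k, 1 ≤ k → k ≤ K' → d k < d K)
    (hp : ∀ k ∈ Set.Icc 1 K, ∀ k' ∈ Set.Icc 1 K, k ≠ k' → d k = d k' → ∀ i, p k i → ¬ p k' i) :
    (∏ k ∈ Finset.Icc 1 K', ((((Finset.Icc 1 n).filter fun i =>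
        deg a n i = d k ∧ p k i).card.descFactorial (c k) : ℕ) : ℝ)) *
      ∏ k ∈ Finset.Icc (K' + 1) K, ((((Finset.Icc 1 n).filter fun i =>
        d k ≤ deg a n i ∧ p k i).card.descFactorial (c k) : ℕ) : ℝ) =
    tupleCount (ι := Σ k : Finset.Icc 1 K, Fin (c k)) (fun l v => if p l.1 v then 1 else 0)
      (fun l => d l.1) (fun l => width (K' < (l.1 : ℕ)) n) n a := by
  set S : Finset.Icc 1 K → Finset ℕ := fun k => (Finset.Icc 1 n).filter fun i =>
    (if K' < (k : ℕ) then d k ≤ deg a n i else deg a n i = d k) ∧ p k i with hSdef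
  have hmem : ∀ k i, i ∈ S k ↔ i ∈ Finset.Icc 1 n ∧
      (if K' < (k : ℕ) then d k ≤ deg a n i else deg a n i = d k) ∧ p k i := fun k i => by
    rw [hSdef]
    exact Finset.mem_filter
  -- Disjointness turns tuples that are injective in each block into globally injective ones. Blocks
  -- with equal `d` are separated by `p`; otherwise either two distinct exact degrees are
  -- prescribed, or an exact degree below `d K` meets degrees at least `d K`.
  have hS : ∀ k k', k ≠ k' → Disjoint (S k) (S k') := by
    intro k k' hk
    rw [Finset.disjoint_left]
    intro i hi hi'
    rw [hmem] at hi hi'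
    have hk1 := Finset.mem_Icc.1 k.2
    have hk2 := Finset.mem_Icc.1 k'.2
    have hne : (k : ℕ) ≠ k' := fun h => hk (Subtype.ext h)
    by_cases heq : d k = d k'
    · exact hp k hk1 k' hk2 hne heq i hi.2.2 hi'.2.2
    · have h1 := hi.2.1
      have h2 := hi'.2.1
      split_ifs at h1 h2 with h3 h4 h4
      · exact heq ((hge k h3 hk1.2).trans (hge k' h4 hk2.2).symm)
      · have := hge k h3 hk1.2
        have := hlt k' hk2.1 (not_lt.1 h4)
        omega
      · have := hge k' h4 hk2.2
        have := hlt k hk1.1 (not_lt.1 h3)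
        omega
      · omega
  rw [prod_Icc_mul_prod_Icc hK]
  have h1 : ∀ k : Finset.Icc 1 K, (if K' < (k : ℕ) then ((((Finset.Icc 1 n).filter fun i =>
        d k ≤ deg a n i ∧ p k i).card.descFactorial (c k) : ℕ) : ℝ) else
        ((((Finset.Icc 1 n).filter fun i =>
        deg a n i = d k ∧ p k i).card.descFactorial (c k) : ℕ) : ℝ)) =
      (((S k).card.descFactorial (c k) : ℕ) : ℝ) := by
    intro k
    split_ifs with h <;> simp only [hSdef, h, if_true, if_false]
  rw [Finset.prod_congr rfl fun k _ => h1 k, ← Nat.cast_prod,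
    prod_descFactorial_eq_card (fun k : Finset.Icc 1 K => c k) S hS (T := Finset.Icc 1 n)
      (fun k => Finset.filter_subset _ _), tupleCount, Finset.card_filter, Nat.cast_sum]
  refine Finset.sum_congr ?_ fun v hv => ?_
  · congr!
  · have hterm : ∀ l : (Σ k : Finset.Icc 1 K, Fin (c k)),
        ((if p l.1 (v l) then 1 else 0) : ℝ) *
          degInd (d l.1) (width (K' < (l.1 : ℕ)) n) (deg a n (v l)) =
        if v l ∈ S l.1 then 1 else 0 := by
      intro l
      have hvl : v l ∈ Finset.Icc 1 n := Fintype.mem_piFinset.1 (Finset.mem_filter.1 hv).1 l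
      by_cases hl : K' < (l.1 : ℕ)
      · have : (v l ∈ S l.1) ↔ (d l.1 ≤ deg a n (v l) ∧ p l.1 (v l)) := by
          rw [hmem, if_pos hl]
          exact and_iff_right hvl
        simp only [width, if_pos hl, degInd_of_lt (deg_lt a hn (v l)), this]
        by_cases h2 : p l.1 (v l) <;> by_cases h3 : d l.1 ≤ deg a n (v l) <;> simp [h2, h3]
      · have : (v l ∈ S l.1) ↔ (deg a n (v l) = d l.1 ∧ p l.1 (v l)) := by
          rw [hmem, if_neg hl]
          exact and_iff_right hvl
        simp only [width, if_neg hl, degInd_one, this]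
        by_cases h2 : p l.1 (v l) <;> by_cases h3 : deg a n (v l) = d l.1 <;> simp [h2, h3]
    rw [Finset.prod_congr rfl fun l _ => hterm l]
    split_ifs with h
    · rw [Finset.prod_eq_one fun l _ => if_pos (h l)]
      simp
    · push Not at h
      obtain ⟨l, hl⟩ := h
      rw [Finset.prod_eq_zero (Finset.mem_univ l) (if_neg hl)]
      simp

/-! ### Degree levels, label normalisations and the asymptotic value -/

section Cutoff

variable {K : ℕ} {j : ℕ → ℤ}

lemma cutoff_lt (hK : 1 ≤ K) : cutoff K j < K := by
  have h : K - 1 ∈ {k : ℕ | j (k + 1) = j K} := by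
    simp [Nat.sub_add_cancel hK]
  have := Nat.sInf_le h
  unfold cutoff
  omega

lemma eq_of_cutoff_lt (hK : 1 ≤ K) (hj : MonotoneOn j (Set.Icc 1 K)) {k : ℕ}
    (hk : cutoff K j < k) (hkK : k ≤ K) : j k = j K := by
  have h : K - 1 ∈ {k : ℕ | j (k + 1) = j K} := by
    simp [Nat.sub_add_cancel hK]
  have h1 : j (cutoff K j + 1) = j K := Nat.sInf_mem ⟨_, h⟩
  have h2 := cutoff_lt (j := j) hK
  refine le_antisymm (hj ⟨by omega, hkK⟩ ⟨hK, le_rfl⟩ hkK) ?_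
  rw [← h1]
  exact hj ⟨by omega, by omega⟩ ⟨by omega, hkK⟩ (by omega)

lemma lt_of_le_cutoff (hK : 1 ≤ K) (hj : MonotoneOn j (Set.Icc 1 K)) {k : ℕ} (hk1 : 1 ≤ k)
    (hk : k ≤ cutoff K j) : j k < j K := by
  have h2 := cutoff_lt (j := j) hK
  refine lt_of_le_of_ne (hj ⟨hk1, by omega⟩ ⟨hK, le_rfl⟩ (by omega)) fun h => ?_
  have h3 : k - 1 ∉ {k : ℕ | j (k + 1) = j K} :=
    Nat.notMem_of_lt_sInf (show k - 1 < cutoff K j by omega)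
  exact h3 (by simpa [Nat.sub_add_cancel hk1] using h)

end Cutoff

lemma level_le (θ : ℝ) (n : ℕ) (j : ℤ) : (level θ n j : ℝ) ≤ j + Real.logb θ n := by
  unfold level
  push_cast
  have := Int.floor_le (Real.logb θ n)
  linarith

lemma lt_level (θ : ℝ) (n : ℕ) (j : ℤ) : j + Real.logb θ n - 1 < level θ n j := by
  unfold level
  push_cast
  have := Int.lt_floor_add_one (Real.logb θ n)
  linarith

lemma labelDeg_eq {θ : ℝ} (hθ : 1 < θ) (n : ℕ) (j : ℤ) (i : ℕ) :
    labelDeg θ n j i = lab (1 - θ⁻¹) n (level θ n j) i := by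
  unfold labelDeg lab
  rw [Real.sqrt_mul (sq_nonneg _), Real.sqrt_sq (one_sub_inv_pos hθ).le]

/-- Since `(1 - μ) log n = (1 - θ⁻¹) log_θ n` and `(1 - σ²) log n = (1 - θ⁻¹)² log_θ n`, this
normalisation is that of `lab` with `D = log_θ n` in place of the degree. -/
lemma labelMu_eq {θ : ℝ} (hθ : 1 < θ) (n : ℕ) (i : ℕ) :
    labelMu θ n i = lab (1 - θ⁻¹) n (Real.logb θ n) i := by
  have hlog : 0 < Real.log θ := Real.log_pos hθ
  unfold labelMu lab mu sigmaSq Real.logb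
  have e1 : (1 - (1 - (θ - 1) ^ 2 / (θ ^ 2 * Real.log θ))) * Real.log n =
      (1 - θ⁻¹) ^ 2 * (Real.log n / Real.log θ) := by
    field_simp
    ring
  rw [e1, Real.sqrt_mul (sq_nonneg _), Real.sqrt_sq (one_sub_inv_pos hθ).le]
  congr 1
  field_simp

/-- The exact relation between the normalisation and the asymptotic value. -/
lemma modeFactor_mul_momentValue {q₀ θ : ℝ} (hθ : 1 < θ) {K n : ℕ} (hK : 1 ≤ K) (hn : 1 ≤ n)
    {j : ℕ → ℤ} (hj : MonotoneOn j (Set.Icc 1 K)) (B : ℕ → Set ℝ) (c : ℕ → ℕ)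
    (hlev : ∀ k ∈ Set.Icc 1 K, 0 ≤ level θ n (j k)) :
    (∏ l : (Σ k : Finset.Icc 1 K, Fin (c k)), modeFactor θ (cutoff K j < (l.1 : ℕ)) *
      (θ ^ (level θ n (j l.1)).toNat / n)) * momentValue q₀ θ K n j B c =
    ∏ l : (Σ k : Finset.Icc 1 K, Fin (c k)), (q₀ * Phi (B l.1)) := by
  have ha := one_sub_inv_pos hθ
  have hn' : (0 : ℝ) < n := by exact_mod_cast hn
  have hθ0 : 0 < θ := by linarith
  rw [momentValue, prod_Icc_mul_prod_Icc (cutoff_lt hK).le]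
  simp_rw [Fintype.prod_sigma, Finset.prod_const, Finset.card_univ, Fintype.card_fin]
  rw [← Finset.prod_mul_distrib]
  refine Finset.prod_congr rfl fun k _ => ?_
  have hk := Finset.mem_Icc.1 k.2
  -- The exponents add up to `⌊log_θ n⌋ + ε_n = log_θ n`, so the relation between the normalisations
  -- is exact.
  have hpow : θ ^ (level θ n (j k)).toNat * θ ^ (-(j k : ℝ) + eps θ n) = n := by
    rw [← Real.rpow_natCast θ, ← Real.rpow_add hθ0]
    have e : (((level θ n (j k)).toNat : ℕ) : ℝ) = level θ n (j k) := by
      exact_mod_cast Int.toNat_of_nonneg (hlev k hk)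
    have e2 : (((level θ n (j k)).toNat : ℕ) : ℝ) + (-(j k : ℝ) + eps θ n) = Real.logb θ n := by
      rw [e, level, eps]
      push_cast
      ring
    rw [e2, Real.rpow_logb hθ0 hθ.ne' hn']
  have e3 : θ ^ (level θ n (j k)).toNat / n * θ ^ (-(j k : ℝ) + eps θ n) = 1 := by
    rw [div_mul_eq_mul_div, hpow, div_self hn'.ne']
  unfold modeFactor
  split_ifs with h
  · rw [← mul_pow, ← eq_of_cutoff_lt hK hj h hk.2]
    congr 1
    calc _ = q₀ * Phi (B k) *
          (θ ^ (level θ n (j k)).toNat / n * θ ^ (-(j k : ℝ) + eps θ n)) := by ring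
      _ = _ := by rw [e3, mul_one]
  · rw [← mul_pow]
    congr 1
    calc _ = q₀ * Phi (B k) * ((1 - θ⁻¹)⁻¹ * (1 - θ⁻¹)) *
          (θ ^ (level θ n (j k)).toNat / n * θ ^ (-(j k : ℝ) + eps θ n)) := by ring
      _ = _ := by rw [e3, mul_one, inv_mul_cancel₀ ha.ne', mul_one]

lemma tendsto_logb_natCast {θ : ℝ} (hθ : 1 < θ) :
    Tendsto (fun n : ℕ => Real.logb θ n) atTop atTop :=
  (Real.tendsto_logb_atTop hθ).comp tendsto_natCast_atTop_atTop

open Classical in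
lemma X_eq {θ : ℝ} (hθ : 1 < θ) {Ω : Type*} (A : ℕ → Ω → ℕ) (n : ℕ) (j : ℤ) (B : Set ℝ)
    (ω : Ω) : X A θ n j B ω = ((Finset.Icc 1 n).filter fun i =>
      (inDegree A n i ω : ℤ) = level θ n j ∧ lab (1 - θ⁻¹) n (level θ n j) i ∈ B).card := by
  unfold X
  congr 1
  exact Finset.filter_congr fun i _ => by rw [labelDeg_eq hθ]

open Classical in
lemma XGe_eq {θ : ℝ} (hθ : 1 < θ) {Ω : Type*} (A : ℕ → Ω → ℕ) (n : ℕ) (j : ℤ) (B : Set ℝ)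
    (ω : Ω) : XGe A θ n j B ω = ((Finset.Icc 1 n).filter fun i =>
      level θ n j ≤ (inDegree A n i ω : ℤ) ∧ lab (1 - θ⁻¹) n (level θ n j) i ∈ B).card := by
  unfold XGe
  congr 1
  exact Finset.filter_congr fun i _ => by rw [labelDeg_eq hθ]

open Classical in
lemma XTilde_eq {θ : ℝ} (hθ : 1 < θ) {Ω : Type*} (A : ℕ → Ω → ℕ) (n : ℕ) (j : ℤ) (B : Set ℝ)
    (ω : Ω) : XTilde A θ n j B ω = ((Finset.Icc 1 n).filter fun i =>
      (inDegree A n i ω : ℤ) = level θ n j ∧ lab (1 - θ⁻¹) n (Real.logb θ n) i ∈ B).card := by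
  unfold XTilde
  congr 1
  exact Finset.filter_congr fun i _ => by rw [labelMu_eq hθ]

open Classical in
lemma XTildeGe_eq {θ : ℝ} (hθ : 1 < θ) {Ω : Type*} (A : ℕ → Ω → ℕ) (n : ℕ) (j : ℤ) (B : Set ℝ)
    (ω : Ω) : XTildeGe A θ n j B ω = ((Finset.Icc 1 n).filter fun i =>
      level θ n j ≤ (inDegree A n i ω : ℤ) ∧ lab (1 - θ⁻¹) n (Real.logb θ n) i ∈ B).card := by
  unfold XTildeGe
  congr 1
  exact Finset.filter_congr fun i _ => by rw [labelMu_eq hθ]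

/-! ### Assembling the asymptotics -/

open Classical in
/-- The asymptotics of the joint factorial moments, for labels normalised by means of general
sequences `D k`. -/
theorem IsWRT.isEquivalent_momentValue {Ω : Type*} [MeasurableSpace Ω] {P : Measure Ω}
    [IsProbabilityMeasure P] {W : ℕ → Ω → ℝ} {A : ℕ → Ω → ℕ} (hT : IsWRT P W A)
    {q₀ : ℝ} (hatom : AtomCase P W q₀) {θ : ℝ} (hθ : θ = theta P W)
    {b β : ℝ} (hb : b < θ / (θ - 1)) (hβ : (1 - θ⁻¹) * β < 1) {K : ℕ} (hK : 1 ≤ K) {j : ℕ → ℕ → ℤ}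
    (hj_mono : ∀ᶠ n in atTop, MonotoneOn (j n) (Set.Icc 1 K))
    (hj_low : Tendsto (fun n : ℕ => (j n 1 : ℝ) + Real.logb θ n) atTop atTop)
    (hj_up : ∀ᶠ n : ℕ in atTop, (j n K : ℝ) + Real.logb θ n < b * Real.log n)
    {B : ℕ → Set ℝ}
    (hB_meas : ∀ k ∈ Set.Icc 1 K, MeasurableSet (B k))
    (hB_frontier : ∀ k ∈ Set.Icc 1 K, Phi (frontier (B k)) = 0)
    (hB_pos : ∀ k ∈ Set.Icc 1 K, (B k).Nonempty → 0 < Phi (B k))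
    (hB_disj : ∀ᶠ n in atTop, ∀ k ∈ Set.Icc 1 K, ∀ l ∈ Set.Icc 1 K,
      k ≠ l → j n k = j n l → Disjoint (B k) (B l))
    (c : ℕ → ℕ) {D : ℕ → ℕ → ℝ} (hDj : ∀ n k k', j n k = j n k' → D k n = D k' n)
    (hDt : ∀ k ∈ Set.Icc 1 K, Tendsto (D k) atTop atTop)
    (hD : ∀ k ∈ Set.Icc 1 K, ∀ᶠ n : ℕ in atTop, D k n ≤ β * Real.log n)
    (hdD : ∀ k ∈ Set.Icc 1 K,
      Tendsto (fun n => ((level θ n (j n k) : ℝ) - D k n) / √(D k n)) atTop (𝓝 0)) :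
    (fun n : ℕ => ∫ ω,
        (∏ k ∈ Finset.Icc 1 (cutoff K (j n)), ((((Finset.Icc 1 n).filter fun i =>
          (inDegree A n i ω : ℤ) = level θ n (j n k) ∧
            lab (1 - θ⁻¹) n (D k n) i ∈ B k).card.descFactorial (c k) : ℕ) : ℝ)) *
        ∏ k ∈ Finset.Icc (cutoff K (j n) + 1) K, ((((Finset.Icc 1 n).filter fun i =>
          level θ n (j n k) ≤ (inDegree A n i ω : ℤ) ∧
            lab (1 - θ⁻¹) n (D k n) i ∈ B k).card.descFactorial (c k) : ℕ) : ℝ) ∂P)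
      ~[atTop] fun n => momentValue q₀ θ K n (j n) B c := by
  have hθ1 := hT.theta_gt_one hatom hθ
  have hmono : ∀ᶠ n : ℕ in atTop, ∀ k ∈ Set.Icc 1 K, j n 1 ≤ j n k ∧ j n k ≤ j n K := by
    filter_upwards [hj_mono] with n h k hk
    exact ⟨h ⟨le_rfl, hK⟩ hk hk.1, h hk ⟨hK, le_rfl⟩ hk.2⟩
  have hlevt : ∀ k ∈ Set.Icc 1 K, Tendsto (fun n : ℕ => (level θ n (j n k) : ℝ)) atTop atTop := by
    intro k hk
    refine tendsto_atTop_mono' _ ?_ (tendsto_atTop_add_const_right _ (-1) hj_low)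
    filter_upwards [hmono] with n h
    have h1 := lt_level θ n (j n k)
    have h2 : (j n 1 : ℝ) ≤ j n k := by exact_mod_cast (h k hk).1
    linarith
  have hlev0 : ∀ᶠ n : ℕ in atTop, ∀ k ∈ Set.Icc 1 K, 0 ≤ level θ n (j n k) := by
    have : ∀ᶠ n : ℕ in atTop, ∀ k ∈ Finset.Icc 1 K, 0 ≤ level θ n (j n k) := by
      rw [Finset.eventually_all]
      intro k hk
      filter_upwards [(hlevt k (Finset.mem_Icc.1 hk)).eventually_ge_atTop 0] with n h
      exact_mod_cast h
    filter_upwards [this] with n h k hk using h k (Finset.mem_Icc.2 hk)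
  set d : ℕ → ℕ → ℕ := fun k n => (level θ n (j n k)).toNat with hddef
  have hdcast : ∀ k ∈ Set.Icc 1 K, ∀ᶠ n : ℕ in atTop, (level θ n (j n k) : ℝ) = d k n := by
    intro k hk
    filter_upwards [hlev0] with n h
    exact_mod_cast (Int.toNat_of_nonneg (h k hk)).symm
  have hmem : ∀ l : (Σ k : Finset.Icc 1 K, Fin (c k)), (l.1 : ℕ) ∈ Set.Icc 1 K :=
    fun l => Finset.mem_Icc.1 l.1.2
  -- One tuple coordinate for each factor of each falling factorial; an index `k` with `c k = 0` has
  -- none.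
  have hlim := hT.tendsto_integral_tupleCount (ι := Σ k : Finset.Icc 1 K, Fin (c k)) hatom hθ hb hβ
    (d := fun l => d l.1) (D := fun l => D l.1) (B := fun l => B l.1)
    (fun l => tendsto_natCast_atTop_iff (R := ℝ).1
      ((hlevt _ (hmem l)).congr' (hdcast _ (hmem l))))
    (fun l => by
      filter_upwards [hdcast _ (hmem l), hj_up, hmono] with n h1 h2 h3
      rw [← h1]
      have h4 := level_le θ n (j n l.1)
      have h5 : (j n l.1 : ℝ) ≤ j n K := by exact_mod_cast (h3 _ (hmem l)).2
      linarith)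
    (fun l => hDt _ (hmem l)) (fun l => hD _ (hmem l))
    (fun l => (hdD _ (hmem l)).congr' (by
      filter_upwards [hdcast _ (hmem l)] with n h1
      rw [h1]))
    (fun l => hB_meas _ (hmem l)) (fun l => hB_frontier _ (hmem l))
    (fun l n => cutoff K (j n) < (l.1 : ℕ))
  -- rewriting the factorial moments as expected numbers of tuples
  have hcount : ∀ᶠ n : ℕ in atTop, ∀ ω,
        (∏ k ∈ Finset.Icc 1 (cutoff K (j n)), ((((Finset.Icc 1 n).filter fun i =>
          (inDegree A n i ω : ℤ) = level θ n (j n k) ∧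
            lab (1 - θ⁻¹) n (D k n) i ∈ B k).card.descFactorial (c k) : ℕ) : ℝ)) *
        ∏ k ∈ Finset.Icc (cutoff K (j n) + 1) K, ((((Finset.Icc 1 n).filter fun i =>
          level θ n (j n k) ≤ (inDegree A n i ω : ℤ) ∧
            lab (1 - θ⁻¹) n (D k n) i ∈ B k).card.descFactorial (c k) : ℕ) : ℝ) =
      tupleCount (ι := Σ k : Finset.Icc 1 K, Fin (c k))
        (fun l v => (B l.1).indicator (1 : ℝ → ℝ) (lab (1 - θ⁻¹) n (D l.1 n) v))
        (fun l => d l.1 n) (fun l => width (cutoff K (j n) < (l.1 : ℕ)) n) n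
        (fun m => A m ω) := by
    filter_upwards [hj_mono, hlev0, hB_disj, eventually_ge_atTop 1] with n h1 h2 h3 hn ω
    have hcutK := cutoff_lt (j := j n) hK
    have hto : ∀ k ∈ Set.Icc 1 K, ((d k n : ℕ) : ℤ) = level θ n (j n k) := fun k hk =>
      Int.toNat_of_nonneg (h2 k hk)
    have hdj : ∀ k ∈ Set.Icc 1 K, ∀ k' ∈ Set.Icc 1 K, d k n = d k' n → j n k = j n k' := by
      intro k hk k' hk' h
      have e1 := hto k hk
      have e2 := hto k' hk'
      rw [h, e2] at e1
      unfold level at e1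
      omega
    have h4 := prod_descFactorial_eq_tupleCount hcutK.le hn (fun k => d k n)
      (fun k i => lab (1 - θ⁻¹) n (D k n) i ∈ B k) c (fun m => A m ω)
      (fun k hk hkK => by
        simp only [hddef, eq_of_cutoff_lt hK h1 hk hkK])
      (fun k hk hkK => by
        have h5 := lt_of_le_cutoff hK h1 hk hkK
        have e1 := hto k ⟨hk, by omega⟩
        have e2 := hto K ⟨hK, le_rfl⟩
        unfold level at e1 e2
        have : ((d k n : ℕ) : ℤ) < d K n := by omega
        exact_mod_cast this)
      (fun k hk k' hk' hne hdd i hi hi' => by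
        have h5 := hdj k hk k' hk' hdd
        rw [hDj n k k' h5] at hi
        exact Set.disjoint_left.1 (h3 k hk k' hk' hne h5) hi hi')
    refine Eq.trans ?_ (h4.trans ?_)
    · congr 1
      · refine Finset.prod_congr rfl fun k hk => ?_
        rw [Finset.mem_Icc] at hk
        have e := hto k ⟨hk.1, by omega⟩
        rw [← e]
        simp only [Nat.cast_inj]
        rfl
      · refine Finset.prod_congr rfl fun k hk => ?_
        rw [Finset.mem_Icc] at hk
        have e := hto k ⟨by omega, hk.2⟩
        rw [← e]
        simp only [Nat.cast_le]
        rfl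
    · congr 1
  -- the exact relation between the two normalisations
  have hval : ∀ᶠ n : ℕ in atTop, (∏ l : (Σ k : Finset.Icc 1 K, Fin (c k)),
      modeFactor θ (cutoff K (j n) < (l.1 : ℕ)) * (θ ^ d l.1 n / n)) *
        momentValue q₀ θ K n (j n) B c =
      ∏ l : (Σ k : Finset.Icc 1 K, Fin (c k)), (q₀ * Phi (B l.1)) := by
    filter_upwards [hj_mono, hlev0, eventually_ge_atTop 1] with n h1 h2 hn
    exact modeFactor_mul_momentValue hθ1 hK hn h1 B c h2
  have hmult : ∀ᶠ n : ℕ in atTop, (∏ l : (Σ k : Finset.Icc 1 K, Fin (c k)),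
      modeFactor θ (cutoff K (j n) < (l.1 : ℕ)) * (θ ^ d l.1 n / (n : ℝ))) ≠ 0 := by
    filter_upwards [eventually_ge_atTop 1] with n hn
    have hn' : (0 : ℝ) < n := by exact_mod_cast hn
    refine (Finset.prod_pos fun l _ => mul_pos (modeFactor_pos hθ1 _) ?_).ne'
    have : 0 < θ := by linarith
    positivity
  by_cases hzero : ∃ l : (Σ k : Finset.Icc 1 K, Fin (c k)), B l.1 = ∅
  · obtain ⟨l, hl⟩ := hzero
    refine Asymptotics.IsEquivalent.refl.congr_left ?_
    filter_upwards [hcount, hval, hmult] with n h1 h2 h3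
    have e1 : ∏ l : (Σ k : Finset.Icc 1 K, Fin (c k)), (q₀ * Phi (B l.1)) = 0 :=
      Finset.prod_eq_zero (Finset.mem_univ l) (by simp [hl, Phi])
    rw [e1] at h2
    rw [(mul_eq_zero.1 h2).resolve_left h3]
    simp_rw [h1]
    refine (integral_eq_zero_of_ae (ae_of_all _ fun ω => ?_)).symm
    refine Finset.sum_eq_zero fun v _ => Finset.prod_eq_zero (Finset.mem_univ l) ?_
    simp [hl]
  · push Not at hzero
    have hL : ∏ l : (Σ k : Finset.Icc 1 K, Fin (c k)), (q₀ * Phi (B l.1)) ≠ 0 :=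
      (Finset.prod_pos fun l _ => mul_pos hatom.q₀_mem.1
        (hB_pos _ (hmem l) (hzero l))).ne'
    refine Asymptotics.isEquivalent_of_tendsto_one ?_
    have h1 := hlim.div_const (∏ l : (Σ k : Finset.Icc 1 K, Fin (c k)), (q₀ * Phi (B l.1)))
    rw [div_self hL] at h1
    refine h1.congr' ?_
    filter_upwards [hcount, hval, hmult] with n h2 h3 h4
    rw [Pi.div_apply]
    simp_rw [h2]
    rw [← h3, mul_div_mul_left _ _ h4]

end WRT

theorem mainTheorem6 {Ω : Type*} [MeasurableSpace Ω] (P : Measure Ω) [IsProbabilityMeasure P]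
    (W : ℕ → Ω → ℝ) (A : ℕ → Ω → ℕ) (hT : WRT.IsWRT P W A)
    (q₀ : ℝ) (hatom : WRT.AtomCase P W q₀)
    (θ : ℝ) (hθ : θ = WRT.theta P W)
    (b : ℝ) (hb : b ∈ Set.Ioo 0 (θ / (θ - 1)))
    (K : ℕ) (hK : 1 ≤ K)
    -- `j n k` is the integer `j_k`, which may depend on `n`; only `1 ≤ k ≤ K` matters
    (j : ℕ → ℕ → ℤ)
    (hj_mono : ∀ᶠ n in atTop, MonotoneOn (j n) (Set.Icc 1 K))
    (hj_low : Tendsto (fun n : ℕ => (j n 1 : ℝ) + Real.logb θ n) atTop atTop)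
    (hj_up : ∀ᶠ n : ℕ in atTop, (j n K : ℝ) + Real.logb θ n < b * Real.log n)
    (B : ℕ → Set ℝ)
    (hB_meas : ∀ k ∈ Set.Icc 1 K, MeasurableSet (B k))
    (hB_frontier : ∀ k ∈ Set.Icc 1 K, WRT.Phi (frontier (B k)) = 0)
    (hB_pos : ∀ k ∈ Set.Icc 1 K, (B k).Nonempty → 0 < WRT.Phi (B k))
    (hB_disj : ∀ᶠ n in atTop, ∀ k ∈ Set.Icc 1 K, ∀ l ∈ Set.Icc 1 K,
      k ≠ l → j n k = j n l → Disjoint (B k) (B l))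
    (c : ℕ → ℕ) :
    ((fun n : ℕ => ∫ ω,
        (∏ k ∈ Finset.Icc 1 (WRT.cutoff K (j n)),
          ((WRT.X A θ n (j n k) (B k) ω).descFactorial (c k) : ℝ)) *
        ∏ k ∈ Finset.Icc (WRT.cutoff K (j n) + 1) K,
          ((WRT.XGe A θ n (j n k) (B k) ω).descFactorial (c k) : ℝ) ∂P)
      ~[atTop] fun n => WRT.momentValue q₀ θ K n (j n) B c) ∧
    ((∀ k ∈ Set.Icc 1 K,
        (fun n : ℕ => (j n k : ℝ)) =o[atTop] fun n : ℕ => √(Real.log n)) →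
      (fun n : ℕ => ∫ ω,
        (∏ k ∈ Finset.Icc 1 (WRT.cutoff K (j n)),
          ((WRT.XTilde A θ n (j n k) (B k) ω).descFactorial (c k) : ℝ)) *
        ∏ k ∈ Finset.Icc (WRT.cutoff K (j n) + 1) K,
          ((WRT.XTildeGe A θ n (j n k) (B k) ω).descFactorial (c k) : ℝ) ∂P)
      ~[atTop] fun n => WRT.momentValue q₀ θ K n (j n) B c) := by
  have hθ1 := hT.theta_gt_one hatom hθ
  have hθ0 : 0 < θ - 1 := by linarith
  have hlogθ : 0 < Real.log θ := Real.log_pos hθ1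
  have hmono : ∀ᶠ n : ℕ in atTop, ∀ k ∈ Set.Icc 1 K, j n 1 ≤ j n k ∧ j n k ≤ j n K := by
    filter_upwards [hj_mono] with n h k hk
    exact ⟨h ⟨le_rfl, hK⟩ hk hk.1, h hk ⟨hK, le_rfl⟩ hk.2⟩
  constructor
  -- Here `D` is the degree level itself, so the upper bound on the degrees, with `(1 - θ⁻¹) θ / (θ
  -- - 1) = 1`, already places the relevant labels above a power of `n`.
  · have hβ : (1 - θ⁻¹) * b < 1 := by
      have h1 := mul_lt_mul_of_pos_left hb.2 (WRT.one_sub_inv_pos hθ1)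
      have h2 : (1 - θ⁻¹) * (θ / (θ - 1)) = 1 := by field_simp
      linarith
    have h := hT.isEquivalent_momentValue hatom hθ hb.2 hβ hK hj_mono hj_low hj_up hB_meas
      hB_frontier hB_pos hB_disj c (D := fun k n => (WRT.level θ n (j n k) : ℝ))
      (fun n k k' h => by simp only [h])
      (fun k hk => by
        refine tendsto_atTop_mono' _ ?_ (tendsto_atTop_add_const_right _ (-1) hj_low)
        filter_upwards [hmono] with n h
        have h1 := WRT.lt_level θ n (j n k)
        have h2 : (j n 1 : ℝ) ≤ j n k := by exact_mod_cast (h k hk).1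
        linarith)
      (fun k hk => by
        filter_upwards [hj_up, hmono] with n h2 h3
        have h4 := WRT.level_le θ n (j n k)
        have h5 : (j n k : ℝ) ≤ j n K := by exact_mod_cast (h3 k hk).2
        linarith)
      (fun k _ => by simp)
    simp only [WRT.X_eq hθ1, WRT.XGe_eq hθ1]
    exact h
  · intro ho
    -- Here `D = log_θ n = log n / log θ`, and the condition amounts to `1 - θ⁻¹ < log θ`, the
    -- strict inequality `log u < u - 1` at `u = θ⁻¹`.
    have hβ : (1 - θ⁻¹) * (Real.log θ)⁻¹ < 1 := by
      rw [← div_eq_mul_inv, div_lt_one hlogθ]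
      have h1 := Real.log_lt_sub_one_of_pos (inv_pos.2 (zero_lt_one.trans hθ1))
        (inv_lt_one_of_one_lt₀ hθ1).ne
      rw [Real.log_inv] at h1
      linarith
    have hsqrt : Tendsto (fun n : ℕ => √(Real.logb θ n)) atTop atTop :=
      Real.tendsto_sqrt_atTop.comp (WRT.tendsto_logb_natCast hθ1)
    have h := hT.isEquivalent_momentValue hatom hθ hb.2 hβ hK hj_mono hj_low hj_up hB_meas
      hB_frontier hB_pos hB_disj c (D := fun _ n => Real.logb θ n) (fun _ _ _ _ => rfl)
      (fun k _ => WRT.tendsto_logb_natCast hθ1)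
      (fun k _ => .of_forall fun n => by rw [Real.logb, div_eq_inv_mul])
      (fun k hk => by
        -- The degree differs from `log_θ n` by `j_k` and a rounding error below one; `j_k = o(√(log
        -- n))` is exactly what makes this negligible on the scale `√D`.
        have h1 : Tendsto (fun n : ℕ => (j n k : ℝ) / √(Real.logb θ n)) atTop (𝓝 0) := by
          have h2 := (ho k hk).tendsto_div_nhds_zero.mul_const √(Real.log θ)
          rw [zero_mul] at h2
          refine h2.congr fun n => ?_
          rw [Real.logb, Real.sqrt_div' _ hlogθ.le]
          field_simp
        have h3 : Tendsto (fun n : ℕ => (⌊Real.logb θ n⌋ - Real.logb θ n) / √(Real.logb θ n))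
            atTop (𝓝 0) := by
          refine squeeze_zero_norm (fun n => ?_) (tendsto_inv_atTop_zero.comp hsqrt)
          rw [Real.norm_eq_abs, abs_div, abs_of_nonneg (Real.sqrt_nonneg _), div_eq_mul_inv]
          refine mul_le_of_le_one_left (inv_nonneg.2 (Real.sqrt_nonneg _)) ?_
          have h4 := Int.floor_le (Real.logb θ n)
          have h5 := Int.lt_floor_add_one (Real.logb θ n)
          rw [abs_le]
          constructor <;> linarith
        have h6 := h3.add h1
        rw [add_zero] at h6
        refine h6.congr fun n => ?_
        rw [← add_div, WRT.level]
        push_cast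
        ring)
    simp only [WRT.XTilde_eq hθ1, WRT.XTildeGe_eq hθ1]
    exact h
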